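/- **Setting.** Let $J$ and $r_1,\dots,r_J$ be fixed positive integers. For units $i=1,2,\dots$ and dates $t=1,2,\dots$ let $$x_{it}=f_t'\lambda_{ji}^0+e_{it}\quad\text{if } z_t=j,$$ where $z_t\in\{1,\dots,J\}$ is an unobserved state, $f_t$ is a random vector of length $r_{z_t}$, $e_{it}$ is a random error and $\lambda^0_{ji}\in\mathbb R^{r_j}$ are non-random loadings. Put $\Lambda_j^0=(\lambda^0_{j1},\dots,\lambda^0_{jN})'$, $x_t=(x_{1t},\dots,x_{Nt})'$, $P_A=A(A'A)^{-1}A'$, $M_A=I-P_A$. Assume that for some constants $M$, $\alpha>16$, $\beta\ge2$, and for all regimes $j$, units $i,k$, dates $t,s$ and sample sizes $N,T$ (with $i,k\le N$ and $t,s\le T$ where relevant): 1. (Factors) $\frac1{Tq_j^0}\sum_{t\le T}f_tf_t'1_{z_t=j}\to_p\Sigma_{F_j}$, positive definite; for every $\delta>0$ there is $c>0$ such that, with probability tending to one, $\frac1{|A|}\sum_{t\in A}f_tf_t'\ge cI$ for every set $A\subseteq\{t\le T:z_t=j\}$ with $|A|\ge\delta Tq^0_j$; $\mathbb E\|f_t\|^\alpha\le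 M$. 2. (Loadings) $\frac1N\Lambda_j^{0\prime}\Lambda^0_j\to\Sigma_{\Lambda_j}$, positive definite; $\|\lambda^0_{ji}\|\le M$; for some $C>0$ and all $j\ne k$, with probability tending to one as $(N,T)\to\infty$, $\frac1Nf_t'\Lambda_j^{0\prime}M_{\Lambda^0_k}\Lambda_j^0f_t\ge C$ for all $t\le T$ with $z_t=j$. 3. (Errors) $\mathbb E e_{it}=0$, $\mathbb E|e_{it}|^\alpha\le M$; $|\mathbb E(e_{it}e_{kt})|\le\tau_{ik}$ with $\sum_{k\le N}\tau_{ik}\le M$; $|\mathbb E(e_{it}e_{is})|\le\gamma_{ts}$ with $\sum_{s\le T}\gamma_{ts}\le M$; $\mathbb E|\frac1{\sqrt T}\sum_{t\le T}(e_{it}e_{kt}-\mathbb E(e_{it}e_{kt}))1_{z_t=j}|^2\le M$. 4. (States) $\frac1T\sum_{t\le T}1_{z_t=j}\to_pq_j^0\in(0,1)$. 5. (Moments) $\mathbb E\|\frac1{\sqrt N}\sum_{i\le N}\lambda^0_{ji}e_{it}\|^\beta\le M$ and $\mathbb E\|\frac1{\sqrt T}\sum_{t\le T}f_te_{it}1_{z_t=j}\|^2\le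 M$. 6. (Eigenvalues) The eigenvalues of $\Sigma_{\Lambda_j}^{1/2}\Sigma_{F_j}\Sigma_{\Lambda_j}^{1/2}$ are distinct. $V_j$ is the diagonal matrix of these eigenvalues in descending order, and the columns of $\Upsilon_j$ are corresponding orthonormal eigenvectors. 7. (Limit distributions) $\mathbb E\|\frac1{\sqrt{NT}}\sum_{k\le N}\sum_{t\le T}\lambda_{jk}^0(e_{it}e_{kt}-\mathbb E(e_{it}e_{kt}))1_{z_t=j}\|^2\le M$; $\mathbb E\|\frac1{\sqrt{NT}}\sum_{i\le N}\sum_{t\le T}(e_{it}e_{is}-\mathbb E(e_{it}e_{is}))f_t1_{z_t=j}\|^2\le M$; $\mathbb E\|\frac1{\sqrt{NT}}\sum_{k\le N}\sum_{t\le T}\lambda^0_{jk}f_t'e_{kt}1_{z_t=j}\|_F^2\le M$; $\frac1{\sqrt{Tq_j^0}}\sum_{t\le T}f_te_{it}1_{z_t=j}\to_d\mathcal N(0,\Phi_{ji})$ as $T\to\infty$; $\frac1N\sum_{i,k\le N}\lambda^0_{ji}\lambda^{0\prime}_{jk}\mathbb E(e_{it}e_{kt})\to\Gamma_{jt}$ and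 $\frac1{\sqrt N}\sum_{i\le N}\lambda^0_{ji}e_{it}\to_d\mathcal N(0,\Gamma_{jt})$ as $N\to\infty$. **Estimator.** Let $q_1,\dots,q_J$ be weights that sum to one and are bounded below by a positive constant (they may depend on the sample), and let $\hat\sigma^2>0$ be bounded and bounded away from zero in probability. Let $\hat\Lambda_j=(\hat\lambda_{j1},\dots,\hat\lambda_{jN})'$ ($N\times r_j$), $j\le J$, maximize over $(\Lambda_1,\dots,\Lambda_J)$ the Gaussian mixture log-likelihood $$\sum_{t=1}^T\log\sum_{j=1}^Jq_jL(x_t|\Lambda_j,\hat\sigma^2),\quad L(x|\Lambda,\sigma^2)=(2\pi)^{-N/2}|\Sigma|^{-1/2}e^{-\frac12x'\Sigma^{-1}x},\quad \Sigma=\Lambda\Lambda'+\sigma^2I_N,$$ normalized so that $\hat\Lambda_j'\hat\Lambda_j$ is diagonal with non-increasing diagonal. The regime labels and column signs, which the likelihood does not identify, are matched with the true model: $\sum_j\|M_{\hat\Lambda_j}\Lambda^0_j\|_F^2\le\sum_j\|M_{\hat\Lambda_{\pi(j)}}\Lambda^0_j\|_F^2$ for every permutation $\pi$ with $r_{\pi(j)}=r_j$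 for all $j$, and the diagonal entries of $\Upsilon_j'\Sigma_{\Lambda_j}^{-1/2}\Lambda_j^{0\prime}\hat\Lambda_j$ are nonnegative. Let $$\hat p_{tj}=\frac{q_jL(x_t|\hat\Lambda_j,\hat\sigma^2)}{\sum_kq_kL(x_t|\hat\Lambda_k,\hat\sigma^2)},\quad W_{jNT}=\Big(\tfrac{\hat\Lambda_j'\hat\Lambda_j}N+\tfrac{\hat\sigma^2}NI_{r_j}\Big)\tfrac1T\sum_{t\le T}\hat p_{tj},\quad H_j=\frac{\sum_{t\le T}f_tf_t'1_{z_t=j}}T\,\frac{\Lambda_j^{0\prime}\hat\Lambda_j}N\,W_{jNT}^{-1}.$$ **Theorem.** If $(N,T)\to\infty$ with $\sqrt T/N\to0$, $T^{16/\alpha}/N\to0$ and $T^{2/\alpha+2/\beta}/N\to0$, then for each $j$ and $i$ $$\sqrt{Tq_j^0}\,(\hat\lambda_{ji}-H_j'\lambda^0_{ji})\to_d\mathcal N\big(0,\;V_j^{-1/2}\Upsilon_j'\Sigma_{\Lambda_j}^{1/2}\Phi_{ji}\Sigma_{\Lambda_j}^{1/2}\Upsilon_jV_j^{-1/2}\big).$$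 -/

import Mathlib

open MeasureTheory ProbabilityTheory Filter Topology
open scoped MatrixOrder RealInnerProductSpace

namespace RegimeFactor

/-- Real vectors of length `r`, with the Euclidean norm. -/
abbrev Vec (r : ℕ) : Type := EuclideanSpace ℝ (Fin r)

/-- A factor model with regime switching in the loadings, on a probability space `Ω`: there are `J`
regimes, regime `j` having `r j` factors.  Dates and cross-section units are numbered from `0`, so
a sample of size `(N, T)` consists of the units `i < N` and the dates `t < T`.
The factor vector at date `t` is `f (z t ω) t ω`, a vector of length `r (z t ω)`; the values
`f j t ω` with `j ≠ z t ω` never enter anything below. -/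
structure Model (Ω : Type*) [MeasurableSpace Ω] (J : ℕ) (r : Fin J → ℕ) where
  /-- the regime at date `t` -/
  z : ℕ → Ω → Fin J
  /-- the factors at date `t`, when the regime is `j` -/
  f : (j : Fin J) → ℕ → Ω → Vec (r j)
  /-- the error `e i t` of unit `i` at date `t` -/
  e : ℕ → ℕ → Ω → ℝ
  /-- the true loadings of unit `i` in regime `j` -/
  lam : (j : Fin J) → ℕ → Vec (r j)
  measurable_z : ∀ t, Measurable (z t)
  measurable_f : ∀ j t, Measurable (f j t)
  measurable_e : ∀ i t, Measurable (e i t)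

section Matrices

/-- The `N × r` matrix whose rows are the first `N` loading vectors. -/
def loadMat {r : ℕ} (N : ℕ) (L : ℕ → Vec r) : Matrix (Fin N) (Fin r) ℝ :=
  Matrix.of fun i a => L i a

/-- The annihilator `M_A = I - A (A' A)⁻¹ A'`. -/
noncomputable def annihilator {N r : ℕ} (A : Matrix (Fin N) (Fin r) ℝ) :
    Matrix (Fin N) (Fin N) ℝ :=
  1 - A * (A.transpose * A)⁻¹ * A.transpose

/-- The squared Frobenius norm. -/
def frobSq {m n : ℕ} (A : Matrix (Fin m) (Fin n) ℝ) : ℝ :=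
  ∑ i, ∑ k, A i k ^ 2

end Matrices

section Likelihood

variable {J : ℕ} {r : Fin J → ℕ}

/-- The Gaussian density of `x ∈ ℝ^N` with mean zero and covariance matrix `Λ Λ' + s2 I`. -/
noncomputable def gaussDensity {N k : ℕ} (Λ : Matrix (Fin N) (Fin k) ℝ) (s2 : ℝ)
    (x : Fin N → ℝ) : ℝ :=
  let S : Matrix (Fin N) (Fin N) ℝ := Λ * Λ.transpose + s2 • (1 : Matrix (Fin N) (Fin N) ℝ)
  (2 * Real.pi) ^ (-(N : ℝ) / 2) * S.det ^ (-(1 / 2 : ℝ)) *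
    Real.exp (-(1 / 2) * (x ⬝ᵥ (S⁻¹.mulVec x)))

/-- The log-likelihood of the Gaussian mixture with weights `q`. -/
noncomputable def logLik {N : ℕ} (T : ℕ) (x : ℕ → Fin N → ℝ) (q : Fin J → ℝ) (s2 : ℝ)
    (Λ : (j : Fin J) → Matrix (Fin N) (Fin (r j)) ℝ) : ℝ :=
  ∑ t ∈ Finset.range T, Real.log (∑ j, q j * gaussDensity (Λ j) s2 (x t))

/-- The posterior probability of regime `j` given the observation `x`. -/
noncomputable def postProb {N : ℕ} (q : Fin J → ℝ) (s2 : ℝ)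
    (Λ : (j : Fin J) → Matrix (Fin N) (Fin (r j)) ℝ) (x : Fin N → ℝ) (j : Fin J) : ℝ :=
  q j * gaussDensity (Λ j) s2 x / ∑ k, q k * gaussDensity (Λ k) s2 x

end Likelihood

namespace Model

variable {Ω : Type*} [MeasurableSpace Ω] {J : ℕ} {r : Fin J → ℕ} (D : Model Ω J r)

/-- The observation `x_{it} = f_t' λ_{ji} + e_{it}`, where `j = z_t`. -/
noncomputable def x (N : ℕ) (ω : Ω) (t : ℕ) : Fin N → ℝ := fun i =>
  ⟪D.f (D.z t ω) t ω, D.lam (D.z t ω) i⟫ + D.e i t ω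

/-- The indicator of `z_t = j`. -/
def ind (j : Fin J) (t : ℕ) (ω : Ω) : ℝ := if D.z t ω = j then 1 else 0

/-- The matrix `∑_{t < T} f_t f_t' 1_{z_t = j}`. -/
noncomputable def factorGram (T : ℕ) (ω : Ω) (j : Fin J) : Matrix (Fin (r j)) (Fin (r j)) ℝ :=
  Matrix.of fun a b => ∑ t ∈ Finset.range T, D.f j t ω a * D.f j t ω b * D.ind j t ω

/-- The expectation of `e_{it} e_{ks}`. -/
noncomputable def errCov (P : Measure Ω) (i t k s : ℕ) : ℝ :=
  ∫ ω, D.e i t ω * D.e k s ω ∂P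

/-- `∑_{t < T} f_t e_{it} 1_{z_t = j}`. -/
noncomputable def score (T : ℕ) (ω : Ω) (j : Fin J) (i : ℕ) : Vec (r j) :=
  ∑ t ∈ Finset.range T, (D.e i t ω * D.ind j t ω) • D.f j t ω

/-- The conditions on factors, loadings, errors and regimes.  `q0` are the regime probabilities,
`SF j` and `SL j` the limits `Σ_{F_j}` and `Σ_{Λ_j}`, and `Phi j i` is the asymptotic covariance
matrix in the central limit theorem for `f_t e_{it} 1_{z_t = j}`. -/
structure Conditions (P : Measure Ω) [IsProbabilityMeasure P] (q0 : Fin J → ℝ)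
    (SF SL : (j : Fin J) → Matrix (Fin (r j)) (Fin (r j)) ℝ)
    (Phi : (j : Fin J) → ℕ → Matrix (Fin (r j)) (Fin (r j)) ℝ) (α β M : ℝ) : Prop where
  -- factors
  SF_posDef : ∀ j, (SF j).PosDef
  factor_plim : ∀ j a b, TendstoInMeasure P
    (fun (T : ℕ) ω => (1 / (T * q0 j)) * D.factorGram T ω j a b) atTop (fun _ => SF j a b)
  /-- Second moments over any non-negligible, possibly random, set `A` of dates of regime `j` are
  bounded away from singularity with probability tending to one. -/
  factor_subsets : ∀ j, ∀ δ : ℝ, 0 < δ → ∃ c : ℝ, 0 < c ∧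
    Tendsto (fun T : ℕ => P {ω | ∃ A ⊆ Finset.range T, (∀ t ∈ A, D.z t ω = j) ∧
        δ * (T * q0 j) ≤ A.card ∧
        ∃ v : Vec (r j), (1 / (A.card : ℝ)) * ∑ t ∈ A, ⟪v, D.f j t ω⟫ ^ 2 < c * ‖v‖ ^ 2})
      atTop (𝓝 0)
  alpha_gt : 16 < α
  factor_moment : ∀ t, ∫⁻ ω, ‖D.f (D.z t ω) t ω‖ₑ ^ α ∂P ≤ ENNReal.ofReal M
  -- loadings
  SL_posDef : ∀ j, (SL j).PosDef
  loading_lim : ∀ j, Tendsto (fun N : ℕ =>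
    (1 / (N : ℝ)) • ((loadMat N (D.lam j)).transpose * loadMat N (D.lam j))) atTop (𝓝 (SL j))
  loading_bdd : ∀ j i, ‖D.lam j i‖ ≤ M
  /-- With probability tending to one, for every date `t < T` of regime `j` and every `k ≠ j`,
  `f_t' Λ_j' M_{Λ_k} Λ_j f_t / N ≥ C`. -/
  identification : ∃ C : ℝ, 0 < C ∧ ∀ j k, j ≠ k →
    Tendsto (fun p : ℕ × ℕ => P {ω | ∃ t < p.2, D.z t ω = j ∧
        (1 / (p.1 : ℝ)) * ((D.f j t ω).ofLp ⬝ᵥ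
          ((loadMat p.1 (D.lam j)).transpose * annihilator (loadMat p.1 (D.lam k)) *
            loadMat p.1 (D.lam j)).mulVec (D.f j t ω).ofLp) < C})
      atTop (𝓝 0)
  -- errors
  error_mean : ∀ i t, ∫ ω, D.e i t ω ∂P = 0
  error_moment : ∀ i t, ∫⁻ ω, ‖D.e i t ω‖ₑ ^ α ∂P ≤ ENNReal.ofReal M
  error_cross : ∃ τ : ℕ → ℕ → ℝ, (∀ i k t, |D.errCov P i t k t| ≤ τ i k) ∧
    ∀ N i, ∑ k ∈ Finset.range N, τ i k ≤ M
  error_serial : ∃ γ : ℕ → ℕ → ℝ, (∀ i t s, |D.errCov P i t i s| ≤ γ t s) ∧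
    ∀ T t, ∑ s ∈ Finset.range T, γ t s ≤ M
  error_prod : ∀ (T : ℕ) i k j, ∫⁻ ω, ‖(1 / √(T : ℝ)) * ∑ t ∈ Finset.range T,
      (D.e i t ω * D.e k t ω - D.errCov P i t k t) * D.ind j t ω‖ₑ ^ 2 ∂P ≤ ENNReal.ofReal M
  -- regimes
  regime_freq : ∀ j, TendstoInMeasure P
    (fun (T : ℕ) ω => (1 / (T : ℝ)) * ∑ t ∈ Finset.range T, D.ind j t ω) atTop (fun _ => q0 j)
  q0_mem : ∀ j, 0 < q0 j ∧ q0 j < 1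
  -- moments
  beta_ge : 2 ≤ β
  moment_loading_error : ∀ (N : ℕ) j t, ∫⁻ ω, ‖(1 / √(N : ℝ)) • ∑ i ∈ Finset.range N,
      D.e i t ω • D.lam j i‖ₑ ^ β ∂P ≤ ENNReal.ofReal M
  moment_factor_error : ∀ (T : ℕ) j i,
    ∫⁻ ω, ‖(1 / √(T : ℝ)) • D.score T ω j i‖ₑ ^ 2 ∂P ≤ ENNReal.ofReal M
  -- double sums and limit distributions
  double_unit : ∀ (N T : ℕ) j, ∀ i < N, ∫⁻ ω, ‖(1 / √((N : ℝ) * T)) •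
      ∑ k ∈ Finset.range N, ∑ t ∈ Finset.range T,
        ((D.e i t ω * D.e k t ω - D.errCov P i t k t) * D.ind j t ω) • D.lam j k‖ₑ ^ 2 ∂P
    ≤ ENNReal.ofReal M
  double_date : ∀ (N T : ℕ) j, ∀ s < T, ∫⁻ ω, ‖(1 / √((N : ℝ) * T)) •
      ∑ i ∈ Finset.range N, ∑ t ∈ Finset.range T,
        ((D.e i t ω * D.e i s ω - D.errCov P i t i s) * D.ind j t ω) • D.f j t ω‖ₑ ^ 2 ∂P
    ≤ ENNReal.ofReal M
  double_mixed : ∀ (N T : ℕ) j, ∫⁻ ω, ENNReal.ofReal (frobSq ((1 / √((N : ℝ) * T)) •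
      ∑ k ∈ Finset.range N, Matrix.vecMulVec (D.lam j k).ofLp (D.score T ω j k).ofLp)) ∂P
    ≤ ENNReal.ofReal M
  Phi_posSemidef : ∀ j i, (Phi j i).PosSemidef
  clt_score : ∀ j i, TendstoInDistribution
    (fun (T : ℕ) ω => (1 / √(T * q0 j)) • D.score T ω j i) atTop
    id (fun _ => P) (multivariateGaussian 0 (Phi j i))
  clt_loading_error : ∀ j t, ∃ Gamma : Matrix (Fin (r j)) (Fin (r j)) ℝ, Gamma.PosSemidef ∧
    Tendsto (fun N : ℕ => (1 / (N : ℝ)) • ∑ i ∈ Finset.range N, ∑ k ∈ Finset.range N,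
      D.errCov P i t k t • Matrix.vecMulVec (D.lam j i).ofLp (D.lam j k).ofLp) atTop (𝓝 Gamma) ∧
    TendstoInDistribution
      (fun (N : ℕ) ω => (1 / √(N : ℝ)) • ∑ i ∈ Finset.range N, D.e i t ω • D.lam j i) atTop
      id (fun _ => P) (multivariateGaussian 0 Gamma)

/-- `L` is a quasi-maximum likelihood estimate of the loadings for the sample of size `(N, T)` at
`ω`, given the weights `q` and the error variance `s2`, normalized so that the `Λ_j' Λ_j` are
diagonal with decreasing diagonal. -/
structure IsQMLE (N T : ℕ) (ω : Ω) (q : Fin J → ℝ) (s2 : ℝ)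
    (L : (j : Fin J) → ℕ → Vec (r j)) : Prop where
  isMax : ∀ Λ : (j : Fin J) → Matrix (Fin N) (Fin (r j)) ℝ,
    logLik T (D.x N ω) q s2 Λ ≤ logLik T (D.x N ω) q s2 (fun j => loadMat N (L j))
  diag : ∀ j, ((loadMat N (L j)).transpose * loadMat N (L j)).IsDiag
  order : ∀ j, Antitone fun a => ((loadMat N (L j)).transpose * loadMat N (L j)) a a

/-- What the likelihood leaves undetermined is matched with the true model: the labels of the
regimes (among regimes with equally many factors), by a best fit of the loading spaces, and the
signs of the columns, by the signs of the chosen eigenvectors `U j`. -/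
structure Aligned (SL U : (j : Fin J) → Matrix (Fin (r j)) (Fin (r j)) ℝ) (N : ℕ)
    (L : (j : Fin J) → ℕ → Vec (r j)) : Prop where
  labels : ∀ π : Equiv.Perm (Fin J), (∀ j, r (π j) = r j) →
    ∑ j, frobSq (annihilator (loadMat N (L j)) * loadMat N (D.lam j)) ≤
      ∑ j, frobSq (annihilator (loadMat N (L (π j))) * loadMat N (D.lam j))
  signs : ∀ j a, 0 ≤ ((U j).transpose * (CFC.sqrt (SL j))⁻¹ *
    (loadMat N (D.lam j)).transpose * loadMat N (L j)) a a

/-- `W_{jNT} = (Λ̂_j' Λ̂_j / N + (s2 / N) I) (T⁻¹ ∑_t p̂_{tj})`. -/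
noncomputable def W (N T : ℕ) (ω : Ω) (q : Fin J → ℝ) (s2 : ℝ)
    (L : (j : Fin J) → ℕ → Vec (r j)) (j : Fin J) : Matrix (Fin (r j)) (Fin (r j)) ℝ :=
  ((1 / (T : ℝ)) * ∑ t ∈ Finset.range T,
      postProb q s2 (fun k => loadMat N (L k)) (D.x N ω t) j) •
    ((1 / (N : ℝ)) • ((loadMat N (L j)).transpose * loadMat N (L j)) +
      (s2 / N) • (1 : Matrix (Fin (r j)) (Fin (r j)) ℝ))

/-- `H_j = (T⁻¹ ∑_t f_t f_t' 1_{z_t = j}) (Λ_j' Λ̂_j / N) W_{jNT}⁻¹`. -/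
noncomputable def H (N T : ℕ) (ω : Ω) (q : Fin J → ℝ) (s2 : ℝ)
    (L : (j : Fin J) → ℕ → Vec (r j)) (j : Fin J) : Matrix (Fin (r j)) (Fin (r j)) ℝ :=
  ((1 / (T : ℝ)) • D.factorGram T ω j) *
    ((1 / (N : ℝ)) • ((loadMat N (D.lam j)).transpose * loadMat N (L j))) *
    (D.W N T ω q s2 L j)⁻¹

end Model

/-- `v` lists the eigenvalues of `SL^{1/2} SF SL^{1/2}` in strictly decreasing order, and the columns
of `U` are corresponding orthonormal eigenvectors. -/
structure IsEigen {k : ℕ} (SF SL : Matrix (Fin k) (Fin k) ℝ) (v : Fin k → ℝ)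
    (U : Matrix (Fin k) (Fin k) ℝ) : Prop where
  anti : StrictAnti v
  orthonormal : U.transpose * U = 1
  eigen : (CFC.sqrt SL * SF * CFC.sqrt SL) * U = U * Matrix.diagonal v

/-- `V^{-1/2} U' SL^{1/2} Φ SL^{1/2} U V^{-1/2}`, where `V = diag v`. -/
noncomputable def limitCov {k : ℕ} (SL : Matrix (Fin k) (Fin k) ℝ) (v : Fin k → ℝ)
    (U Phi : Matrix (Fin k) (Fin k) ℝ) : Matrix (Fin k) (Fin k) ℝ :=
  Matrix.diagonal (fun a => (√(v a))⁻¹) * U.transpose * CFC.sqrt SL * Phi * CFC.sqrt SL * U *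
    Matrix.diagonal (fun a => (√(v a))⁻¹)

end RegimeFactor

/-!
The estimate is the maximizer of a Gaussian mixture likelihood, which is not convex and whose first
order conditions alone do not locate it. The proof first finds the maximizer by comparing values of
the likelihood, and only then uses its stationarity.

**Consistency.** Up to constants, minus twice the log-density of an observation `x` under loadings
`Λ` is its `deviance`, the log-determinant `logDet` plus the residual `x' (I - B) x / s` of a ridge
regression on `Λ`, where `B = Λ (Λ' Λ + s I)⁻¹ Λ'` is the *soft projection* of `Λ`. Comparing the
maximum of the likelihood with its value at the true loadings, and attributing each date to the
component that fits it best, shows that the fitted loadings leave unexplained only `O(N T ρ)` of the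
common components, where `ρ = T^{-1/4} + N^{-1/2}` (`IsFit.exists_sum_resid_le`, `slack_isBigO`).
By pigeonhole, some component is in charge of a fixed share of the dates of a given regime; the
factors of these dates are well-conditioned, and hence this component fits the whole loading space
of the regime (`exists_component`). Two loading spaces cannot be fitted by one component of the
rank of either, since the regimes are identified (`Covers.eq`); a counting argument makes the
assignment of components to regimes a rank preserving permutation, and the alignment of the labels
makes it the identity (`misfit_le`).

**Classification.** Now the residual of every observation with respect to a wrong component exceeds
the one with respect to the right component by a multiple of `N`, uniformly over the dates
(`exists_resid_gap`). This is where the growth conditions that involve the largest of `T` factors,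
errors and error averages are used. The posterior probabilities are therefore exponentially close
to the indicators of the regimes (`post_sub_ind_le`), and misclassification is negligible.

**Principal components.** As in the EM algorithm, changing the loadings of one regime cannot lower
the deviance weighted by the posterior probabilities (`sum_post_deviance_le`). A quadratic majorant
of the weighted deviance then yields the principal components equation
`(∑ p_t x_t x_t') L = (∑ p_t) L (L' L + s I)` (`weightedGram_mul_of_min`). Its limit is the eigenvalue
problem of `Σ_Λ^{1/2} Σ_F Σ_Λ^{1/2}`. Limits of the rescaled loadings exist along ultrafilters by
compactness, and simple eigenvalues together with the order and sign conventions leave only one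
candidate (`IsEigen.eq_of_solution`, `tendsto_coord_spec`). The same equation, read off at the row of
one unit, expands the estimation error `L i - H' Λ i` into a linear image of the score
`∑ f_t e_it` over the dates of the regime, and a part that is negligible after multiplication by
`√T`, because `√T / N → 0` (`tendsto_expansion`).

**Probability.** All of this is a deterministic argument along a filter on pairs `(n, ω)`, for
samples that satisfy the structure `Regular`. The events whose probability tends to one form the
filter `whp P`, convergence along which is convergence in probability. Moment bounds provide
constants on events of probability close to one; on these, `Regular` holds along every filter finer
than `whp P` (`Conditions.regular`), and the conclusion transfers back by `InProb.tendsto`. The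
central limit theorem for the score, which is a hypothesis, and Slutsky's lemma give the limit
distribution.
-/

namespace RegimeFactor
section Analysis
open Matrix Asymptotics
open scoped Matrix.Norms.L2Operator

/-! ### Euclidean and operator norms -/

section Norms

variable {m n k : ℕ}

/-- The Euclidean norm of a plain coordinate vector. -/
noncomputable def nrm (v : Fin n → ℝ) : ℝ := ‖WithLp.toLp 2 v‖

lemma nrm_nonneg (v : Fin n → ℝ) : 0 ≤ nrm v := norm_nonneg _

lemma nrm_sq (v : Fin n → ℝ) : nrm v ^ 2 = v ⬝ᵥ v := by
  rw [nrm, EuclideanSpace.real_norm_sq_eq]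
  simp [dotProduct, sq]

lemma nrm_zero : nrm (0 : Fin n → ℝ) = 0 := by simp [nrm]

lemma nrm_add_le (u v : Fin n → ℝ) : nrm (u + v) ≤ nrm u + nrm v := by
  simpa [nrm, WithLp.toLp_add] using norm_add_le (WithLp.toLp 2 u) (WithLp.toLp 2 v)

lemma nrm_smul (c : ℝ) (v : Fin n → ℝ) : nrm (c • v) = |c| * nrm v := by
  simp [nrm, WithLp.toLp_smul, norm_smul]

lemma nrm_sum_le {ι : Type*} (s : Finset ι) (v : ι → Fin n → ℝ) :
    nrm (∑ i ∈ s, v i) ≤ ∑ i ∈ s, nrm (v i) := by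
  classical
  induction s using Finset.induction_on with
  | empty => simp [nrm_zero]
  | insert a s ha ih =>
    rw [Finset.sum_insert ha, Finset.sum_insert ha]
    exact (nrm_add_le _ _).trans (by linarith)

lemma abs_dot_le (u v : Fin n → ℝ) : |u ⬝ᵥ v| ≤ nrm u * nrm v := by
  have h := abs_real_inner_le_norm (WithLp.toLp 2 v) (WithLp.toLp 2 u)
  rw [EuclideanSpace.inner_eq_star_dotProduct] at h
  simpa [nrm, mul_comm] using h

lemma abs_apply_le_nrm (v : Fin n → ℝ) (i : Fin n) : |v i| ≤ nrm v := by
  apply abs_le_of_sq_le_sq _ (nrm_nonneg v)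
  rw [nrm_sq]
  simp only [dotProduct, ← sq]
  exact Finset.single_le_sum (f := fun i => v i ^ 2) (fun j _ => sq_nonneg _) (Finset.mem_univ i)

lemma nrm_le_of_sq_le {v : Fin n → ℝ} {c : ℝ} (hc : 0 ≤ c) (h : v ⬝ᵥ v ≤ c ^ 2) : nrm v ≤ c := by
  rw [← nrm_sq] at h
  exact (abs_le_of_sq_le_sq' h hc).2

lemma nrm_mulVec_le (A : Matrix (Fin m) (Fin n) ℝ) (v : Fin n → ℝ) :
    nrm (A *ᵥ v) ≤ ‖A‖ * nrm v := by
  simpa [nrm] using Matrix.l2_opNorm_mulVec A (WithLp.toLp 2 v)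

lemma opNorm_le_of_nrm {A : Matrix (Fin m) (Fin n) ℝ} {c : ℝ} (hc : 0 ≤ c)
    (h : ∀ v, nrm (A *ᵥ v) ≤ c * nrm v) : ‖A‖ ≤ c := by
  rw [Matrix.l2_opNorm_def]
  exact ContinuousLinearMap.opNorm_le_bound _ hc fun v => h v.ofLp

lemma opNorm_transpose (A : Matrix (Fin m) (Fin n) ℝ) : ‖Aᵀ‖ = ‖A‖ := by
  rw [← Matrix.l2_opNorm_conjTranspose A, conjTranspose_eq_transpose_of_trivial]

lemma opNorm_transpose_mul_self (A : Matrix (Fin m) (Fin n) ℝ) : ‖Aᵀ * A‖ = ‖A‖ ^ 2 := by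
  have := Matrix.l2_opNorm_conjTranspose_mul_self A
  rwa [conjTranspose_eq_transpose_of_trivial, ← sq] at this

lemma opNorm_mul_le {l : ℕ} (A : Matrix (Fin m) (Fin n) ℝ) (B : Matrix (Fin n) (Fin l) ℝ) :
    ‖A * B‖ ≤ ‖A‖ * ‖B‖ := Matrix.l2_opNorm_mul A B

lemma nrm_vecMul_le (A : Matrix (Fin m) (Fin n) ℝ) (v : Fin m → ℝ) :
    nrm (v ᵥ* A) ≤ nrm v * ‖A‖ := by
  rw [← mulVec_transpose, mul_comm, ← opNorm_transpose A]
  exact nrm_mulVec_le _ _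

lemma nrm_row_le (A : Matrix (Fin m) (Fin n) ℝ) (i : Fin m) : nrm (A i) ≤ ‖A‖ := by
  have h1 : A i = Pi.single i 1 ᵥ* A := by
    rw [single_one_vecMul]
    rfl
  rw [h1]
  refine (nrm_vecMul_le A _).trans (le_of_eq ?_)
  have : nrm (Pi.single i (1 : ℝ)) = 1 := by
    have h := nrm_sq (Pi.single i (1 : ℝ))
    simp only [dotProduct_single, Pi.single_eq_same, mul_one] at h
    nlinarith [nrm_nonneg (Pi.single i (1 : ℝ))]
  rw [this, one_mul]

lemma frobSq_nonneg (A : Matrix (Fin m) (Fin n) ℝ) : 0 ≤ frobSq A :=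
  Finset.sum_nonneg fun _ _ => Finset.sum_nonneg fun _ _ => sq_nonneg _

lemma frobSq_eq_sum_nrm_sq (A : Matrix (Fin m) (Fin n) ℝ) : frobSq A = ∑ i, nrm (A i) ^ 2 := by
  exact Finset.sum_congr rfl fun i _ => by rw [nrm_sq]; simp only [dotProduct, sq]

lemma trace_transpose_mul_self (A : Matrix (Fin m) (Fin n) ℝ) : (Aᵀ * A).trace = frobSq A := by
  simp only [trace, diag_apply, mul_apply, transpose_apply, frobSq, sq]
  exact Finset.sum_comm

lemma opNorm_sq_le_frobSq (A : Matrix (Fin m) (Fin n) ℝ) : ‖A‖ ^ 2 ≤ frobSq A := by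
  have : ‖A‖ ≤ √(frobSq A) := by
    refine opNorm_le_of_nrm (Real.sqrt_nonneg _) fun v => ?_
    refine nrm_le_of_sq_le (by positivity [nrm_nonneg v]) ?_
    rw [mul_pow, Real.sq_sqrt (frobSq_nonneg A), frobSq_eq_sum_nrm_sq, Finset.sum_mul, dotProduct]
    refine Finset.sum_le_sum fun i _ => ?_
    rw [← sq, ← mul_pow]
    exact sq_le_sq' (abs_le.1 (abs_dot_le (A i) v)).1 (abs_le.1 (abs_dot_le (A i) v)).2
  calc ‖A‖ ^ 2 ≤ √(frobSq A) ^ 2 := by gcongr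
    _ = frobSq A := Real.sq_sqrt (frobSq_nonneg A)

lemma abs_entry_le_opNorm (A : Matrix (Fin m) (Fin n) ℝ) (i : Fin m) (k : Fin n) :
    |A i k| ≤ ‖A‖ := (abs_apply_le_nrm (A i) k).trans (nrm_row_le A i)

lemma opNorm_vecMulVec_le (u : Fin m → ℝ) (v : Fin n → ℝ) : ‖vecMulVec u v‖ ≤ nrm u * nrm v := by
  refine opNorm_le_of_nrm (mul_nonneg (nrm_nonneg _) (nrm_nonneg _)) fun w => ?_
  have : vecMulVec u v *ᵥ w = (v ⬝ᵥ w) • u := by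
    ext i
    simp [vecMulVec_mulVec, mul_comm]
  rw [this, nrm_smul]
  have := abs_dot_le v w
  nlinarith [nrm_nonneg u, nrm_nonneg v, nrm_nonneg w]

lemma dot_mulVec_le (A : Matrix (Fin n) (Fin n) ℝ) (v : Fin n → ℝ) :
    v ⬝ᵥ (A *ᵥ v) ≤ ‖A‖ * nrm v ^ 2 := by
  have h1 := (le_abs_self _).trans (abs_dot_le v (A *ᵥ v))
  have h2 := nrm_mulVec_le A v
  nlinarith [nrm_nonneg v]

lemma abs_dot_mulVec_le (A : Matrix (Fin m) (Fin n) ℝ) (u : Fin m → ℝ) (v : Fin n → ℝ) :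
    |u ⬝ᵥ (A *ᵥ v)| ≤ ‖A‖ * nrm u * nrm v := by
  have h1 := abs_dot_le u (A *ᵥ v)
  have h2 := nrm_mulVec_le A v
  nlinarith [nrm_nonneg u]

/-- A positive semidefinite real matrix is a Gram matrix. -/
lemma exists_gram {Q : Matrix (Fin n) (Fin n) ℝ} (hQ : Q.PosSemidef) :
    ∃ D : Matrix (Fin n) (Fin n) ℝ, Q = Dᵀ * D := by
  obtain ⟨B, hB⟩ := CStarAlgebra.nonneg_iff_eq_star_mul_self.mp hQ.nonneg
  exact ⟨B, by rw [hB, star_eq_conjTranspose, conjTranspose_eq_transpose_of_trivial]⟩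

lemma trace_mul_gram (G : Matrix (Fin n) (Fin n) ℝ) (D : Matrix (Fin m) (Fin n) ℝ) :
    (G * (Dᵀ * D)).trace = ∑ i, D i ⬝ᵥ (G *ᵥ D i) := by
  rw [← Matrix.mul_assoc, trace_mul_comm, trace]
  refine Finset.sum_congr rfl fun i _ => ?_
  rw [diag_apply, mul_apply, dotProduct]
  refine Finset.sum_congr rfl fun k _ => ?_
  simp [mul_apply, mulVec, dotProduct]

lemma trace_mul_le_of_posSemidef (G : Matrix (Fin n) (Fin n) ℝ) {Q : Matrix (Fin n) (Fin n) ℝ}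
    (hQ : Q.PosSemidef) : (G * Q).trace ≤ ‖G‖ * Q.trace := by
  obtain ⟨D, rfl⟩ := exists_gram hQ
  rw [trace_mul_gram, trace_transpose_mul_self, frobSq_eq_sum_nrm_sq, Finset.mul_sum]
  exact Finset.sum_le_sum fun i _ => dot_mulVec_le G (D i)

lemma posSemidef_of_dot {A : Matrix (Fin n) (Fin n) ℝ} (h : Aᵀ = A)
    (h' : ∀ x : Fin n → ℝ, 0 ≤ x ⬝ᵥ (A *ᵥ x)) : A.PosSemidef := by
  refine PosSemidef.of_dotProduct_mulVec_nonneg ?_ (by simpa using h')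
  rw [IsHermitian, conjTranspose_eq_transpose_of_trivial, h]

lemma dot_nonneg_of_posSemidef {A : Matrix (Fin n) (Fin n) ℝ} (h : A.PosSemidef)
    (x : Fin n → ℝ) : 0 ≤ x ⬝ᵥ (A *ᵥ x) := by simpa using h.dotProduct_mulVec_nonneg x

lemma transpose_eq_of_posSemidef {A : Matrix (Fin n) (Fin n) ℝ} (h : A.PosSemidef) : Aᵀ = A := by
  have := h.1
  rwa [IsHermitian, conjTranspose_eq_transpose_of_trivial] at this

/-- The trace of a positive definite matrix dominates the logarithm of its determinant. -/
lemma log_det_le_trace {Z : Matrix (Fin n) (Fin n) ℝ} (hZ : Z.PosDef) :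
    Real.log Z.det ≤ Z.trace - n := by
  have hh := hZ.1
  have hd := hh.det_eq_prod_eigenvalues
  have ht := hh.trace_eq_sum_eigenvalues
  simp only [RCLike.ofReal_real_eq_id, id_eq] at hd ht
  rw [hd, ht, Real.log_prod (fun i _ => (hZ.eigenvalues_pos i).ne')]
  calc ∑ i, Real.log (hh.eigenvalues i) ≤ ∑ i, (hh.eigenvalues i - 1) :=
        Finset.sum_le_sum fun i _ => Real.log_le_sub_one_of_pos (hZ.eigenvalues_pos i)
    _ = _ := by simp

end Norms

/-! ### Soft projections and the Gaussian density -/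

section Soft

variable {N k : ℕ}

/-- The matrix `Λ (Λ' Λ + s I)⁻¹ Λ'`, a shrunken version of the projection on the column space
of `Λ`. -/
noncomputable def softProj (Λ : Matrix (Fin N) (Fin k) ℝ) (s : ℝ) : Matrix (Fin N) (Fin N) ℝ :=
  Λ * (Λᵀ * Λ + s • 1)⁻¹ * Λᵀ

/-- The squared residual `x' (I - B) x`, where `B` is the soft projection of `Λ`. -/
noncomputable def resid (Λ : Matrix (Fin N) (Fin k) ℝ) (s : ℝ) (x : Fin N → ℝ) : ℝ :=
  x ⬝ᵥ x - x ⬝ᵥ (softProj Λ s *ᵥ x)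

/-- `log det (I + Λ' Λ / s)`. -/
noncomputable def logDet (Λ : Matrix (Fin N) (Fin k) ℝ) (s : ℝ) : ℝ :=
  Real.log (1 + s⁻¹ • (Λᵀ * Λ)).det

lemma gramShift_posDef (Λ : Matrix (Fin N) (Fin k) ℝ) {s : ℝ} (hs : 0 < s) :
    (Λᵀ * Λ + s • (1 : Matrix (Fin k) (Fin k) ℝ)).PosDef := by
  refine PosDef.posSemidef_add ?_ (PosDef.one.smul hs)
  rw [← conjTranspose_eq_transpose_of_trivial]
  exact posSemidef_conjTranspose_mul_self Λ

lemma isUnit_det_gramShift (Λ : Matrix (Fin N) (Fin k) ℝ) {s : ℝ} (hs : 0 < s) :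
    IsUnit (Λᵀ * Λ + s • (1 : Matrix (Fin k) (Fin k) ℝ)).det :=
  (gramShift_posDef Λ hs).det_pos.ne'.isUnit

lemma transpose_inv_gramShift (Λ : Matrix (Fin N) (Fin k) ℝ) (s : ℝ) :
    ((Λᵀ * Λ + s • (1 : Matrix (Fin k) (Fin k) ℝ))⁻¹)ᵀ = (Λᵀ * Λ + s • 1)⁻¹ := by
  rw [transpose_nonsing_inv]
  simp [transpose_mul]

lemma transpose_softProj (Λ : Matrix (Fin N) (Fin k) ℝ) (s : ℝ) :
    (softProj Λ s)ᵀ = softProj Λ s := by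
  simp only [softProj, transpose_mul, transpose_inv_gramShift, transpose_transpose,
    Matrix.mul_assoc]

lemma gram_mul_inv_gramShift (Λ : Matrix (Fin N) (Fin k) ℝ) {s : ℝ} (hs : 0 < s) :
    Λᵀ * Λ * (Λᵀ * Λ + s • (1 : Matrix (Fin k) (Fin k) ℝ))⁻¹ =
      1 - s • (Λᵀ * Λ + s • (1 : Matrix (Fin k) (Fin k) ℝ))⁻¹ := by
  have h := mul_nonsing_inv _ (isUnit_det_gramShift Λ hs)
  rw [Matrix.add_mul, smul_mul, Matrix.one_mul] at h
  exact eq_sub_of_add_eq h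

lemma gram_mul_softProj (Λ : Matrix (Fin N) (Fin k) ℝ) {s : ℝ} (hs : 0 < s) :
    Λ * Λᵀ * softProj Λ s = Λ * Λᵀ - s • softProj Λ s := by
  calc Λ * Λᵀ * softProj Λ s
      = Λ * (Λᵀ * Λ * (Λᵀ * Λ + s • (1 : Matrix (Fin k) (Fin k) ℝ))⁻¹) * Λᵀ := by
        simp only [softProj, Matrix.mul_assoc]
    _ = _ := by
        rw [gram_mul_inv_gramShift Λ hs, Matrix.mul_sub, Matrix.sub_mul, Matrix.mul_one]
        simp only [softProj, Matrix.mul_smul, Matrix.smul_mul]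

lemma inv_gram_add (Λ : Matrix (Fin N) (Fin k) ℝ) {s : ℝ} (hs : 0 < s) :
    (Λ * Λᵀ + s • (1 : Matrix (Fin N) (Fin N) ℝ))⁻¹ = s⁻¹ • (1 - softProj Λ s) := by
  apply inv_eq_right_inv
  rw [Matrix.mul_smul, Matrix.mul_sub, Matrix.mul_one, Matrix.add_mul, gram_mul_softProj Λ hs,
    smul_mul, Matrix.one_mul]
  have : Λ * Λᵀ + s • (1 : Matrix (Fin N) (Fin N) ℝ) -
      (Λ * Λᵀ - s • softProj Λ s + s • softProj Λ s) = s • 1 := by abel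
  rw [this, smul_smul, inv_mul_cancel₀ hs.ne', one_smul]

lemma dot_softProj (Λ : Matrix (Fin N) (Fin k) ℝ) (s : ℝ) (x : Fin N → ℝ) :
    x ⬝ᵥ (softProj Λ s *ᵥ x) =
      (Λᵀ *ᵥ x) ⬝ᵥ ((Λᵀ * Λ + s • (1 : Matrix (Fin k) (Fin k) ℝ))⁻¹ *ᵥ (Λᵀ *ᵥ x)) := by
  rw [softProj, ← mulVec_mulVec, ← mulVec_mulVec, dotProduct_mulVec x Λ, mulVec_transpose]

/-- Completing the square in the penalized least squares problem of regressing `x` on `Λ`. -/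
lemma penalized_sq_eq (Λ : Matrix (Fin N) (Fin k) ℝ) {s : ℝ} (hs : 0 < s) (x : Fin N → ℝ)
    (g : Fin k → ℝ) :
    (x - Λ *ᵥ g) ⬝ᵥ (x - Λ *ᵥ g) + s * (g ⬝ᵥ g) = resid Λ s x +
      (g - (Λᵀ * Λ + s • (1 : Matrix (Fin k) (Fin k) ℝ))⁻¹ *ᵥ (Λᵀ *ᵥ x)) ⬝ᵥ
        ((Λᵀ * Λ + s • (1 : Matrix (Fin k) (Fin k) ℝ)) *ᵥ
          (g - (Λᵀ * Λ + s • (1 : Matrix (Fin k) (Fin k) ℝ))⁻¹ *ᵥ (Λᵀ *ᵥ x))) := by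
  rw [resid, dot_softProj]
  set y := Λᵀ *ᵥ x with hy
  set C := Λᵀ * Λ + s • (1 : Matrix (Fin k) (Fin k) ℝ) with hC
  set g0 := C⁻¹ *ᵥ y with hg0
  have h0 : C *ᵥ g0 = y := by
    rw [hg0, mulVec_mulVec, mul_nonsing_inv _ (isUnit_det_gramShift Λ hs), one_mulVec]
  have hCt : Cᵀ = C := by simp [hC, transpose_mul]
  have h1 : g0 ⬝ᵥ (C *ᵥ g) = y ⬝ᵥ g := by
    rw [dotProduct_mulVec, ← mulVec_transpose, hCt, h0]
  have h2 : g ⬝ᵥ (C *ᵥ g) = (Λ *ᵥ g) ⬝ᵥ (Λ *ᵥ g) + s * (g ⬝ᵥ g) := by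
    rw [hC, add_mulVec, dotProduct_add, smul_mulVec, one_mulVec, dotProduct_smul, smul_eq_mul,
      ← mulVec_mulVec, dotProduct_mulVec g Λᵀ, vecMul_transpose]
  have h3 : x ⬝ᵥ (Λ *ᵥ g) = y ⬝ᵥ g := by rw [dotProduct_mulVec, hy, mulVec_transpose]
  simp only [mulVec_sub, sub_dotProduct, dotProduct_sub, h0, h1, h2, h3]
  rw [dotProduct_comm (Λ *ᵥ g) x, h3, dotProduct_comm g y, dotProduct_comm g0 y]
  ring

lemma resid_le (Λ : Matrix (Fin N) (Fin k) ℝ) {s : ℝ} (hs : 0 < s) (x : Fin N → ℝ)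
    (g : Fin k → ℝ) :
    resid Λ s x ≤ (x - Λ *ᵥ g) ⬝ᵥ (x - Λ *ᵥ g) + s * (g ⬝ᵥ g) := by
  rw [penalized_sq_eq Λ hs x g]
  exact le_add_of_nonneg_right
    (dot_nonneg_of_posSemidef (gramShift_posDef Λ hs).posSemidef _)

lemma resid_eq (Λ : Matrix (Fin N) (Fin k) ℝ) {s : ℝ} (hs : 0 < s) (x : Fin N → ℝ)
    {g : Fin k → ℝ} (hg : g = (Λᵀ * Λ + s • (1 : Matrix (Fin k) (Fin k) ℝ))⁻¹ *ᵥ (Λᵀ *ᵥ x)) :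
    resid Λ s x = (x - Λ *ᵥ g) ⬝ᵥ (x - Λ *ᵥ g) + s * (g ⬝ᵥ g) := by
  rw [penalized_sq_eq Λ hs x g, hg, sub_self, zero_dotProduct, add_zero]

lemma resid_nonneg (Λ : Matrix (Fin N) (Fin k) ℝ) {s : ℝ} (hs : 0 < s) (x : Fin N → ℝ) :
    0 ≤ resid Λ s x := by
  rw [resid_eq Λ hs x rfl, ← nrm_sq, ← nrm_sq]
  positivity

/-- `B² ≤ B` for a soft projection `B`. -/
lemma nrm_softProj_sq_le (Λ : Matrix (Fin N) (Fin k) ℝ) {s : ℝ} (hs : 0 < s) (x : Fin N → ℝ) :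
    nrm (softProj Λ s *ᵥ x) ^ 2 ≤ x ⬝ᵥ (softProj Λ s *ᵥ x) := by
  set C := Λᵀ * Λ + s • (1 : Matrix (Fin k) (Fin k) ℝ) with hC
  set g := C⁻¹ *ᵥ (Λᵀ *ᵥ x) with hg
  have hB : softProj Λ s *ᵥ x = Λ *ᵥ g := by
    rw [softProj, ← mulVec_mulVec, ← mulVec_mulVec]
  have h1 := resid_eq Λ hs x hg
  rw [resid, hB] at h1
  rw [hB, nrm_sq]
  simp only [sub_dotProduct, dotProduct_sub] at h1
  rw [dotProduct_comm (Λ *ᵥ g) x] at h1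
  have h2 : 0 ≤ s * (g ⬝ᵥ g) := by rw [← nrm_sq]; positivity
  linarith

lemma softProj_dot_nonneg (Λ : Matrix (Fin N) (Fin k) ℝ) {s : ℝ} (hs : 0 < s) (x : Fin N → ℝ) :
    0 ≤ x ⬝ᵥ (softProj Λ s *ᵥ x) := (sq_nonneg _).trans (nrm_softProj_sq_le Λ hs x)

lemma nrm_softProj_le (Λ : Matrix (Fin N) (Fin k) ℝ) {s : ℝ} (hs : 0 < s) (x : Fin N → ℝ) :
    nrm (softProj Λ s *ᵥ x) ≤ nrm x := by
  have h1 := nrm_softProj_sq_le Λ hs x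
  have h2 := (le_abs_self _).trans (abs_dot_le x (softProj Λ s *ᵥ x))
  by_contra! h
  nlinarith [nrm_nonneg x]

lemma softProj_posSemidef (Λ : Matrix (Fin N) (Fin k) ℝ) {s : ℝ} (hs : 0 < s) :
    (softProj Λ s).PosSemidef :=
  posSemidef_of_dot (transpose_softProj Λ s) (softProj_dot_nonneg Λ hs)

lemma dot_one_sub_softProj (Λ : Matrix (Fin N) (Fin k) ℝ) (s : ℝ) (x : Fin N → ℝ) :
    x ⬝ᵥ ((1 - softProj Λ s) *ᵥ x) = resid Λ s x := by
  rw [sub_mulVec, one_mulVec, dotProduct_sub, resid]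

lemma one_sub_softProj_posSemidef (Λ : Matrix (Fin N) (Fin k) ℝ) {s : ℝ} (hs : 0 < s) :
    (1 - softProj Λ s).PosSemidef := by
  refine posSemidef_of_dot (by simp [transpose_softProj]) fun x => ?_
  rw [dot_one_sub_softProj]
  exact resid_nonneg Λ hs x

/-- `A² ≤ A` for the complement `A` of a soft projection. -/
lemma nrm_one_sub_softProj_sq_le (Λ : Matrix (Fin N) (Fin k) ℝ) {s : ℝ} (hs : 0 < s)
    (x : Fin N → ℝ) : nrm ((1 - softProj Λ s) *ᵥ x) ^ 2 ≤ resid Λ s x := by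
  have h := nrm_softProj_sq_le Λ hs x
  rw [nrm_sq] at h ⊢
  rw [sub_mulVec, one_mulVec, resid]
  simp only [sub_dotProduct, dotProduct_sub]
  rw [dotProduct_comm (softProj Λ s *ᵥ x) x]
  linarith

lemma trace_softProj (Λ : Matrix (Fin N) (Fin k) ℝ) {s : ℝ} (hs : 0 < s) :
    (softProj Λ s).trace =
      k - s * (Λᵀ * Λ + s • (1 : Matrix (Fin k) (Fin k) ℝ))⁻¹.trace := by
  rw [softProj, trace_mul_comm, ← Matrix.mul_assoc, gram_mul_inv_gramShift Λ hs]
  simp [trace_sub, trace_smul]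

lemma trace_softProj_le (Λ : Matrix (Fin N) (Fin k) ℝ) {s : ℝ} (hs : 0 < s) :
    (softProj Λ s).trace ≤ k := by
  rw [trace_softProj Λ hs]
  have := (gramShift_posDef Λ hs).inv.posSemidef.trace_nonneg
  nlinarith

lemma frobSq_softProj_le (Λ : Matrix (Fin N) (Fin k) ℝ) {s : ℝ} (hs : 0 < s) :
    frobSq (softProj Λ s) ≤ (softProj Λ s).trace := by
  rw [frobSq_eq_sum_nrm_sq, trace]
  refine Finset.sum_le_sum fun i _ => ?_
  have h := nrm_softProj_sq_le Λ hs (Pi.single i 1)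
  have h1 : softProj Λ s *ᵥ Pi.single i 1 = softProj Λ s i := by
    rw [mulVec_single_one]
    conv_rhs => rw [← transpose_softProj Λ s]
    rfl
  rw [h1, single_one_dotProduct] at h
  exact h

lemma det_one_add_pos (Λ : Matrix (Fin N) (Fin k) ℝ) {s : ℝ} (hs : 0 < s) :
    0 < (1 + s⁻¹ • (Λᵀ * Λ)).det := by
  have h : (1 : Matrix (Fin k) (Fin k) ℝ) + s⁻¹ • (Λᵀ * Λ) = s⁻¹ • (Λᵀ * Λ + s • 1) := by
    rw [smul_add, smul_smul, inv_mul_cancel₀ hs.ne', one_smul, add_comm]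
  rw [h]
  exact ((gramShift_posDef Λ hs).smul (inv_pos.2 hs)).det_pos

/-- `log det Z ≥ k - tr Z⁻¹`, for `Z = I + Λ' Λ / s`. -/
lemma trace_softProj_le_logDet (Λ : Matrix (Fin N) (Fin k) ℝ) {s : ℝ} (hs : 0 < s) :
    (softProj Λ s).trace ≤ logDet Λ s := by
  set C := Λᵀ * Λ + s • (1 : Matrix (Fin k) (Fin k) ℝ) with hC
  have h := log_det_le_trace (((gramShift_posDef Λ hs).inv).smul hs)
  have h1 : (1 : Matrix (Fin k) (Fin k) ℝ) + s⁻¹ • (Λᵀ * Λ) = s⁻¹ • C := by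
    rw [hC, smul_add, smul_smul, inv_mul_cancel₀ hs.ne', one_smul, add_comm]
  have h2 : (s • C⁻¹).det = ((1 : Matrix (Fin k) (Fin k) ℝ) + s⁻¹ • (Λᵀ * Λ)).det⁻¹ := by
    rw [h1, det_smul, det_smul, det_nonsing_inv, Ring.inverse_eq_inv', mul_inv, inv_pow, inv_inv]
  rw [h2, Real.log_inv, trace_smul, smul_eq_mul] at h
  rw [trace_softProj Λ hs, logDet]
  linarith

lemma logDet_nonneg (Λ : Matrix (Fin N) (Fin k) ℝ) {s : ℝ} (hs : 0 < s) :
    0 ≤ logDet Λ s :=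
  (softProj_posSemidef Λ hs).trace_nonneg.trans (trace_softProj_le_logDet Λ hs)

/-- The normalizing constant of the Gaussian density that does not depend on the loadings. -/
noncomputable def gaussConst (N : ℕ) (s : ℝ) : ℝ :=
  (2 * Real.pi) ^ (-(N : ℝ) / 2) * (s ^ N) ^ (-(1 / 2 : ℝ))

lemma gaussConst_pos (N : ℕ) {s : ℝ} (hs : 0 < s) : 0 < gaussConst N s := by
  unfold gaussConst
  positivity

/-- The deviance of an observation: minus twice its log-density, up to a constant. -/
noncomputable def deviance (Λ : Matrix (Fin N) (Fin k) ℝ) (s : ℝ) (x : Fin N → ℝ) : ℝ :=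
  logDet Λ s + resid Λ s x / s

lemma gaussDensity_eq (Λ : Matrix (Fin N) (Fin k) ℝ) {s : ℝ} (hs : 0 < s) (x : Fin N → ℝ) :
    gaussDensity Λ s x = gaussConst N s * Real.exp (-(deviance Λ s x / 2)) := by
  have hdet : (Λ * Λᵀ + s • (1 : Matrix (Fin N) (Fin N) ℝ)).det =
      s ^ N * (1 + s⁻¹ • (Λᵀ * Λ)).det := by
    have h : Λ * Λᵀ + s • (1 : Matrix (Fin N) (Fin N) ℝ) = s • (1 + (s⁻¹ • Λ) * Λᵀ) := by
      rw [smul_add, Matrix.smul_mul, smul_smul, mul_inv_cancel₀ hs.ne', one_smul, add_comm]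
    rw [h, det_smul, det_one_add_mul_comm, Matrix.mul_smul, Fintype.card_fin]
  have hpos := det_one_add_pos Λ hs
  have hexp : (1 + s⁻¹ • (Λᵀ * Λ)).det ^ (-(1 / 2 : ℝ)) = Real.exp (-(logDet Λ s / 2)) := by
    rw [Real.rpow_def_of_pos hpos, logDet]
    congr 1
    ring
  have hq : x ⬝ᵥ ((Λ * Λᵀ + s • (1 : Matrix (Fin N) (Fin N) ℝ))⁻¹ *ᵥ x) = resid Λ s x / s := by
    rw [inv_gram_add Λ hs, smul_mulVec, dotProduct_smul, dot_one_sub_softProj, smul_eq_mul,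
      div_eq_inv_mul]
  simp only [gaussDensity]
  rw [hq, hdet, Real.mul_rpow (by positivity) hpos.le, hexp, gaussConst, deviance]
  rw [show -((logDet Λ s + resid Λ s x / s) / 2) =
    -(logDet Λ s / 2) + -(1 / 2) * (resid Λ s x / s) by ring, Real.exp_add]
  ring

/-- The tangent bound of `log det` at `c I`, with `log c` replaced by `c`. For `c = √N` it shows that
the log-determinant is `O(√N)`. -/
lemma logDet_le (Λ : Matrix (Fin N) (Fin k) ℝ) {s c : ℝ} (hs : 0 < s) (hc : 1 ≤ c) :
    logDet Λ s ≤ k * c + (k + s⁻¹ * frobSq Λ) / c := by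
  have hc0 : 0 < c := by linarith
  have h : (1 : Matrix (Fin k) (Fin k) ℝ) + s⁻¹ • (Λᵀ * Λ) = s⁻¹ • (Λᵀ * Λ + s • 1) := by
    rw [smul_add, smul_smul, inv_mul_cancel₀ hs.ne', one_smul, add_comm]
  have hpd : (c⁻¹ • (1 + s⁻¹ • (Λᵀ * Λ)) : Matrix (Fin k) (Fin k) ℝ).PosDef := by
    rw [h]
    exact ((gramShift_posDef Λ hs).smul (inv_pos.2 hs)).smul (inv_pos.2 hc0)
  have h1 := log_det_le_trace hpd
  rw [det_smul, Fintype.card_fin, Real.log_mul (by positivity) (det_one_add_pos Λ hs).ne',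
    Real.log_pow, Real.log_inv, trace_smul, trace_add, trace_one, trace_smul,
    trace_transpose_mul_self, Fintype.card_fin] at h1
  have h2 : Real.log c ≤ c := (Real.log_le_sub_one_of_pos hc0).trans (by linarith)
  have h3 : (k : ℝ) * Real.log c ≤ k * c := by gcongr
  simp only [smul_eq_mul] at h1
  rw [div_eq_inv_mul, logDet]
  have : (0 : ℝ) ≤ k := by positivity
  linarith

end Soft

/-! ### Projections and the distance to soft projections -/

section Projections

variable {N k l : ℕ}

/-- The projection `Λ (Λ' Λ)⁻¹ Λ'` on the column space of `Λ`. -/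
noncomputable def proj (Λ : Matrix (Fin N) (Fin k) ℝ) : Matrix (Fin N) (Fin N) ℝ :=
  Λ * (Λᵀ * Λ)⁻¹ * Λᵀ

lemma annihilator_eq (Λ : Matrix (Fin N) (Fin k) ℝ) : annihilator Λ = 1 - proj Λ := rfl

lemma transpose_proj (Λ : Matrix (Fin N) (Fin k) ℝ) : (proj Λ)ᵀ = proj Λ := by
  simp only [proj, transpose_mul, transpose_nonsing_inv, transpose_transpose, Matrix.mul_assoc]

lemma proj_mul_self {Λ : Matrix (Fin N) (Fin k) ℝ} (h : IsUnit (Λᵀ * Λ).det) :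
    proj Λ * proj Λ = proj Λ := by
  calc proj Λ * proj Λ = Λ * ((Λᵀ * Λ)⁻¹ * (Λᵀ * Λ)) * (Λᵀ * Λ)⁻¹ * Λᵀ := by
        simp only [proj, Matrix.mul_assoc]
    _ = proj Λ := by rw [nonsing_inv_mul _ h, Matrix.mul_one, proj]

lemma transpose_annihilator (Λ : Matrix (Fin N) (Fin k) ℝ) :
    (annihilator Λ)ᵀ = annihilator Λ := by
  rw [annihilator_eq, transpose_sub, transpose_proj, transpose_one]

lemma annihilator_mul_self {Λ : Matrix (Fin N) (Fin k) ℝ} (h : IsUnit (Λᵀ * Λ).det) :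
    annihilator Λ * annihilator Λ = annihilator Λ := by
  rw [annihilator_eq, Matrix.sub_mul, Matrix.one_mul, Matrix.mul_sub, Matrix.mul_one,
    proj_mul_self h, sub_self, sub_zero]

lemma trace_proj {Λ : Matrix (Fin N) (Fin k) ℝ} (h : IsUnit (Λᵀ * Λ).det) :
    (proj Λ).trace = k := by
  rw [proj, trace_mul_comm, ← Matrix.mul_assoc, mul_nonsing_inv _ h]
  simp

lemma proj_mul {Λ : Matrix (Fin N) (Fin k) ℝ} (h : IsUnit (Λᵀ * Λ).det) :
    proj Λ * Λ = Λ := by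
  rw [proj, Matrix.mul_assoc, Matrix.mul_assoc, nonsing_inv_mul _ h, Matrix.mul_one]

lemma nrm_proj_mulVec_sq {Λ : Matrix (Fin N) (Fin k) ℝ} (h : IsUnit (Λᵀ * Λ).det)
    (x : Fin N → ℝ) : nrm (proj Λ *ᵥ x) ^ 2 = x ⬝ᵥ (proj Λ *ᵥ x) := by
  rw [nrm_sq, dotProduct_mulVec, ← mulVec_transpose, transpose_proj, mulVec_mulVec,
    proj_mul_self h, dotProduct_comm]

lemma nrm_proj_mulVec_sq_le {Λ : Matrix (Fin N) (Fin k) ℝ} (h : IsUnit (Λᵀ * Λ).det)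
    (x : Fin N → ℝ) : nrm (proj Λ *ᵥ x) ^ 2 ≤ ‖(Λᵀ * Λ)⁻¹‖ * nrm (Λᵀ *ᵥ x) ^ 2 := by
  rw [nrm_proj_mulVec_sq h, proj, ← mulVec_mulVec, ← mulVec_mulVec, dotProduct_mulVec x Λ,
    ← mulVec_transpose]
  exact dot_mulVec_le _ _

/-- The total squared residual of the columns of `Λ` regressed on `L`. -/
noncomputable def misfit (L : Matrix (Fin N) (Fin l) ℝ) (s : ℝ) (Λ : Matrix (Fin N) (Fin k) ℝ) :
    ℝ := (Λᵀ * (1 - softProj L s) * Λ).trace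

lemma misfit_posSemidef (L : Matrix (Fin N) (Fin l) ℝ) {s : ℝ} (hs : 0 < s)
    (Λ : Matrix (Fin N) (Fin k) ℝ) : (Λᵀ * (1 - softProj L s) * Λ).PosSemidef := by
  have := (one_sub_softProj_posSemidef L hs).conjTranspose_mul_mul_same Λ
  rwa [conjTranspose_eq_transpose_of_trivial] at this

lemma misfit_nonneg (L : Matrix (Fin N) (Fin l) ℝ) {s : ℝ} (hs : 0 < s)
    (Λ : Matrix (Fin N) (Fin k) ℝ) : 0 ≤ misfit L s Λ :=
  (misfit_posSemidef L hs Λ).trace_nonneg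

lemma dot_misfit (L : Matrix (Fin N) (Fin l) ℝ) (s : ℝ) (Λ : Matrix (Fin N) (Fin k) ℝ)
    (v : Fin k → ℝ) :
    v ⬝ᵥ ((Λᵀ * (1 - softProj L s) * Λ) *ᵥ v) = resid L s (Λ *ᵥ v) := by
  rw [← dot_one_sub_softProj, ← mulVec_mulVec, ← mulVec_mulVec, dotProduct_mulVec v,
    vecMul_transpose]

lemma resid_le_misfit (L : Matrix (Fin N) (Fin l) ℝ) {s : ℝ} (hs : 0 < s)
    (Λ : Matrix (Fin N) (Fin k) ℝ) (v : Fin k → ℝ) :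
    resid L s (Λ *ᵥ v) ≤ misfit L s Λ * nrm v ^ 2 := by
  obtain ⟨D, hD⟩ := exists_gram (misfit_posSemidef L hs Λ)
  rw [← dot_misfit, misfit, hD, trace_transpose_mul_self, ← mulVec_mulVec, dotProduct_mulVec,
    vecMul_transpose, ← nrm_sq]
  calc nrm (D *ᵥ v) ^ 2 ≤ (‖D‖ * nrm v) ^ 2 := by
        gcongr
        · exact nrm_nonneg _
        · exact nrm_mulVec_le D v
    _ = ‖D‖ ^ 2 * nrm v ^ 2 := by ring
    _ ≤ _ := by gcongr; exact opNorm_sq_le_frobSq D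

/-- Averaging over dates whose factors have a well-conditioned second moment matrix recovers the
misfit of the whole loading space. -/
lemma misfit_le_sum_resid (L : Matrix (Fin N) (Fin l) ℝ) {s : ℝ} (hs : 0 < s)
    (Λ : Matrix (Fin N) (Fin k) ℝ) (A : Finset ℕ) (f : ℕ → Fin k → ℝ) {c : ℝ}
    (hc : ∀ v : Fin k → ℝ, c * nrm v ^ 2 ≤ ∑ t ∈ A, (v ⬝ᵥ f t) ^ 2) :
    c * misfit L s Λ ≤ ∑ t ∈ A, resid L s (Λ *ᵥ f t) := by
  obtain ⟨D, hD⟩ := exists_gram (misfit_posSemidef L hs Λ)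
  have h1 : ∀ t, resid L s (Λ *ᵥ f t) = ∑ i, (D i ⬝ᵥ f t) ^ 2 := fun t => by
    rw [← dot_misfit, hD, ← mulVec_mulVec, dotProduct_mulVec, vecMul_transpose]
    simp only [dotProduct, mulVec, sq]
  rw [misfit, hD, trace_transpose_mul_self, frobSq_eq_sum_nrm_sq, Finset.mul_sum]
  simp_rw [h1]
  rw [Finset.sum_comm]
  exact Finset.sum_le_sum fun i _ => hc (D i)

lemma trace_proj_mul (L : Matrix (Fin N) (Fin l) ℝ) (s : ℝ) (Λ : Matrix (Fin N) (Fin k) ℝ) :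
    (proj Λ * (1 - softProj L s)).trace =
      ((Λᵀ * Λ)⁻¹ * (Λᵀ * (1 - softProj L s) * Λ)).trace := by
  rw [proj, Matrix.mul_assoc (Λ * _), Matrix.mul_assoc Λ, trace_mul_comm]
  simp only [Matrix.mul_assoc]

lemma trace_proj_mul_le (L : Matrix (Fin N) (Fin l) ℝ) {s : ℝ} (hs : 0 < s)
    (Λ : Matrix (Fin N) (Fin k) ℝ) :
    (proj Λ * (1 - softProj L s)).trace ≤ ‖(Λᵀ * Λ)⁻¹‖ * misfit L s Λ := by
  rw [trace_proj_mul]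
  exact trace_mul_le_of_posSemidef _ (misfit_posSemidef L hs Λ)

/-- If the column space of `Λ` is well fitted by `L`, and the ranks agree, the soft projection of
`L` is close to the projection on the column space of `Λ`. -/
lemma frobSq_proj_sub_softProj_le (L : Matrix (Fin N) (Fin l) ℝ) {s : ℝ} (hs : 0 < s)
    {Λ : Matrix (Fin N) (Fin k) ℝ} (h : IsUnit (Λᵀ * Λ).det) :
    frobSq (proj Λ - softProj L s) ≤
      (softProj L s).trace - k + 2 * (‖(Λᵀ * Λ)⁻¹‖ * misfit L s Λ) := by
  have h1 := trace_proj_mul_le L hs Λ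
  have h2 := frobSq_softProj_le L hs
  rw [← trace_transpose_mul_self] at h2 ⊢
  rw [transpose_softProj] at h2
  rw [transpose_sub, transpose_proj, transpose_softProj, Matrix.sub_mul, Matrix.mul_sub,
    Matrix.mul_sub, proj_mul_self h, trace_sub, trace_sub, trace_sub,
    trace_mul_comm (softProj L s) (proj Λ), trace_proj h]
  rw [Matrix.mul_sub, Matrix.mul_one, trace_sub, trace_proj h] at h1
  linarith

/-- A soft projection which fits `k` dimensions has trace almost `k`. -/
lemma le_trace_softProj (L : Matrix (Fin N) (Fin l) ℝ) {s : ℝ} (hs : 0 < s)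
    {Λ : Matrix (Fin N) (Fin k) ℝ} (h : IsUnit (Λᵀ * Λ).det) :
    k - 2 * (‖(Λᵀ * Λ)⁻¹‖ * misfit L s Λ) ≤ (softProj L s).trace := by
  have := frobSq_proj_sub_softProj_le L hs h
  linarith [frobSq_nonneg (proj Λ - softProj L s)]

/-- The residual of the projection on the column space of `L` is the least squares residual. -/
lemma annihilator_dot_le (L : Matrix (Fin N) (Fin l) ℝ) {s : ℝ} (hs : 0 < s)
    (h : IsUnit (Lᵀ * L).det) (x : Fin N → ℝ) :
    x ⬝ᵥ (annihilator L *ᵥ x) ≤ resid L s x := by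
  set g := (Lᵀ * L + s • (1 : Matrix (Fin l) (Fin l) ℝ))⁻¹ *ᵥ (Lᵀ *ᵥ x)
  rw [resid_eq L hs x (g := g) rfl]
  have hL : annihilator L *ᵥ (L *ᵥ g) = 0 := by
    rw [mulVec_mulVec, annihilator_eq, Matrix.sub_mul, proj_mul h]
    simp
  have hq : ∀ y, y ⬝ᵥ (annihilator L *ᵥ y) = y ⬝ᵥ y - nrm (proj L *ᵥ y) ^ 2 := fun y => by
    rw [annihilator_eq, sub_mulVec, one_mulVec, dotProduct_sub, nrm_proj_mulVec_sq h]
  have h1 : x ⬝ᵥ (annihilator L *ᵥ x) =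
      (x - L *ᵥ g) ⬝ᵥ (annihilator L *ᵥ (x - L *ᵥ g)) := by
    rw [mulVec_sub, hL, sub_zero, sub_dotProduct, dotProduct_mulVec (L *ᵥ g),
      ← mulVec_transpose, transpose_annihilator, hL, zero_dotProduct, sub_zero]
  rw [h1, hq]
  have h2 : 0 ≤ s * (g ⬝ᵥ g) := by rw [← nrm_sq]; positivity
  linarith [sq_nonneg (nrm (proj L *ᵥ (x - L *ᵥ g)))]

lemma frobSq_annihilator_mul {L : Matrix (Fin N) (Fin l) ℝ} (h : IsUnit (Lᵀ * L).det)
    (Λ : Matrix (Fin N) (Fin k) ℝ) :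
    frobSq (annihilator L * Λ) = (Λᵀ * annihilator L * Λ).trace := by
  rw [← trace_transpose_mul_self, transpose_mul, transpose_annihilator,
    Matrix.mul_assoc, ← Matrix.mul_assoc (annihilator L), annihilator_mul_self h, Matrix.mul_assoc]

/-- Shrinking lowers a projection. -/
lemma proj_sub_softProj_posSemidef {L : Matrix (Fin N) (Fin l) ℝ} {s : ℝ} (hs : 0 < s)
    (h : IsUnit (Lᵀ * L).det) : (proj L - softProj L s).PosSemidef := by
  refine posSemidef_of_dot (by rw [transpose_sub, transpose_proj, transpose_softProj]) fun x => ?_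
  have h1 := annihilator_dot_le L hs h x
  rw [annihilator_eq, sub_mulVec, one_mulVec, dotProduct_sub, resid] at h1
  rw [sub_mulVec, dotProduct_sub]
  linarith

/-- The hard projection on the columns of `L` fits better than the soft one. -/
lemma frobSq_annihilator_mul_le {L : Matrix (Fin N) (Fin l) ℝ} {s : ℝ} (hs : 0 < s)
    (h : IsUnit (Lᵀ * L).det) (Λ : Matrix (Fin N) (Fin k) ℝ) :
    frobSq (annihilator L * Λ) ≤ misfit L s Λ := by
  have h1 := ((proj_sub_softProj_posSemidef hs h).conjTranspose_mul_mul_same Λ).trace_nonneg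
  have h2 : Λᴴ * (proj L - softProj L s) * Λ =
      Λᵀ * (1 - softProj L s) * Λ - Λᵀ * annihilator L * Λ := by
    rw [conjTranspose_eq_transpose_of_trivial, ← Matrix.sub_mul, ← Matrix.mul_sub, annihilator_eq]
    congr 2
    abel
  rw [frobSq_annihilator_mul h, misfit]
  rw [h2, trace_sub] at h1
  linarith

/-- The soft projection fits almost as well as the hard one when its trace is almost the number `l`
of columns of `L`. -/
lemma misfit_le_frobSq_annihilator {L : Matrix (Fin N) (Fin l) ℝ} {s : ℝ} (hs : 0 < s)
    (h : IsUnit (Lᵀ * L).det) (Λ : Matrix (Fin N) (Fin k) ℝ) :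
    misfit L s Λ ≤ frobSq (annihilator L * Λ) + ‖Λ‖ ^ 2 * (l - (softProj L s).trace) := by
  have h1 := trace_mul_le_of_posSemidef (Λ * Λᵀ) (proj_sub_softProj_posSemidef hs h)
  have h2 : (Λ * Λᵀ * (proj L - softProj L s)).trace =
      (Λᵀ * (1 - softProj L s) * Λ).trace - (Λᵀ * annihilator L * Λ).trace := by
    rw [Matrix.mul_assoc, trace_mul_comm, ← trace_sub, ← Matrix.sub_mul, ← Matrix.mul_sub,
      annihilator_eq]
    congr 3
    abel
  have h3 : ‖Λ * Λᵀ‖ = ‖Λ‖ ^ 2 := by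
    have := opNorm_transpose_mul_self Λᵀ
    rwa [transpose_transpose, opNorm_transpose] at this
  rw [h2, h3, trace_sub, trace_proj h] at h1
  rw [frobSq_annihilator_mul h, misfit]
  linarith

end Projections

section DiagonalGram

variable {N k : ℕ}

/-- The squared column norms of `L`. -/
def gramDiag (L : Matrix (Fin N) (Fin k) ℝ) (a : Fin k) : ℝ := (Lᵀ * L) a a

lemma gramDiag_nonneg (L : Matrix (Fin N) (Fin k) ℝ) (a : Fin k) : 0 ≤ gramDiag L a := by
  simp only [gramDiag, mul_apply, transpose_apply]
  exact Finset.sum_nonneg fun i _ => mul_self_nonneg _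

lemma gram_eq_diagonal {L : Matrix (Fin N) (Fin k) ℝ} (h : (Lᵀ * L).IsDiag) :
    Lᵀ * L = diagonal (gramDiag L) := h.diagonal_diag.symm

lemma gramShift_eq_diagonal {L : Matrix (Fin N) (Fin k) ℝ} (h : (Lᵀ * L).IsDiag) (s : ℝ) :
    Lᵀ * L + s • (1 : Matrix (Fin k) (Fin k) ℝ) = diagonal (fun a => gramDiag L a + s) := by
  rw [gram_eq_diagonal h, smul_one_eq_diagonal, diagonal_add]

lemma inv_gramShift_eq_diagonal {L : Matrix (Fin N) (Fin k) ℝ} (h : (Lᵀ * L).IsDiag) {s : ℝ}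
    (hs : 0 < s) : (Lᵀ * L + s • (1 : Matrix (Fin k) (Fin k) ℝ))⁻¹ =
      diagonal (fun a => (gramDiag L a + s)⁻¹) := by
  apply inv_eq_right_inv
  rw [gramShift_eq_diagonal h, diagonal_mul_diagonal, ← diagonal_one]
  congr 1
  ext a
  exact mul_inv_cancel₀ (by linarith [gramDiag_nonneg L a])

lemma trace_softProj_eq_sum {L : Matrix (Fin N) (Fin k) ℝ} (h : (Lᵀ * L).IsDiag) {s : ℝ}
    (hs : 0 < s) : (softProj L s).trace = ∑ a, (1 - s * (gramDiag L a + s)⁻¹) := by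
  rw [trace_softProj L hs, inv_gramShift_eq_diagonal h hs, trace_diagonal, Finset.mul_sum,
    Finset.sum_sub_distrib]
  simp

/-- A nearly full trace of the soft projection forces all columns of `L` to be nonzero, hence, being
orthogonal, to be independent. -/
lemma isUnit_det_of_trace {L : Matrix (Fin N) (Fin k) ℝ} (h : (Lᵀ * L).IsDiag) {s : ℝ}
    (hs : 0 < s) (htr : (k : ℝ) - 1 < (softProj L s).trace) : IsUnit (Lᵀ * L).det := by
  rw [gram_eq_diagonal h, det_diagonal, isUnit_iff_ne_zero, Finset.prod_ne_zero_iff]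
  intro a _ ha
  rw [trace_softProj_eq_sum h hs, ← Finset.add_sum_erase _ _ (Finset.mem_univ a), ha, zero_add,
    mul_inv_cancel₀ hs.ne', sub_self, zero_add] at htr
  have h1 : ∑ b ∈ Finset.univ.erase a, (1 - s * (gramDiag L b + s)⁻¹) ≤
      ∑ b ∈ Finset.univ.erase a, (1 : ℝ) := Finset.sum_le_sum fun b _ => by
    have := gramDiag_nonneg L b
    have : 0 ≤ s * (gramDiag L b + s)⁻¹ := by positivity
    linarith
  rw [Finset.sum_const, Finset.card_erase_of_mem (Finset.mem_univ a), Finset.card_univ,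
    Fintype.card_fin, nsmul_eq_mul, mul_one, Nat.cast_sub (Nat.one_le_of_lt a.2)] at h1
  simp only [Nat.cast_one] at h1
  linarith

/-- `L` with its columns rescaled so that their Gram matrix is almost the identity. -/
noncomputable def scaled (L : Matrix (Fin N) (Fin k) ℝ) (s : ℝ) : Matrix (Fin N) (Fin k) ℝ :=
  L * diagonal fun a => (√(gramDiag L a + s))⁻¹

lemma scaled_mul_transpose {L : Matrix (Fin N) (Fin k) ℝ} (h : (Lᵀ * L).IsDiag) {s : ℝ}
    (hs : 0 < s) : scaled L s * (scaled L s)ᵀ = softProj L s := by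
  rw [softProj, inv_gramShift_eq_diagonal h hs, scaled, transpose_mul, diagonal_transpose,
    Matrix.mul_assoc, ← Matrix.mul_assoc (diagonal _) (diagonal _), diagonal_mul_diagonal,
    ← Matrix.mul_assoc]
  congr 3
  ext a
  rw [← mul_inv, Real.mul_self_sqrt (by linarith [gramDiag_nonneg L a])]

lemma scaled_mul_sqrt (L : Matrix (Fin N) (Fin k) ℝ) {s : ℝ} (hs : 0 < s) :
    scaled L s * diagonal (fun a => √(gramDiag L a + s)) = L := by
  rw [scaled, Matrix.mul_assoc, diagonal_mul_diagonal]
  have : (fun a => (√(gramDiag L a + s))⁻¹ * √(gramDiag L a + s)) = fun _ => 1 := by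
    ext a
    have := gramDiag_nonneg L a
    exact inv_mul_cancel₀ (by positivity)
  rw [this, diagonal_one, Matrix.mul_one]

lemma opNorm_scaled_le {L : Matrix (Fin N) (Fin k) ℝ} (h : (Lᵀ * L).IsDiag) {s : ℝ}
    (hs : 0 < s) : ‖scaled L s‖ ≤ 1 := by
  have h1 : ‖softProj L s‖ ≤ 1 :=
    opNorm_le_of_nrm zero_le_one fun v => by simpa using nrm_softProj_le L hs v
  have h2 := opNorm_transpose_mul_self (scaled L s)ᵀ
  rw [transpose_transpose, opNorm_transpose, scaled_mul_transpose h hs] at h2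
  nlinarith [norm_nonneg (scaled L s)]

end DiagonalGram

/-! ### The mixture likelihood and its maximizer -/

section Likelihood

variable {N k l : ℕ}

lemma resid_add (L : Matrix (Fin N) (Fin k) ℝ) (s : ℝ) (w e : Fin N → ℝ) :
    resid L s (w + e) =
      resid L s w + 2 * (w ⬝ᵥ e - w ⬝ᵥ (softProj L s *ᵥ e)) + resid L s e := by
  have h : e ⬝ᵥ (softProj L s *ᵥ w) = w ⬝ᵥ (softProj L s *ᵥ e) := by
    rw [dotProduct_mulVec, ← mulVec_transpose, transpose_softProj, dotProduct_comm]
  simp only [resid, mulVec_add, add_dotProduct, dotProduct_add]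
  rw [h, dotProduct_comm e w]
  ring

/-- The tangent bound that expresses the concavity of `log det` in the Gram matrix. -/
lemma logDet_sub_le {L : Matrix (Fin N) (Fin k) ℝ} (h : (Lᵀ * L).IsDiag) {s : ℝ} (hs : 0 < s)
    (Λ : Matrix (Fin N) (Fin k) ℝ) :
    logDet Λ s - logDet L s ≤
      ((Lᵀ * L + s • (1 : Matrix (Fin k) (Fin k) ℝ))⁻¹ * (Λᵀ * Λ - Lᵀ * L)).trace := by
  set c : Fin k → ℝ := fun a => gramDiag L a + s with hc
  have hcpos : ∀ a, 0 < c a := fun a => by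
    have := gramDiag_nonneg L a
    simp only [hc]; linarith
  -- `E` is the inverse square root of `L' L + s I`; the claim is `log det Z ≤ tr Z - k` for
  -- `Z = E (Λ' Λ + s I) E`.
  set E : Matrix (Fin k) (Fin k) ℝ := diagonal fun a => (√(c a))⁻¹ with hE
  have hEE : E * E = (Lᵀ * L + s • (1 : Matrix (Fin k) (Fin k) ℝ))⁻¹ := by
    rw [inv_gramShift_eq_diagonal h hs, hE, diagonal_mul_diagonal]
    congr 1
    ext a
    rw [← mul_inv, Real.mul_self_sqrt (hcpos a).le]
  have hEt : Eᴴ = E := by rw [conjTranspose_eq_transpose_of_trivial, hE, diagonal_transpose]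
  have hEdet : E.det ≠ 0 := by
    rw [hE, det_diagonal, Finset.prod_ne_zero_iff]
    intro a _
    exact (inv_pos.2 (Real.sqrt_pos.2 (hcpos a))).ne'
  have hinj : Function.Injective E.mulVec :=
    mulVec_injective_iff_isUnit.2 ((isUnit_iff_isUnit_det E).2 hEdet.isUnit)
  have hZ : (E * (Λᵀ * Λ + s • (1 : Matrix (Fin k) (Fin k) ℝ)) * E).PosDef := by
    have := (gramShift_posDef Λ hs).conjTranspose_mul_mul_same hinj
    rwa [hEt] at this
  have h1 := log_det_le_trace hZ
  have hdet : ∀ A : Matrix (Fin N) (Fin k) ℝ, logDet A s =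
      k * Real.log s⁻¹ + Real.log (Aᵀ * A + s • (1 : Matrix (Fin k) (Fin k) ℝ)).det := by
    intro A
    have h2 : (1 : Matrix (Fin k) (Fin k) ℝ) + s⁻¹ • (Aᵀ * A) = s⁻¹ • (Aᵀ * A + s • 1) := by
      rw [smul_add, smul_smul, inv_mul_cancel₀ hs.ne', one_smul, add_comm]
    rw [logDet, h2, det_smul, Fintype.card_fin, Real.log_mul (by positivity)
      (gramShift_posDef A hs).det_pos.ne', Real.log_pow]
  have hCdet : E.det * E.det * (Lᵀ * L + s • (1 : Matrix (Fin k) (Fin k) ℝ)).det = 1 := by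
    rw [← det_mul, hEE, ← det_mul, nonsing_inv_mul _ (isUnit_det_gramShift L hs), det_one]
  have hlog : Real.log (E * (Λᵀ * Λ + s • (1 : Matrix (Fin k) (Fin k) ℝ)) * E).det =
      logDet Λ s - logDet L s := by
    have hCL := (gramShift_posDef L hs).det_pos
    have hEsq : E.det * E.det = ((Lᵀ * L + s • (1 : Matrix (Fin k) (Fin k) ℝ)).det)⁻¹ :=
      eq_inv_of_mul_eq_one_left hCdet
    rw [det_mul, det_mul, mul_right_comm, hEsq, Real.log_mul (inv_pos.2 hCL).ne'
      (gramShift_posDef Λ hs).det_pos.ne', Real.log_inv, hdet, hdet]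
    ring
  have htr : (E * (Λᵀ * Λ + s • (1 : Matrix (Fin k) (Fin k) ℝ)) * E).trace - k =
      ((Lᵀ * L + s • (1 : Matrix (Fin k) (Fin k) ℝ))⁻¹ * (Λᵀ * Λ - Lᵀ * L)).trace := by
    have h3 : Λᵀ * Λ - Lᵀ * L = (Λᵀ * Λ + s • (1 : Matrix (Fin k) (Fin k) ℝ)) -
        (Lᵀ * L + s • (1 : Matrix (Fin k) (Fin k) ℝ)) := by abel
    rw [trace_mul_comm, ← Matrix.mul_assoc, hEE, h3, Matrix.mul_sub, trace_sub,
      nonsing_inv_mul _ (isUnit_det_gramShift L hs), trace_one, Fintype.card_fin]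
  rw [hlog, htr] at h1
  exact h1

variable {J : ℕ} {r : Fin J → ℕ}

lemma sum_gauss_pos {q : Fin J → ℝ} (hq : ∀ j, 0 < q j) {s : ℝ} (hs : 0 < s)
    (L : (j : Fin J) → Matrix (Fin N) (Fin (r j)) ℝ) (x : Fin N → ℝ) (j : Fin J) :
    0 < ∑ k, q k * gaussDensity (L k) s x := by
  refine Finset.sum_pos (fun k _ => ?_) ⟨j, Finset.mem_univ j⟩
  rw [gaussDensity_eq _ hs]
  exact mul_pos (hq k) (mul_pos (gaussConst_pos N hs) (Real.exp_pos _))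

lemma postProb_nonneg {q : Fin J → ℝ} (hq : ∀ j, 0 < q j) {s : ℝ} (hs : 0 < s)
    (L : (j : Fin J) → Matrix (Fin N) (Fin (r j)) ℝ) (x : Fin N → ℝ) (j : Fin J) :
    0 ≤ postProb q s L x j := by
  refine div_nonneg (mul_nonneg (hq j).le ?_) (sum_gauss_pos hq hs L x j).le
  rw [gaussDensity_eq _ hs]
  exact mul_nonneg (gaussConst_pos N hs).le (Real.exp_pos _).le

lemma sum_postProb {q : Fin J → ℝ} (hq : ∀ j, 0 < q j) {s : ℝ} (hs : 0 < s)
    (L : (j : Fin J) → Matrix (Fin N) (Fin (r j)) ℝ) (x : Fin N → ℝ) (j : Fin J) :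
    ∑ k, postProb q s L x k = 1 := by
  simp only [postProb]
  rw [← Finset.sum_div, div_self (sum_gauss_pos hq hs L x j).ne']

/-- A posterior probability is small when the deviance of another regime is much smaller. -/
lemma postProb_le {q : Fin J → ℝ} (hq : ∀ j, 0 < q j) {s : ℝ} (hs : 0 < s)
    (L : (j : Fin J) → Matrix (Fin N) (Fin (r j)) ℝ) (x : Fin N → ℝ) (j k : Fin J) :
    postProb q s L x k ≤
      q k / q j * Real.exp (-((deviance (L k) s x - deviance (L j) s x) / 2)) := by
  have hc := gaussConst_pos N hs
  have h0 : ∀ k, 0 ≤ q k * gaussDensity (L k) s x := fun k => by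
    rw [gaussDensity_eq _ hs]
    exact mul_nonneg (hq k).le (mul_pos hc (Real.exp_pos _)).le
  have h1 : q j * gaussDensity (L j) s x ≤ ∑ k, q k * gaussDensity (L k) s x :=
    Finset.single_le_sum (f := fun k => q k * gaussDensity (L k) s x) (fun k _ => h0 k)
      (Finset.mem_univ j)
  have h2 : 0 < q j * gaussDensity (L j) s x := by
    rw [gaussDensity_eq _ hs]
    exact mul_pos (hq j) (mul_pos hc (Real.exp_pos _))
  refine (div_le_div_of_nonneg_left (h0 k) h2 h1).trans (le_of_eq ?_)
  rw [gaussDensity_eq _ hs, gaussDensity_eq _ hs,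
    show -((deviance (L k) s x - deviance (L j) s x) / 2) =
      -(deviance (L k) s x / 2) - -(deviance (L j) s x / 2) by ring, Real.exp_sub]
  have := (hq j).ne'
  have := hc.ne'
  have := (Real.exp_pos (-(deviance (L j) s x / 2))).ne'
  field_simp

/-- Comparison of the maximum of the likelihood with its value at arbitrary loadings, each
observation being attributed to a given component there and to the best component at the
maximizer. -/
lemma exists_sum_deviance_le {T : ℕ} {x : ℕ → Fin N → ℝ} {q : Fin J → ℝ} {c : ℝ} (hc : 0 < c)
    (hq : ∀ j, c ≤ q j) (hsum : ∑ j, q j = 1) {s : ℝ} (hs : 0 < s)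
    {L Λ : (j : Fin J) → Matrix (Fin N) (Fin (r j)) ℝ}
    (hmax : logLik T x q s Λ ≤ logLik T x q s L) (z : ℕ → Fin J) :
    ∃ κ : ℕ → Fin J, ∑ t ∈ Finset.range T, deviance (L (κ t)) s (x t) ≤
      ∑ t ∈ Finset.range T, deviance (Λ (z t)) s (x t) + T * (2 * Real.log c⁻¹) := by
  have hq0 : ∀ j, 0 < q j := fun j => hc.trans_le (hq j)
  have hg := gaussConst_pos N hs
  have hex : ∀ t, ∃ k, ∀ k', deviance (L k) s (x t) ≤ deviance (L k') s (x t) := fun t => by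
    have : Nonempty (Fin J) := ⟨z t⟩
    exact Finite.exists_min _
  choose κ hκ using hex
  refine ⟨κ, ?_⟩
  -- at the maximizer, every component density is bounded by the one of the best component
  have hup : logLik T x q s L ≤ ∑ t ∈ Finset.range T,
      (Real.log (gaussConst N s) - deviance (L (κ t)) s (x t) / 2) := by
    refine Finset.sum_le_sum fun t _ => ?_
    have h1 : ∑ j, q j * gaussDensity (L j) s (x t) ≤
        gaussConst N s * Real.exp (-(deviance (L (κ t)) s (x t) / 2)) := by
      calc ∑ j, q j * gaussDensity (L j) s (x t)
          ≤ ∑ j, q j * (gaussConst N s * Real.exp (-(deviance (L (κ t)) s (x t) / 2))) := by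
            refine Finset.sum_le_sum fun j _ => ?_
            rw [gaussDensity_eq _ hs]
            have := hκ t j
            have := (hq0 j).le
            gcongr
        _ = _ := by rw [← Finset.sum_mul, hsum, one_mul]
    have h2 := Real.log_le_log (sum_gauss_pos hq0 hs L (x t) (z t)) h1
    rwa [Real.log_mul hg.ne' (Real.exp_pos _).ne', Real.log_exp, ← sub_eq_add_neg] at h2
  -- at the comparison loadings, only the given component is kept, with weight at least `c`
  have hlow : ∑ t ∈ Finset.range T, (Real.log c + (Real.log (gaussConst N s) -
      deviance (Λ (z t)) s (x t) / 2)) ≤ logLik T x q s Λ := by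
    refine Finset.sum_le_sum fun t _ => ?_
    have h1 : c * (gaussConst N s * Real.exp (-(deviance (Λ (z t)) s (x t) / 2))) ≤
        ∑ j, q j * gaussDensity (Λ j) s (x t) := by
      refine le_trans ?_ (Finset.single_le_sum (f := fun k => q k * gaussDensity (Λ k) s (x t))
        (fun k _ => ?_) (Finset.mem_univ (z t)))
      · simp only [gaussDensity_eq _ hs]
        have := hq (z t)
        gcongr
      · rw [gaussDensity_eq _ hs]
        exact mul_nonneg (hq0 k).le (mul_pos hg (Real.exp_pos _)).le
    have h2 := Real.log_le_log (by positivity) h1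
    rwa [Real.log_mul hc.ne' (mul_pos hg (Real.exp_pos _)).ne',
      Real.log_mul hg.ne' (Real.exp_pos _).ne', Real.log_exp, ← sub_eq_add_neg] at h2
  have h := (hlow.trans hmax).trans hup
  rw [Finset.sum_add_distrib, Finset.sum_sub_distrib, Finset.sum_sub_distrib, Finset.sum_const,
    Finset.card_range, nsmul_eq_mul, ← Finset.sum_div, ← Finset.sum_div] at h
  rw [Real.log_inv]
  linarith

/-- The maximizer of the likelihood also maximizes the expected complete-data likelihood: changing
the loadings of one regime cannot lower the deviance weighted by posterior probabilities. -/
lemma sum_post_deviance_le {T : ℕ} {x : ℕ → Fin N → ℝ} {q : Fin J → ℝ}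
    (hq : ∀ j, 0 < q j) {s : ℝ} (hs : 0 < s) {L : (j : Fin J) → Matrix (Fin N) (Fin (r j)) ℝ}
    (hmax : ∀ Λ : (j : Fin J) → Matrix (Fin N) (Fin (r j)) ℝ,
      logLik T x q s Λ ≤ logLik T x q s L) (j : Fin J)
    (Λ : Matrix (Fin N) (Fin (r j)) ℝ) :
    ∑ t ∈ Finset.range T, postProb q s L (x t) j * deviance (L j) s (x t) ≤
      ∑ t ∈ Finset.range T, postProb q s L (x t) j * deviance Λ s (x t) := by
  classical
  have hg := gaussConst_pos N hs
  set L' := Function.update L j Λ with hL'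
  have key : ∀ t, postProb q s L (x t) j * (deviance (L j) s (x t) - deviance Λ s (x t)) / 2 ≤
      Real.log (∑ k, q k * gaussDensity (L' k) s (x t)) -
        Real.log (∑ k, q k * gaussDensity (L k) s (x t)) := by
    intro t
    set S := ∑ k, q k * gaussDensity (L k) s (x t) with hS
    set p := postProb q s L (x t) j with hp
    have hSpos : 0 < S := sum_gauss_pos hq hs L (x t) j
    have hp0 : 0 ≤ p := postProb_nonneg hq hs L (x t) j
    have hp1 : p ≤ 1 := by
      rw [← sum_postProb hq hs L (x t) j]
      exact Finset.single_le_sum (f := postProb q s L (x t))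
        (fun k _ => postProb_nonneg hq hs L (x t) k) (Finset.mem_univ j)
    -- `ρ` is the ratio of the new to the old density of component `j`
    set ρ := Real.exp ((deviance (L j) s (x t) - deviance Λ s (x t)) / 2) with hρ
    have hpS : p * S = q j * gaussDensity (L j) s (x t) := by
      rw [hp, postProb, div_mul_cancel₀ _ hSpos.ne']
    have hnew : ∑ k, q k * gaussDensity (L' k) s (x t) = S * (1 - p + p * ρ) := by
      have h1 : q j * gaussDensity Λ s (x t) = p * S * ρ := by
        rw [hpS, gaussDensity_eq _ hs, gaussDensity_eq _ hs, hρ, mul_assoc, mul_assoc,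
          ← Real.exp_add]
        ring_nf
      rw [← Finset.add_sum_erase _ _ (Finset.mem_univ j)]
      have h2 : ∑ k ∈ Finset.univ.erase j, q k * gaussDensity (L' k) s (x t) = S - p * S := by
        rw [hpS, hS, ← Finset.add_sum_erase _ _ (Finset.mem_univ j), add_sub_cancel_left]
        refine Finset.sum_congr rfl fun k hk => ?_
        rw [hL', Function.update_of_ne (Finset.ne_of_mem_erase hk)]
      rw [h2, hL', Function.update_self, h1]
      ring
    -- weighted inequality of the arithmetic and geometric means
    have hge : ρ ^ p ≤ 1 - p + p * ρ := by
      have := Real.geom_mean_le_arith_mean2_weighted (sub_nonneg.2 hp1) hp0 zero_le_one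
        (Real.exp_pos _).le (by ring : 1 - p + p = 1) (p₂ := ρ)
      simpa using this
    have hρp : 0 < ρ ^ p := Real.rpow_pos_of_pos (Real.exp_pos _) p
    have h3 := Real.log_le_log hρp hge
    rw [Real.log_rpow (Real.exp_pos _), Real.log_exp] at h3
    rw [hnew, Real.log_mul hSpos.ne' (hρp.trans_le hge).ne', add_sub_cancel_left]
    linarith
  have h := hmax L'
  have hsum : ∑ t ∈ Finset.range T, postProb q s L (x t) j *
      (deviance (L j) s (x t) - deviance Λ s (x t)) / 2 ≤ 0 := by
    refine (Finset.sum_le_sum fun t _ => key t).trans ?_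
    rw [Finset.sum_sub_distrib]
    simp only [logLik] at h
    linarith
  rw [← Finset.sum_div] at hsum
  simp only [mul_sub, Finset.sum_sub_distrib] at hsum
  linarith

/-- A quadratic polynomial without constant term that is nonnegative has no linear term. -/
lemma linear_coeff_eq_zero {a b : ℝ} (h : ∀ t : ℝ, 0 ≤ a * t + b * t ^ 2) : a = 0 := by
  by_contra ha
  have hb : 0 < 1 + |b| := by positivity
  have h1 := h (-(a / (1 + |b|)))
  have h2 : a * -(a / (1 + |b|)) + b * (-(a / (1 + |b|))) ^ 2 =
      a ^ 2 / (1 + |b|) ^ 2 * (b - (1 + |b|)) := by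
    field_simp
    ring
  rw [h2] at h1
  have h3 : 0 < a ^ 2 / (1 + |b|) ^ 2 := by positivity
  nlinarith [le_abs_self b]

/-- The second moment matrix of the observations, weighted with `p`. -/
def weightedGram (T : ℕ) (p : ℕ → ℝ) (x : ℕ → Fin N → ℝ) : Matrix (Fin N) (Fin N) ℝ :=
  ∑ t ∈ Finset.range T, p t • vecMulVec (x t) (x t)

/-- Loadings that minimize the weighted deviance satisfy the principal components equation. It is
read off from a quadratic majorant of the deviance, so that no determinant or inverse has to be
differentiated. -/
lemma weightedGram_mul_of_min {T : ℕ} {x : ℕ → Fin N → ℝ} {p : ℕ → ℝ} (hp : ∀ t, 0 ≤ p t) {s : ℝ}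
    (hs : 0 < s) {L : Matrix (Fin N) (Fin k) ℝ} (hdiag : (Lᵀ * L).IsDiag)
    (hmin : ∀ Λ : Matrix (Fin N) (Fin k) ℝ, ∑ t ∈ Finset.range T, p t * deviance L s (x t) ≤
      ∑ t ∈ Finset.range T, p t * deviance Λ s (x t)) :
    weightedGram T p x * L =
      (∑ t ∈ Finset.range T, p t) • (L * (Lᵀ * L + s • (1 : Matrix (Fin k) (Fin k) ℝ))) := by
  set C := Lᵀ * L + s • (1 : Matrix (Fin k) (Fin k) ℝ) with hC
  set g : ℕ → Fin k → ℝ := fun t => C⁻¹ *ᵥ (Lᵀ *ᵥ x t) with hg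
  set u : ℕ → Fin N → ℝ := fun t => x t - L *ᵥ g t with hu
  set w := ∑ t ∈ Finset.range T, p t with hw
  have hCu := isUnit_det_gramShift L hs
  -- minimality along `L + h Δ`, with the log-determinant majorized by its tangent and the residual
  -- by the penalized residual with the old coefficients `g`
  have hquad : ∀ (Δ : Matrix (Fin N) (Fin k) ℝ) (h : ℝ),
      0 ≤ (2 * (w * s * (C⁻¹ * (Lᵀ * Δ)).trace -
          ∑ t ∈ Finset.range T, p t * (u t ⬝ᵥ (Δ *ᵥ g t)))) * h +
        (w * s * (C⁻¹ * (Δᵀ * Δ)).trace +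
          ∑ t ∈ Finset.range T, p t * ((Δ *ᵥ g t) ⬝ᵥ (Δ *ᵥ g t))) * h ^ 2 := by
    intro Δ h
    have hsym : (C⁻¹ * (Δᵀ * L)).trace = (C⁻¹ * (Lᵀ * Δ)).trace := by
      rw [← trace_transpose, transpose_mul, transpose_mul, transpose_transpose,
        transpose_inv_gramShift, trace_mul_comm]
    have hld := logDet_sub_le hdiag hs (L + h • Δ)
    have htr : (C⁻¹ * ((L + h • Δ)ᵀ * (L + h • Δ) - Lᵀ * L)).trace =
        2 * h * (C⁻¹ * (Lᵀ * Δ)).trace + h ^ 2 * (C⁻¹ * (Δᵀ * Δ)).trace := by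
      have : (L + h • Δ)ᵀ * (L + h • Δ) - Lᵀ * L =
          h • (Lᵀ * Δ) + h • (Δᵀ * L) + h ^ 2 • (Δᵀ * Δ) := by
        rw [transpose_add, transpose_smul, Matrix.add_mul, Matrix.mul_add, Matrix.mul_add]
        simp only [Matrix.smul_mul, Matrix.mul_smul, smul_smul, sq]
        abel
      rw [this, Matrix.mul_add, Matrix.mul_add, trace_add, trace_add, Matrix.mul_smul,
        Matrix.mul_smul, Matrix.mul_smul, trace_smul, trace_smul, trace_smul, hsym]
      simp only [smul_eq_mul]
      ring
    rw [htr] at hld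
    have hres : ∀ t, resid (L + h • Δ) s (x t) - resid L s (x t) ≤
        -(2 * h * (u t ⬝ᵥ (Δ *ᵥ g t))) + h ^ 2 * ((Δ *ᵥ g t) ⬝ᵥ (Δ *ᵥ g t)) := by
      intro t
      have h1 := resid_le (L + h • Δ) hs (x t) (g t)
      have h2 := resid_eq L hs (x t) (g := g t) rfl
      have h3 : x t - (L + h • Δ) *ᵥ g t = u t - h • (Δ *ᵥ g t) := by
        rw [add_mulVec, smul_mulVec, hu]
        simp only
        abel
      have h4 : (u t - h • (Δ *ᵥ g t)) ⬝ᵥ (u t - h • (Δ *ᵥ g t)) =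
          u t ⬝ᵥ u t - 2 * h * (u t ⬝ᵥ (Δ *ᵥ g t)) +
            h ^ 2 * ((Δ *ᵥ g t) ⬝ᵥ (Δ *ᵥ g t)) := by
        simp only [sub_dotProduct, dotProduct_sub, smul_dotProduct, dotProduct_smul, smul_eq_mul]
        rw [dotProduct_comm (Δ *ᵥ g t) (u t)]
        ring
      rw [h3, h4] at h1
      have h5 : (x t - L *ᵥ g t) ⬝ᵥ (x t - L *ᵥ g t) = u t ⬝ᵥ u t := rfl
      rw [h5] at h2
      linarith
    have hterm : ∀ t, p t * (deviance (L + h • Δ) s (x t) - deviance L s (x t)) * s ≤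
        p t * (s * (2 * h * (C⁻¹ * (Lᵀ * Δ)).trace + h ^ 2 * (C⁻¹ * (Δᵀ * Δ)).trace) +
          (-(2 * h * (u t ⬝ᵥ (Δ *ᵥ g t))) + h ^ 2 * ((Δ *ᵥ g t) ⬝ᵥ (Δ *ᵥ g t)))) := by
      intro t
      rw [mul_assoc]
      refine mul_le_mul_of_nonneg_left ?_ (hp t)
      have h1 := hres t
      have h2 : (deviance (L + h • Δ) s (x t) - deviance L s (x t)) * s =
          s * (logDet (L + h • Δ) s - logDet L s) +
            (resid (L + h • Δ) s (x t) - resid L s (x t)) := by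
        simp only [deviance]
        field_simp
        ring
      rw [h2]
      have h3 := mul_le_mul_of_nonneg_left hld hs.le
      linarith
    have hsum := Finset.sum_le_sum fun t (_ : t ∈ Finset.range T) => hterm t
    have h0 : 0 ≤ ∑ t ∈ Finset.range T,
        p t * (deviance (L + h • Δ) s (x t) - deviance L s (x t)) * s := by
      rw [← Finset.sum_mul]
      refine mul_nonneg ?_ hs.le
      simp only [mul_sub, Finset.sum_sub_distrib]
      linarith [hmin (L + h • Δ)]
    refine (h0.trans hsum).trans (le_of_eq ?_)
    have h6 : ∀ t, p t * (s * (2 * h * (C⁻¹ * (Lᵀ * Δ)).trace + h ^ 2 * (C⁻¹ * (Δᵀ * Δ)).trace) +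
          (-(2 * h * (u t ⬝ᵥ (Δ *ᵥ g t))) + h ^ 2 * ((Δ *ᵥ g t) ⬝ᵥ (Δ *ᵥ g t)))) =
        p t * (s * (2 * h * (C⁻¹ * (Lᵀ * Δ)).trace + h ^ 2 * (C⁻¹ * (Δᵀ * Δ)).trace)) -
        2 * h * (p t * (u t ⬝ᵥ (Δ *ᵥ g t))) + h ^ 2 * (p t * ((Δ *ᵥ g t) ⬝ᵥ (Δ *ᵥ g t))) :=
      fun t => by ring
    simp only [h6]
    rw [Finset.sum_add_distrib, Finset.sum_sub_distrib, ← Finset.sum_mul, ← Finset.mul_sum,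
      ← Finset.mul_sum]
    ring
  -- stationarity in the direction of the matrix unit at `(i, a)`
  have hentry : ∀ (i : Fin N) (a : Fin k), w * s * (L * C⁻¹) i a =
      ∑ t ∈ Finset.range T, p t * (u t i * g t a) := by
    intro i a
    have h1 := linear_coeff_eq_zero (hquad (Matrix.single i a (1 : ℝ)))
    have h2 : (C⁻¹ * (Lᵀ * Matrix.single i a (1 : ℝ))).trace = (L * C⁻¹) i a := by
      rw [← Matrix.mul_assoc, trace_mul_single, MulOpposite.op_one, one_smul]
      have : (C⁻¹ * Lᵀ) = (L * C⁻¹)ᵀ := by rw [transpose_mul, transpose_inv_gramShift]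
      rw [this, transpose_apply]
    have h3 : ∀ t, u t ⬝ᵥ (Matrix.single i a (1 : ℝ) *ᵥ g t) = u t i * g t a := fun t => by
      rw [single_mulVec, one_mul]
      exact dotProduct_single (u t) (g t a) i
    rw [h2] at h1
    simp only [h3] at h1
    linarith
  -- the stationarity conditions, assembled into a matrix equation
  have hmat : (w * s) • (L * C⁻¹) = (1 - softProj L s) * weightedGram T p x * (L * C⁻¹) := by
    have h1 : (1 - softProj L s) * weightedGram T p x * (L * C⁻¹) =
        ∑ t ∈ Finset.range T, p t • vecMulVec (u t) (g t) := by
      rw [weightedGram, Matrix.mul_sum, Matrix.sum_mul]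
      refine Finset.sum_congr rfl fun t _ => ?_
      rw [Matrix.mul_smul, Matrix.smul_mul, mul_vecMulVec, vecMulVec_mul]
      have h2 : (1 - softProj L s) *ᵥ x t = u t := by
        rw [sub_mulVec, one_mulVec, softProj, ← mulVec_mulVec, ← mulVec_mulVec]
      have h3 : x t ᵥ* (L * C⁻¹) = g t := by
        rw [← mulVec_transpose, transpose_mul, transpose_inv_gramShift, ← mulVec_mulVec]
      rw [h2, h3]
    rw [h1]
    ext i a
    rw [Matrix.smul_apply, smul_eq_mul, hentry, Matrix.sum_apply]
    rfl
  have hmat2 : (w * s) • L = (1 - softProj L s) * weightedGram T p x * L := by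
    have := congrArg (· * C) hmat
    rwa [Matrix.smul_mul, Matrix.mul_assoc L, nonsing_inv_mul _ hCu, Matrix.mul_one,
      Matrix.mul_assoc _ (L * C⁻¹), Matrix.mul_assoc L, nonsing_inv_mul _ hCu,
      Matrix.mul_one] at this
  -- multiplication by `L L' + s I` removes the factor `I - B`, where `B` is the soft projection
  have hS : (L * Lᵀ + s • (1 : Matrix (Fin N) (Fin N) ℝ)) * (1 - softProj L s) = s • 1 := by
    rw [Matrix.mul_sub, Matrix.mul_one, Matrix.add_mul, gram_mul_softProj L hs, smul_mul,
      Matrix.one_mul]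
    abel
  have h4 := congrArg ((L * Lᵀ + s • (1 : Matrix (Fin N) (Fin N) ℝ)) * ·) hmat2
  rw [← Matrix.mul_assoc, ← Matrix.mul_assoc, hS, Matrix.smul_mul, Matrix.one_mul,
    Matrix.smul_mul, Matrix.mul_smul, mul_comm w s, mul_smul] at h4
  have h5 := smul_right_injective (Matrix (Fin N) (Fin k) ℝ) hs.ne' h4
  rw [← h5, Matrix.add_mul, hC, Matrix.mul_add, Matrix.mul_assoc]
  simp

end Likelihood

/-! ### Inequalities for a single sample -/

/-- A realized sample of size `(N, T)`, together with true loadings `Λ`, candidate loadings `L`,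
mixture weights `q` and an error variance `s`. -/
structure Sample (J : ℕ) (r : Fin J → ℕ) where
  /-- the number of units -/
  N : ℕ
  /-- the number of dates -/
  T : ℕ
  /-- the regimes -/
  z : ℕ → Fin J
  /-- the factors, date by date, in each regime -/
  f : (j : Fin J) → ℕ → Fin (r j) → ℝ
  /-- the error vectors, date by date -/
  e : ℕ → Fin N → ℝ
  /-- the true loadings -/
  Λ : (j : Fin J) → Matrix (Fin N) (Fin (r j)) ℝ
  /-- the estimated loadings -/
  L : (j : Fin J) → Matrix (Fin N) (Fin (r j)) ℝ
  /-- the mixture weights -/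
  q : Fin J → ℝ
  /-- the error variance used in the likelihood -/
  s : ℝ

namespace Sample

variable {J : ℕ} {r : Fin J → ℕ} (S : Sample J r)

/-- The common component of the observation at date `t`. -/
def signal (t : ℕ) : Fin S.N → ℝ := S.Λ (S.z t) *ᵥ S.f (S.z t) t

/-- The observation at date `t`. -/
def obs (t : ℕ) : Fin S.N → ℝ := S.signal t + S.e t

/-- The posterior probability of regime `j` at date `t`. -/
noncomputable def post (j : Fin J) (t : ℕ) : ℝ := postProb S.q S.s S.L (S.obs t) j

/-- The indicator of regime `j` at date `t`. -/
def ind (j : Fin J) (t : ℕ) : ℝ := if S.z t = j then 1 else 0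

/-- `∑ e_t e_t'` over the dates of regime `j`. -/
def errGram (j : Fin J) : Matrix (Fin S.N) (Fin S.N) ℝ := weightedGram S.T (S.ind j) S.e

/-- `∑ e_t f_t'` over the dates of regime `j`. -/
def cross (j : Fin J) : Matrix (Fin S.N) (Fin (r j)) ℝ :=
  ∑ t ∈ Finset.range S.T, S.ind j t • vecMulVec (S.e t) (S.f j t)

/-- `∑ f_t f_t'` over the dates of regime `j`. -/
def facGram (j : Fin J) : Matrix (Fin (r j)) (Fin (r j)) ℝ :=
  weightedGram S.T (S.ind j) (S.f j)

/-- The loadings `L` of the sample maximize the likelihood and are normalized; the weights are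
bounded below by `c`. -/
structure IsFit (c : ℝ) : Prop where
  c_pos : 0 < c
  le_q : ∀ j, c ≤ S.q j
  sum_q : ∑ j, S.q j = 1
  s_pos : 0 < S.s
  isMax : ∀ Λ : (j : Fin J) → Matrix (Fin S.N) (Fin (r j)) ℝ,
    logLik S.T S.obs S.q S.s Λ ≤ logLik S.T S.obs S.q S.s S.L
  diag : ∀ j, ((S.L j)ᵀ * S.L j).IsDiag

variable {S}

lemma sum_ind_mul (t : ℕ) (g : Fin J → ℝ) : ∑ j, S.ind j t * g j = g (S.z t) := by
  rw [Finset.sum_eq_single (S.z t) (fun j _ hj => by rw [ind, if_neg hj.symm, zero_mul])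
    (fun h => absurd (Finset.mem_univ _) h), ind, if_pos rfl, one_mul]

/-- A weighted sum of quadratic forms is a trace against the weighted second moment matrix. -/
lemma sum_dot_mulVec_eq {N : ℕ} (T : ℕ) (p : ℕ → ℝ) (x : ℕ → Fin N → ℝ)
    (B : Matrix (Fin N) (Fin N) ℝ) :
    ∑ t ∈ Finset.range T, p t * (x t ⬝ᵥ (B *ᵥ x t)) = (weightedGram T p x * B).trace := by
  rw [weightedGram, Matrix.sum_mul, trace_sum]
  refine Finset.sum_congr rfl fun t _ => ?_
  rw [Matrix.smul_mul, trace_smul, smul_eq_mul, vecMulVec_mul, trace_vecMulVec, dotProduct_mulVec,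
    dotProduct_comm (x t)]

lemma sum_err_softProj_le {s : ℝ} (hs : 0 < s) {l : ℕ} (L : Matrix (Fin S.N) (Fin l) ℝ) :
    ∑ t ∈ Finset.range S.T, S.e t ⬝ᵥ (softProj L s *ᵥ S.e t) ≤ (∑ j, ‖S.errGram j‖) * l := by
  have h1 : ∀ t, S.e t ⬝ᵥ (softProj L s *ᵥ S.e t) =
      ∑ j, S.ind j t * (S.e t ⬝ᵥ (softProj L s *ᵥ S.e t)) := fun t =>
    (sum_ind_mul t (fun _ => S.e t ⬝ᵥ (softProj L s *ᵥ S.e t))).symm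
  rw [Finset.sum_congr rfl fun t _ => h1 t, Finset.sum_comm, Finset.sum_mul]
  refine Finset.sum_le_sum fun j _ => ?_
  rw [sum_dot_mulVec_eq]
  refine (trace_mul_le_of_posSemidef _ (softProj_posSemidef L hs)).trans ?_
  exact mul_le_mul_of_nonneg_left (trace_softProj_le L hs) (norm_nonneg _)

lemma abs_trace_le {n : ℕ} (A : Matrix (Fin n) (Fin n) ℝ) : |A.trace| ≤ n * ‖A‖ := by
  rw [trace]
  refine (Finset.abs_sum_le_sum_abs _ _).trans ?_
  refine (Finset.sum_le_sum fun i _ => abs_entry_le_opNorm A i i).trans (le_of_eq ?_)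
  simp

lemma abs_sum_signal_dot_err_le :
    |∑ t ∈ Finset.range S.T, S.signal t ⬝ᵥ S.e t| ≤
      ∑ j, (r j : ℝ) * ‖(S.Λ j)ᵀ * S.cross j‖ := by
  have h1 : ∀ t, S.signal t ⬝ᵥ S.e t =
      ∑ j, S.ind j t * ((S.Λ j *ᵥ S.f j t) ⬝ᵥ S.e t) := fun t =>
    (sum_ind_mul t (fun j => (S.Λ j *ᵥ S.f j t) ⬝ᵥ S.e t)).symm
  simp_rw [h1]
  rw [Finset.sum_comm]
  refine (Finset.abs_sum_le_sum_abs _ _).trans (Finset.sum_le_sum fun j _ => ?_)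
  have h2 : ∑ t ∈ Finset.range S.T, S.ind j t * ((S.Λ j *ᵥ S.f j t) ⬝ᵥ S.e t) =
      ((S.Λ j)ᵀ * S.cross j).trace := by
    rw [cross, Matrix.mul_sum, trace_sum]
    refine Finset.sum_congr rfl fun t _ => ?_
    rw [Matrix.mul_smul, trace_smul, smul_eq_mul, mul_vecMulVec, trace_vecMulVec,
      dotProduct_comm (S.Λ j *ᵥ S.f j t), dotProduct_mulVec, mulVec_transpose]
  rw [h2]
  exact abs_trace_le _

variable (S) in
/-- The bound, of smaller order than `N T`, on the total misfit of the maximizer of the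
likelihood. -/
noncomputable def slack (c : ℝ) : ℝ :=
  S.s * ∑ t ∈ Finset.range S.T, nrm (S.f (S.z t) t) ^ 2 +
    S.T * (S.s * ∑ j, |logDet (S.Λ j) S.s|) + S.s * (S.T * (2 * Real.log c⁻¹)) +
    2 * ∑ j, (r j : ℝ) * ‖(S.Λ j)ᵀ * S.cross j‖ +
    2 * (√(∑ t ∈ Finset.range S.T, nrm (S.signal t) ^ 2) *
      √((∑ j, ‖S.errGram j‖) * ∑ k, (r k : ℝ))) + (∑ j, ‖S.errGram j‖) * ∑ k, (r k : ℝ)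

/-- Attributing each date to the component that fits best, the loadings that maximize the
likelihood leave little of the common components unexplained. -/
lemma IsFit.exists_sum_resid_le {c : ℝ} (h : S.IsFit c) :
    ∃ κ : ℕ → Fin J, ∑ t ∈ Finset.range S.T,
      (S.s * logDet (S.L (κ t)) S.s + resid (S.L (κ t)) S.s (S.signal t)) ≤ S.slack c := by
  have hs := h.s_pos
  obtain ⟨κ, hκ⟩ := exists_sum_deviance_le h.c_pos h.le_q h.sum_q hs (h.isMax S.Λ) S.z
  refine ⟨κ, ?_⟩
  set V := (∑ j, ‖S.errGram j‖) * ∑ k, (r k : ℝ) with hV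
  -- the part of the errors captured by the fitted loadings
  set b : ℕ → ℝ := fun t => S.e t ⬝ᵥ (softProj (S.L (κ t)) S.s *ᵥ S.e t) with hb
  have hb0 : ∀ t, 0 ≤ b t := fun t => softProj_dot_nonneg _ hs _
  have hbV : ∑ t ∈ Finset.range S.T, b t ≤ V := by
    calc ∑ t ∈ Finset.range S.T, b t
        ≤ ∑ t ∈ Finset.range S.T, ∑ k, S.e t ⬝ᵥ (softProj (S.L k) S.s *ᵥ S.e t) :=
          Finset.sum_le_sum fun t _ => Finset.single_le_sum
            (f := fun k => S.e t ⬝ᵥ (softProj (S.L k) S.s *ᵥ S.e t))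
            (fun k _ => softProj_dot_nonneg _ hs _) (Finset.mem_univ (κ t))
      _ = ∑ k, ∑ t ∈ Finset.range S.T, S.e t ⬝ᵥ (softProj (S.L k) S.s *ᵥ S.e t) :=
          Finset.sum_comm
      _ ≤ ∑ k, (∑ j, ‖S.errGram j‖) * (r k : ℝ) :=
          Finset.sum_le_sum fun k _ => sum_err_softProj_le hs (S.L k)
      _ = V := by rw [← Finset.mul_sum]
  -- a lower bound on the deviance at the fitted loadings
  have hlow : ∀ t, S.s * logDet (S.L (κ t)) S.s + resid (S.L (κ t)) S.s (S.signal t) +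
      S.e t ⬝ᵥ S.e t + 2 * (S.signal t ⬝ᵥ S.e t) - 2 * (nrm (S.signal t) * √(b t)) - b t ≤
      S.s * deviance (S.L (κ t)) S.s (S.obs t) := by
    intro t
    have h1 := resid_add (S.L (κ t)) S.s (S.signal t) (S.e t)
    have h2 : S.signal t ⬝ᵥ (softProj (S.L (κ t)) S.s *ᵥ S.e t) ≤ nrm (S.signal t) * √(b t) := by
      refine ((le_abs_self _).trans (abs_dot_le _ _)).trans ?_
      refine mul_le_mul_of_nonneg_left ?_ (nrm_nonneg _)
      exact Real.le_sqrt_of_sq_le (nrm_softProj_sq_le _ hs _)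
    have h3 : resid (S.L (κ t)) S.s (S.e t) = S.e t ⬝ᵥ S.e t - b t := rfl
    have h4 : S.s * deviance (S.L (κ t)) S.s (S.obs t) =
        S.s * logDet (S.L (κ t)) S.s + resid (S.L (κ t)) S.s (S.obs t) := by
      rw [deviance]
      field_simp
    rw [h4, obs, h1, h3]
    linarith
  -- an upper bound at the true loadings, where the true factors are feasible coefficients
  have hup : ∀ t, S.s * deviance (S.Λ (S.z t)) S.s (S.obs t) ≤
      S.s * ∑ j, |logDet (S.Λ j) S.s| + (S.e t ⬝ᵥ S.e t + S.s * nrm (S.f (S.z t) t) ^ 2) := by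
    intro t
    have h1 := resid_le (S.Λ (S.z t)) hs (S.obs t) (S.f (S.z t) t)
    have h2 : S.obs t - S.Λ (S.z t) *ᵥ S.f (S.z t) t = S.e t := by
      simp [obs, signal]
    rw [h2, ← nrm_sq (S.f (S.z t) t)] at h1
    have h4 : S.s * deviance (S.Λ (S.z t)) S.s (S.obs t) =
        S.s * logDet (S.Λ (S.z t)) S.s + resid (S.Λ (S.z t)) S.s (S.obs t) := by
      rw [deviance]
      field_simp
    rw [h4]
    refine add_le_add ?_ h1
    refine mul_le_mul_of_nonneg_left ?_ hs.le
    exact (le_abs_self _).trans (Finset.single_le_sum (f := fun j => |logDet (S.Λ j) S.s|)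
      (fun j _ => abs_nonneg _) (Finset.mem_univ (S.z t)))
  have h5 := mul_le_mul_of_nonneg_left hκ hs.le
  rw [mul_add, Finset.mul_sum, Finset.mul_sum] at h5
  have h6 := (Finset.sum_le_sum fun t (_ : t ∈ Finset.range S.T) => hlow t).trans
    (h5.trans (add_le_add_left (Finset.sum_le_sum fun t _ => hup t) _))
  -- Cauchy-Schwarz for the cross term
  have h7 : ∑ t ∈ Finset.range S.T, nrm (S.signal t) * √(b t) ≤
      √(∑ t ∈ Finset.range S.T, nrm (S.signal t) ^ 2) * √V := by
    refine (Real.sum_mul_le_sqrt_mul_sqrt _ _ _).trans ?_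
    refine mul_le_mul_of_nonneg_left (Real.sqrt_le_sqrt ?_) (Real.sqrt_nonneg _)
    simp only [Real.sq_sqrt (hb0 _)]
    exact hbV
  have h8 := (abs_le.1 (abs_sum_signal_dot_err_le (S := S))).1
  simp only [Finset.sum_add_distrib, Finset.sum_sub_distrib, ← Finset.mul_sum] at h6 ⊢
  rw [Finset.sum_const, Finset.card_range, nsmul_eq_mul] at h6
  rw [slack]
  linarith

/-- Every regime is covered by some component of the fitted mixture: one that is in charge of a
non-negligible part of the dates of the regime. -/
lemma IsFit.exists_misfit_le {c : ℝ} (h : S.IsFit c) (j : Fin J) {m d : ℝ} (hm : 0 < m)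
    (hd : 0 ≤ d) (hcard : J * m ≤ ((Finset.range S.T).filter fun t => S.z t = j).card)
    (hsub : ∀ A ⊆ Finset.range S.T, (∀ t ∈ A, S.z t = j) → m ≤ A.card →
      ∀ v : Fin (r j) → ℝ, A.card * (d * nrm v ^ 2) ≤ ∑ t ∈ A, (v ⬝ᵥ S.f j t) ^ 2) :
    ∃ k, m * (d * misfit (S.L k) S.s (S.Λ j)) ≤ S.slack c ∧
      m * (S.s * logDet (S.L k) S.s) ≤ S.slack c := by
  have hs := h.s_pos
  obtain ⟨κ, hκ⟩ := h.exists_sum_resid_le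
  set R := (Finset.range S.T).filter fun t => S.z t = j with hR
  -- pigeonhole: some component is in charge of at least `m` dates of the regime
  obtain ⟨k, hk⟩ : ∃ k, m ≤ ((R.filter fun t => κ t = k).card : ℝ) := by
    by_contra! hcon
    have h1 : (R.card : ℝ) = ∑ k, ((R.filter fun t => κ t = k).card : ℝ) := by
      rw [Finset.card_eq_sum_card_fiberwise (f := κ) (t := Finset.univ) (by simp)]
      push_cast
      rfl
    have h2 : ∑ k, ((R.filter fun t => κ t = k).card : ℝ) < ∑ _k : Fin J, m :=
      Finset.sum_lt_sum_of_nonempty ⟨j, Finset.mem_univ j⟩ fun k _ => hcon k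
    rw [Finset.sum_const, Finset.card_univ, Fintype.card_fin, nsmul_eq_mul] at h2
    linarith
  refine ⟨k, ?_⟩
  set A := R.filter fun t => κ t = k with hA
  have hAR : ∀ t ∈ A, S.z t = j := fun t ht =>
    (Finset.mem_filter.1 (Finset.mem_filter.1 ht).1).2
  have hAk : ∀ t ∈ A, κ t = k := fun t ht => (Finset.mem_filter.1 ht).2
  have hAT : A ⊆ Finset.range S.T := (Finset.filter_subset _ _).trans (Finset.filter_subset _ _)
  have hld : ∀ k, 0 ≤ S.s * logDet (S.L k) S.s := fun k =>
    mul_nonneg hs.le (logDet_nonneg _ hs)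
  have hsumA : ∑ t ∈ A, (S.s * logDet (S.L k) S.s + resid (S.L k) S.s (S.Λ j *ᵥ S.f j t)) ≤
      S.slack c := by
    refine le_trans ?_ hκ
    refine le_trans (le_of_eq ?_) (Finset.sum_le_sum_of_subset_of_nonneg hAT fun t _ _ =>
      add_nonneg (hld _) (resid_nonneg _ hs _))
    refine Finset.sum_congr rfl fun t ht => ?_
    rw [hAk t ht, signal]
    have := hAR t ht
    subst this
    rfl
  -- the factors of those dates are well-conditioned, so that all of `Λ j` has to be fitted
  have hmis : A.card * d * misfit (S.L k) S.s (S.Λ j) ≤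
      ∑ t ∈ A, resid (S.L k) S.s (S.Λ j *ᵥ S.f j t) :=
    misfit_le_sum_resid _ hs _ A (S.f j) fun v => by
      have := hsub A hAT hAR hk v
      linarith
  have hmn := mul_nonneg hd (misfit_nonneg (S.L k) hs (S.Λ j))
  have hrn : 0 ≤ ∑ t ∈ A, resid (S.L k) S.s (S.Λ j *ᵥ S.f j t) :=
    Finset.sum_nonneg fun t _ => resid_nonneg _ hs _
  rw [Finset.sum_add_distrib, Finset.sum_const, nsmul_eq_mul] at hsumA
  have hl := mul_nonneg (hm.le.trans hk) (hld k)
  constructor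
  · have := mul_le_mul_of_nonneg_right hk hmn
    linarith
  · have := mul_le_mul_of_nonneg_right hk (hld k)
    linarith

/-- A lower bound on the gap between the squared residuals of an observation `Λj f + e` of regime
`j` with respect to the fitted loadings of another regime and of its own. -/
lemma le_resid_sub_resid {N a b a' b' : ℕ} {s : ℝ} (hs : 0 < s)
    {Lj : Matrix (Fin N) (Fin a') ℝ} {Lk : Matrix (Fin N) (Fin b') ℝ}
    {Λj : Matrix (Fin N) (Fin a) ℝ} {Λk : Matrix (Fin N) (Fin b) ℝ}
    (hk : IsUnit (Λkᵀ * Λk).det) {δ : ℝ} (hδ : ‖proj Λk - softProj Lk s‖ ≤ δ)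
    (f : Fin a → ℝ) (e : Fin N → ℝ) :
    f ⬝ᵥ ((Λjᵀ * annihilator Λk * Λj) *ᵥ f) - δ * (nrm (Λj *ᵥ f) + nrm e) ^ 2
        - 2 * (nrm f * nrm (Λjᵀ *ᵥ e)) - 2 * (nrm (Λj *ᵥ f) * nrm (proj Λk *ᵥ e))
        - nrm (proj Λk *ᵥ e) ^ 2 - misfit Lj s Λj * nrm f ^ 2
        - 2 * (√(misfit Lj s Λj) * nrm f * nrm e) ≤
      resid Lk s (Λj *ᵥ f + e) - resid Lj s (Λj *ᵥ f + e) := by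
  set w := Λj *ᵥ f with hw
  set Q := proj Λk - softProj Lk s with hQ
  have hB : softProj Lk s = proj Λk - Q := by rw [hQ]; abel
  -- the residual with respect to the wrong loadings
  have h1 : resid Lk s (w + e) = w ⬝ᵥ (annihilator Λk *ᵥ w) + w ⬝ᵥ (Q *ᵥ w) +
      2 * (w ⬝ᵥ e - w ⬝ᵥ (proj Λk *ᵥ e) + w ⬝ᵥ (Q *ᵥ e)) +
      (e ⬝ᵥ e - nrm (proj Λk *ᵥ e) ^ 2 + e ⬝ᵥ (Q *ᵥ e)) := by
    rw [resid_add, nrm_proj_mulVec_sq hk, annihilator_eq]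
    simp only [resid, hB, sub_mulVec, one_mulVec, dotProduct_sub]
    ring
  have hww : w ⬝ᵥ (annihilator Λk *ᵥ w) = f ⬝ᵥ ((Λjᵀ * annihilator Λk * Λj) *ᵥ f) := by
    rw [← mulVec_mulVec, ← mulVec_mulVec, dotProduct_mulVec f, vecMul_transpose]
  have hbd : ∀ u v : Fin N → ℝ, -(δ * (nrm u * nrm v)) ≤ u ⬝ᵥ (Q *ᵥ v) := fun u v => by
    have h2 := (abs_le.1 (abs_dot_mulVec_le Q u v)).1
    have h3 := mul_le_mul_of_nonneg_right hδ (mul_nonneg (nrm_nonneg u) (nrm_nonneg v))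
    linarith
  have hwe : w ⬝ᵥ e = f ⬝ᵥ (Λjᵀ *ᵥ e) := by
    rw [dotProduct_mulVec, vecMul_transpose]
  have h2 := (abs_le.1 (abs_dot_le f (Λjᵀ *ᵥ e))).1
  have h3 := (abs_le.1 (abs_dot_le w (proj Λk *ᵥ e))).2
  -- the residual with respect to the right loadings
  have h4 : resid Lj s (w + e) ≤ misfit Lj s Λj * nrm f ^ 2 +
      2 * (√(misfit Lj s Λj) * nrm f * nrm e) + e ⬝ᵥ e := by
    have h5 := resid_le_misfit Lj hs Λj f
    rw [resid_add]
    have h6 : w ⬝ᵥ e - w ⬝ᵥ (softProj Lj s *ᵥ e) = ((1 - softProj Lj s) *ᵥ w) ⬝ᵥ e := by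
      rw [dotProduct_mulVec w, ← mulVec_transpose, transpose_softProj, sub_mulVec, one_mulVec,
        sub_dotProduct]
    have h7 := (le_abs_self _).trans (abs_dot_le ((1 - softProj Lj s) *ᵥ w) e)
    have h8 : nrm ((1 - softProj Lj s) *ᵥ w) ≤ √(misfit Lj s Λj) * nrm f := by
      rw [← Real.sqrt_sq (nrm_nonneg f), ← Real.sqrt_mul (misfit_nonneg Lj hs Λj)]
      exact Real.le_sqrt_of_sq_le ((nrm_one_sub_softProj_sq_le Lj hs w).trans h5)
    have h9 := mul_le_mul_of_nonneg_right h8 (nrm_nonneg e)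
    have h10 : resid Lj s e ≤ e ⬝ᵥ e := by
      have := softProj_dot_nonneg Lj hs e
      rw [resid]; linarith
    rw [h6]
    linarith
  rw [h1, hww, hwe]
  have h11 := hbd w w
  have h12 := hbd w e
  have h13 := hbd e e
  nlinarith

end Sample

/-! ### Growing samples: standing conditions and rates -/

namespace Sample

variable {J : ℕ} {r : Fin J → ℕ}

/-- The rate `T^{-1/4} + N^{-1/2}` of the first consistency result. -/
noncomputable def rate (S : Sample J r) : ℝ := (√√(S.T : ℝ))⁻¹ + (√(S.N : ℝ))⁻¹

end Sample

/-- A family of samples, growing along the filter `l`, that behaves as the conditions of the model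
guarantee with probability close to one.  The functions `ψ` and `φ` bound the largest factors and
errors, and the largest weighted error sums, over all dates of the sample.  The subset condition
`subsets` is only needed for the sets that the pigeonhole principle produces, which hold a fraction
`1 / (2 J)` of the expected number of dates of a regime. -/
structure Regular {ι : Type*} {J : ℕ} {r : Fin J → ℕ} (S : ι → Sample J r) (l : Filter ι)
    (q0 : Fin J → ℝ) (SF SL : (j : Fin J) → Matrix (Fin (r j)) (Fin (r j)) ℝ)
    (ψ φ : ι → ℝ) (c : ℝ) : Prop where
  N_top : Tendsto (fun p => ((S p).N : ℝ)) l atTop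
  T_top : Tendsto (fun p => ((S p).T : ℝ)) l atTop
  fit : ∀ᶠ p in l, (S p).IsFit c
  c_le_s : ∀ᶠ p in l, c ≤ (S p).s
  s_bdd : (fun p => (S p).s) =O[l] fun _ => (1 : ℝ)
  one_le_ψ : ∀ᶠ p in l, 1 ≤ ψ p
  one_le_φ : ∀ᶠ p in l, 1 ≤ φ p
  rate_ψ : Tendsto (fun p => √((S p).rate) * ψ p ^ 2) l (𝓝 0)
  ψ_φ : Tendsto (fun p => ψ p * φ p / √((S p).N : ℝ)) l (𝓝 0)
  sqrt_T : Tendsto (fun p => √((S p).T : ℝ) / ((S p).N : ℝ)) l (𝓝 0)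
  SF_posDef : ∀ j, (SF j).PosDef
  SL_posDef : ∀ j, (SL j).PosDef
  q0_pos : ∀ j, 0 < q0 j
  loading : ∀ j, Tendsto (fun p => ((S p).N : ℝ)⁻¹ • (((S p).Λ j)ᵀ * (S p).Λ j)) l (𝓝 (SL j))
  factor : ∀ j, Tendsto (fun p => ((S p).T : ℝ)⁻¹ • (S p).facGram j) l (𝓝 (q0 j • SF j))
  freq : ∀ j, Tendsto (fun p => ((S p).T : ℝ)⁻¹ * ∑ t ∈ Finset.range (S p).T, (S p).ind j t) l
    (𝓝 (q0 j))
  subsets : ∃ d : ℝ, 0 < d ∧ ∀ᶠ p in l, ∀ j, ∀ A ⊆ Finset.range (S p).T, (∀ t ∈ A, (S p).z t = j) →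
    (2 * J : ℝ)⁻¹ * ((S p).T * q0 j) ≤ A.card → ∀ v : Fin (r j) → ℝ,
      A.card * (d * nrm v ^ 2) ≤ ∑ t ∈ A, (v ⬝ᵥ (S p).f j t) ^ 2
  ident : ∃ C : ℝ, 0 < C ∧ ∀ᶠ p in l, ∀ j k, j ≠ k → ∀ t < (S p).T, (S p).z t = j →
    C * (S p).N ≤ (S p).f j t ⬝ᵥ
      ((((S p).Λ j)ᵀ * annihilator ((S p).Λ k) * (S p).Λ j) *ᵥ (S p).f j t)
  maxima : ∃ K : ℝ, 0 < K ∧ ∀ᶠ p in l, ∀ t < (S p).T,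
    nrm ((S p).f ((S p).z t) t) ≤ K * ψ p ∧
    nrm ((S p).e t) ≤ K * (√((S p).N : ℝ) * ψ p) ∧
    ∀ j, nrm (((S p).Λ j)ᵀ *ᵥ (S p).e t) ≤ K * (√((S p).N : ℝ) * φ p)
  errGram : ∀ j, (fun p => ‖(S p).errGram j‖) =O[l]
    fun p => ((S p).N : ℝ) * (S p).T * (S p).rate ^ 2
  cross : ∀ j, (fun p => ‖(S p).cross j‖) =O[l] fun p => √((S p).N : ℝ) * √((S p).T : ℝ)
  Λ_cross : ∀ j, (fun p => ‖((S p).Λ j)ᵀ * (S p).cross j‖) =O[l]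
    fun p => √((S p).N : ℝ) * √((S p).T : ℝ)
  labels : ∀ᶠ p in l, ∀ π : Equiv.Perm (Fin J), (∀ j, r (π j) = r j) →
    ∑ j, frobSq (annihilator ((S p).L j) * (S p).Λ j) ≤
      ∑ j, frobSq (annihilator ((S p).L (π j)) * (S p).Λ j)

lemma frobSq_le_opNorm_sq {m n : ℕ} (A : Matrix (Fin m) (Fin n) ℝ) :
    frobSq A ≤ n * ‖A‖ ^ 2 := by
  rw [← trace_transpose_mul_self, ← opNorm_transpose_mul_self]
  exact (le_abs_self _).trans (Sample.abs_trace_le _)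

lemma tendsto_matrix_inv {ι : Type*} {l : Filter ι} {n : ℕ} {A : ι → Matrix (Fin n) (Fin n) ℝ}
    {B : Matrix (Fin n) (Fin n) ℝ} (h : Tendsto A l (𝓝 B)) (hB : IsUnit B.det) :
    Tendsto (fun p => (A p)⁻¹) l (𝓝 B⁻¹) := by
  obtain ⟨u, hu⟩ := (isUnit_iff_isUnit_det B).2 hB
  have h1 := NormedRing.inverse_continuousAt u
  rw [hu] at h1
  simp only [nonsing_inv_eq_ringInverse]
  exact h1.tendsto.comp h

lemma eventually_isUnit_det {ι : Type*} {l : Filter ι} {n : ℕ} {A : ι → Matrix (Fin n) (Fin n) ℝ}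
    {B : Matrix (Fin n) (Fin n) ℝ} (h : Tendsto A l (𝓝 B)) (hB : IsUnit B.det) :
    ∀ᶠ p in l, IsUnit (A p).det := by
  have h1 : Tendsto (fun p => (A p).det) l (𝓝 B.det) :=
    (Continuous.matrix_det continuous_id).continuousAt.tendsto.comp h
  filter_upwards [h1.eventually_ne hB.ne_zero] with p hp using hp.isUnit

namespace Regular

variable {ι : Type*} {J : ℕ} {r : Fin J → ℕ} {S : ι → Sample J r} {l : Filter ι}
  {q0 : Fin J → ℝ} {SF SL : (j : Fin J) → Matrix (Fin (r j)) (Fin (r j)) ℝ}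
  {ψ φ : ι → ℝ} {c : ℝ} (h : Regular S l q0 SF SL ψ φ c)

lemma mono {l' : Filter ι} (h : Regular S l q0 SF SL ψ φ c) (hl : l' ≤ l) :
    Regular S l' q0 SF SL ψ φ c where
  N_top := h.N_top.mono_left hl
  T_top := h.T_top.mono_left hl
  fit := h.fit.filter_mono hl
  c_le_s := h.c_le_s.filter_mono hl
  s_bdd := h.s_bdd.mono hl
  one_le_ψ := h.one_le_ψ.filter_mono hl
  one_le_φ := h.one_le_φ.filter_mono hl
  rate_ψ := h.rate_ψ.mono_left hl
  ψ_φ := h.ψ_φ.mono_left hl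
  sqrt_T := h.sqrt_T.mono_left hl
  SF_posDef := h.SF_posDef
  SL_posDef := h.SL_posDef
  q0_pos := h.q0_pos
  loading j := (h.loading j).mono_left hl
  factor j := (h.factor j).mono_left hl
  freq j := (h.freq j).mono_left hl
  subsets := let ⟨d, hd, H⟩ := h.subsets; ⟨d, hd, H.filter_mono hl⟩
  ident := let ⟨d, hd, H⟩ := h.ident; ⟨d, hd, H.filter_mono hl⟩
  maxima := let ⟨d, hd, H⟩ := h.maxima; ⟨d, hd, H.filter_mono hl⟩
  errGram j := (h.errGram j).mono hl
  cross j := (h.cross j).mono hl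
  Λ_cross j := (h.Λ_cross j).mono hl
  labels := h.labels.filter_mono hl

lemma one_le_N (h : Regular S l q0 SF SL ψ φ c) : ∀ᶠ p in l, 1 ≤ ((S p).N : ℝ) :=
  h.N_top.eventually_ge_atTop 1

lemma one_le_T (h : Regular S l q0 SF SL ψ φ c) : ∀ᶠ p in l, 1 ≤ ((S p).T : ℝ) :=
  h.T_top.eventually_ge_atTop 1

lemma rate_pos (h : Regular S l q0 SF SL ψ φ c) : ∀ᶠ p in l, 0 < (S p).rate := by
  filter_upwards [h.one_le_N, h.one_le_T] with p hN hT
  unfold Sample.rate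
  have : 0 < ((S p).N : ℝ) := by linarith
  have : 0 < ((S p).T : ℝ) := by linarith
  positivity

lemma tendsto_rate (h : Regular S l q0 SF SL ψ φ c) : Tendsto (fun p => (S p).rate) l (𝓝 0) := by
  have h1 : Tendsto (fun p => (√√((S p).T : ℝ))⁻¹) l (𝓝 0) :=
    tendsto_inv_atTop_zero.comp (Real.tendsto_sqrt_atTop.comp
      (Real.tendsto_sqrt_atTop.comp h.T_top))
  have h2 : Tendsto (fun p => (√((S p).N : ℝ))⁻¹) l (𝓝 0) :=
    tendsto_inv_atTop_zero.comp (Real.tendsto_sqrt_atTop.comp h.N_top)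
  simpa [Sample.rate] using h1.add h2

lemma rate_le_one (h : Regular S l q0 SF SL ψ φ c) : ∀ᶠ p in l, (S p).rate ≤ 1 :=
  h.tendsto_rate.eventually_le_const one_pos

/-- `√N ≤ N ρ` -/
lemma sqrt_N_le (h : Regular S l q0 SF SL ψ φ c) :
    ∀ᶠ p in l, √((S p).N : ℝ) ≤ (S p).N * (S p).rate := by
  filter_upwards [h.one_le_N, h.one_le_T] with p hN hT
  have hN0 : 0 < √((S p).N : ℝ) := Real.sqrt_pos.2 (by linarith)
  have h1 : ((S p).N : ℝ) * (√((S p).N : ℝ))⁻¹ = √((S p).N : ℝ) := by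
    rw [← div_eq_mul_inv, Real.div_sqrt]
  unfold Sample.rate
  rw [mul_add, h1]
  have : 0 ≤ ((S p).N : ℝ) * (√√((S p).T : ℝ))⁻¹ := by positivity
  linarith

lemma inv_N_le (h : Regular S l q0 SF SL ψ φ c) :
    ∀ᶠ p in l, ((S p).N : ℝ)⁻¹ ≤ (S p).rate ^ 2 := by
  filter_upwards [h.one_le_N, h.one_le_T] with p hN hT
  have h1 : ((√((S p).N : ℝ))⁻¹) ^ 2 = ((S p).N : ℝ)⁻¹ := by
    rw [inv_pow, Real.sq_sqrt (by linarith)]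
  rw [← h1, Sample.rate]
  gcongr
  exact le_add_of_nonneg_left (by positivity)

lemma inv_sqrt_T_le (h : Regular S l q0 SF SL ψ φ c) :
    ∀ᶠ p in l, (√((S p).T : ℝ))⁻¹ ≤ (S p).rate ^ 2 := by
  filter_upwards [h.one_le_N, h.one_le_T] with p hN hT
  have h1 : ((√√((S p).T : ℝ))⁻¹) ^ 2 = (√((S p).T : ℝ))⁻¹ := by
    rw [inv_pow, Real.sq_sqrt (Real.sqrt_nonneg _)]
  rw [← h1, Sample.rate]
  gcongr
  exact le_add_of_nonneg_right (by positivity)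

lemma isUnit_det_SL (h : Regular S l q0 SF SL ψ φ c) (j : Fin J) : IsUnit (SL j).det :=
  (h.SL_posDef j).det_pos.ne'.isUnit

lemma isUnit_det_gram (h : Regular S l q0 SF SL ψ φ c) (j : Fin J) :
    ∀ᶠ p in l, IsUnit (((S p).Λ j)ᵀ * (S p).Λ j).det := by
  filter_upwards [eventually_isUnit_det (h.loading j) (h.isUnit_det_SL j), h.one_le_N]
    with p hp hN
  rw [det_smul, IsUnit.mul_iff] at hp
  exact hp.2

lemma opNorm_Λ_sq (h : Regular S l q0 SF SL ψ φ c) (j : Fin J) :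
    (fun p => ‖(S p).Λ j‖ ^ 2) =O[l] fun p => ((S p).N : ℝ) := by
  have h1 := (h.loading j).norm.isBigO_one ℝ
  have h2 := h1.mul (isBigO_refl (fun p => ((S p).N : ℝ)) l)
  refine (h2.congr' ?_ ?_)
  · filter_upwards [h.one_le_N] with p hN
    rw [norm_smul, opNorm_transpose_mul_self, norm_inv, Real.norm_natCast]
    field_simp
  · filter_upwards with p
    rw [one_mul]

lemma opNorm_Λ (h : Regular S l q0 SF SL ψ φ c) (j : Fin J) :
    (fun p => ‖(S p).Λ j‖) =O[l] fun p => √((S p).N : ℝ) := by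
  refine IsBigO.of_pow two_ne_zero ?_
  refine (h.opNorm_Λ_sq j).congr_right fun p => ?_
  simp [Real.sq_sqrt]

lemma opNorm_inv_gram (h : Regular S l q0 SF SL ψ φ c) (j : Fin J) :
    (fun p => ‖(((S p).Λ j)ᵀ * (S p).Λ j)⁻¹‖) =O[l] fun p => ((S p).N : ℝ)⁻¹ := by
  have h1 := ((tendsto_matrix_inv (h.loading j) (h.isUnit_det_SL j))).norm.isBigO_one ℝ
  have h2 := h1.mul (isBigO_refl (fun p => ((S p).N : ℝ)⁻¹) l)
  refine (h2.congr' ?_ ?_)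
  · filter_upwards [h.one_le_N, h.isUnit_det_gram j] with p hN hu
    have hN0 : ((S p).N : ℝ)⁻¹ ≠ 0 := by positivity
    have h3 : ((((S p).N : ℝ)⁻¹) • (((S p).Λ j)ᵀ * (S p).Λ j))⁻¹ =
        ((S p).N : ℝ) • (((S p).Λ j)ᵀ * (S p).Λ j)⁻¹ := by
      apply inv_eq_right_inv
      rw [Matrix.smul_mul, Matrix.mul_smul, smul_smul, mul_nonsing_inv _ hu,
        inv_mul_cancel₀ (by positivity), one_smul]
    rw [h3, norm_smul, Real.norm_natCast]
    field_simp
  · filter_upwards with p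
    rw [one_mul]

lemma trace_facGram (j : Fin J) (S : Sample J r) :
    (S.facGram j).trace = ∑ t ∈ Finset.range S.T, S.ind j t * nrm (S.f j t) ^ 2 := by
  rw [Sample.facGram, weightedGram, trace_sum]
  refine Finset.sum_congr rfl fun t _ => ?_
  rw [trace_smul, trace_vecMulVec, smul_eq_mul, nrm_sq]

lemma opNorm_facGram (h : Regular S l q0 SF SL ψ φ c) (j : Fin J) :
    (fun p => ‖(S p).facGram j‖) =O[l] fun p => ((S p).T : ℝ) := by
  have h1 := (h.factor j).norm.isBigO_one ℝ
  have h2 := h1.mul (isBigO_refl (fun p => ((S p).T : ℝ)) l)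
  refine (h2.congr' ?_ ?_)
  · filter_upwards [h.one_le_T] with p hT
    rw [norm_smul, norm_inv, Real.norm_natCast]
    field_simp
  · filter_upwards with p
    rw [one_mul]

lemma sum_factor_sq_regime (h : Regular S l q0 SF SL ψ φ c) (j : Fin J) :
    (fun p => ∑ t ∈ Finset.range (S p).T, (S p).ind j t * nrm ((S p).f j t) ^ 2) =O[l]
      fun p => ((S p).T : ℝ) := by
  refine IsBigO.trans ?_ (h.opNorm_facGram j)
  refine IsBigO.of_bound (r j : ℝ) (Eventually.of_forall fun p => ?_)
  rw [← trace_facGram, Real.norm_eq_abs, norm_norm]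
  exact Sample.abs_trace_le _

lemma sum_factor_sq (h : Regular S l q0 SF SL ψ φ c) :
    (fun p => ∑ t ∈ Finset.range (S p).T, nrm ((S p).f ((S p).z t) t) ^ 2) =O[l]
      fun p => ((S p).T : ℝ) := by
  have h1 : (fun p => ∑ j, ∑ t ∈ Finset.range (S p).T, (S p).ind j t * nrm ((S p).f j t) ^ 2) =O[l]
      fun p => ((S p).T : ℝ) := by
    have := IsBigO.sum (s := Finset.univ) fun j _ => h.sum_factor_sq_regime j
    refine this.congr_left fun p => ?_
    simp
  refine h1.congr_left fun p => ?_
  rw [Finset.sum_comm]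
  refine Finset.sum_congr rfl fun t _ => ?_
  exact Sample.sum_ind_mul t fun j => nrm ((S p).f j t) ^ 2

lemma sum_signal_sq (h : Regular S l q0 SF SL ψ φ c) :
    (fun p => ∑ t ∈ Finset.range (S p).T, nrm ((S p).signal t) ^ 2) =O[l]
      fun p => ((S p).N : ℝ) * (S p).T := by
  have hsum : (fun p => ∑ j, ‖(S p).Λ j‖ ^ 2) =O[l] fun p => ((S p).N : ℝ) := by
    have := IsBigO.sum (s := Finset.univ) fun j _ => h.opNorm_Λ_sq j
    refine this.congr_left fun p => ?_
    simp
  refine IsBigO.trans (IsBigO.of_bound 1 (Eventually.of_forall fun p => ?_))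
    (hsum.mul h.sum_factor_sq)
  rw [one_mul, Real.norm_of_nonneg (Finset.sum_nonneg fun t _ => sq_nonneg _),
    Real.norm_of_nonneg (mul_nonneg (Finset.sum_nonneg fun t _ => sq_nonneg _)
      (Finset.sum_nonneg fun t _ => sq_nonneg _)), Finset.mul_sum]
  refine Finset.sum_le_sum fun t _ => ?_
  have h1 : ‖(S p).Λ ((S p).z t)‖ ^ 2 ≤ ∑ j, ‖(S p).Λ j‖ ^ 2 :=
    Finset.single_le_sum (f := fun j => ‖(S p).Λ j‖ ^ 2) (fun j _ => sq_nonneg _)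
      (Finset.mem_univ _)
  calc nrm ((S p).signal t) ^ 2
      ≤ (‖(S p).Λ ((S p).z t)‖ * nrm ((S p).f ((S p).z t) t)) ^ 2 := by
        gcongr
        · exact nrm_nonneg _
        · exact nrm_mulVec_le _ _
    _ = ‖(S p).Λ ((S p).z t)‖ ^ 2 * nrm ((S p).f ((S p).z t) t) ^ 2 := by ring
    _ ≤ _ := by gcongr

/-- The logarithm is crudely bounded by a square root, which is all that the rate `ρ` requires. -/
lemma logDet_Λ (h : Regular S l q0 SF SL ψ φ c) (j : Fin J) :
    (fun p => logDet ((S p).Λ j) (S p).s) =O[l] fun p => √((S p).N : ℝ) := by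
  obtain ⟨K, hK⟩ := (h.opNorm_Λ_sq j).bound
  refine IsBigO.of_bound (r j + (r j + c⁻¹ * (r j * K))) ?_
  filter_upwards [hK, h.one_le_N, h.fit, h.c_le_s] with p hK hN hfit hs
  have hs0 := hfit.s_pos
  have hc0 := hfit.c_pos
  have h1 : 1 ≤ √((S p).N : ℝ) := Real.one_le_sqrt.2 hN
  have h2 := logDet_le ((S p).Λ j) hs0 h1
  rw [Real.norm_of_nonneg (by positivity), Real.norm_of_nonneg (by positivity)] at hK
  rw [Real.norm_of_nonneg (logDet_nonneg _ hs0), Real.norm_of_nonneg (Real.sqrt_nonneg _)]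
  refine h2.trans ?_
  have hfr : (S p).s⁻¹ * frobSq ((S p).Λ j) ≤ c⁻¹ * (r j * K) * (S p).N := by
    calc (S p).s⁻¹ * frobSq ((S p).Λ j) ≤ c⁻¹ * (r j * (K * (S p).N)) := by
          gcongr
          · exact frobSq_nonneg _
          · exact (frobSq_le_opNorm_sq _).trans (by gcongr)
      _ = _ := by ring
  have hsq : √((S p).N : ℝ) * √((S p).N : ℝ) = (S p).N := Real.mul_self_sqrt (by linarith)
  have h3 : (r j + (S p).s⁻¹ * frobSq ((S p).Λ j)) / √((S p).N : ℝ) ≤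
      (r j + c⁻¹ * (r j * K)) * √((S p).N : ℝ) := by
    rw [div_le_iff₀ (by linarith), mul_assoc, hsq]
    have : (r j : ℝ) ≤ r j * (S p).N := le_mul_of_one_le_right (by positivity) hN
    linarith
  linarith

/-- The likelihood comparison leaves a misfit of order `N T ρ`. -/
lemma slack_isBigO (h : Regular S l q0 SF SL ψ φ c) :
    (fun p => (S p).slack c) =O[l] fun p => ((S p).N : ℝ) * (S p).T * (S p).rate := by
  -- rates in terms of `N T ρ`
  have hTT : (fun p => ((S p).T : ℝ)) =O[l] fun p => ((S p).T : ℝ) := isBigO_refl _ _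
  have hsqN : (fun p => √((S p).N : ℝ)) =O[l] fun p => ((S p).N : ℝ) * (S p).rate := by
    refine IsBigO.of_bound 1 ?_
    filter_upwards [h.sqrt_N_le] with p hp
    rw [one_mul, Real.norm_of_nonneg (Real.sqrt_nonneg _)]
    exact hp.trans (le_abs_self _)
  have hone : (fun _ => (1 : ℝ)) =O[l] fun p => √((S p).N : ℝ) := by
    refine IsBigO.of_bound 1 ?_
    filter_upwards [h.one_le_N] with p hp
    rw [one_mul, norm_one, Real.norm_of_nonneg (Real.sqrt_nonneg _)]
    exact Real.one_le_sqrt.2 hp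
  have hTle : (fun p => ((S p).T : ℝ)) =O[l] fun p => ((S p).N : ℝ) * (S p).T * (S p).rate := by
    have := (hone.trans hsqN).mul hTT
    refine this.congr (fun p => one_mul _) fun p => by ring
  have hsqT : (fun p => √((S p).T : ℝ)) =O[l] fun p => ((S p).T : ℝ) := by
    refine IsBigO.of_bound 1 ?_
    filter_upwards [h.one_le_T] with p hp
    rw [one_mul, Real.norm_of_nonneg (Real.sqrt_nonneg _), Real.norm_natCast]
    exact Real.sqrt_le_iff.2 ⟨by linarith, by nlinarith⟩
  have hrr : (fun p => ((S p).N : ℝ) * (S p).T * (S p).rate ^ 2) =O[l]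
      fun p => ((S p).N : ℝ) * (S p).T * (S p).rate := by
    refine (isBigO_refl _ _).mul (IsBigO.of_bound 1 ?_)
    filter_upwards [h.rate_le_one, h.rate_pos] with p hp hp0
    rw [one_mul, Real.norm_of_nonneg (by positivity), Real.norm_of_nonneg hp0.le]
    nlinarith
  have hsum_err : (fun p => (∑ j, ‖(S p).errGram j‖) * ∑ k, (r k : ℝ)) =O[l]
      fun p => ((S p).N : ℝ) * (S p).T * (S p).rate ^ 2 := by
    have h1 := IsBigO.sum (s := Finset.univ) fun j _ => h.errGram j
    have h2 := h1.mul (isBigO_const_const (∑ k, (r k : ℝ)) (one_ne_zero' ℝ) l)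
    refine h2.congr (fun p => ?_) fun p => mul_one _
    simp
  have h1 : (fun p => (S p).s * ∑ t ∈ Finset.range (S p).T, nrm ((S p).f ((S p).z t) t) ^ 2)
      =O[l] fun p => ((S p).N : ℝ) * (S p).T * (S p).rate := by
    refine ((h.s_bdd.mul h.sum_factor_sq).congr_right fun p => one_mul _).trans hTle
  have h2 : (fun p => (S p).T * ((S p).s * ∑ j, |logDet ((S p).Λ j) (S p).s|)) =O[l]
      fun p => ((S p).N : ℝ) * (S p).T * (S p).rate := by
    have h3 : (fun p => ∑ j, |logDet ((S p).Λ j) (S p).s|) =O[l] fun p => √((S p).N : ℝ) := by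
      have := IsBigO.sum (s := Finset.univ) fun j _ => (h.logDet_Λ j).norm_left
      refine this.congr_left fun p => ?_
      simp
    refine (hTT.mul (h.s_bdd.mul (h3.trans hsqN))).congr_right fun p => by ring
  have h3 : (fun p => (S p).s * ((S p).T * (2 * Real.log c⁻¹))) =O[l]
      fun p => ((S p).N : ℝ) * (S p).T * (S p).rate := by
    refine IsBigO.trans ?_ hTle
    refine (h.s_bdd.mul (hTT.mul
      (isBigO_const_const (2 * Real.log c⁻¹) (one_ne_zero' ℝ) l))).congr_right fun p => by ring
  have h4 : (fun p => 2 * ∑ j, (r j : ℝ) * ‖((S p).Λ j)ᵀ * (S p).cross j‖) =O[l]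
      fun p => ((S p).N : ℝ) * (S p).T * (S p).rate := by
    have h5 := IsBigO.sum (s := Finset.univ) fun j _ => (h.Λ_cross j).const_mul_left (r j : ℝ)
    have h6 := ((h5.congr_left fun p => by simp).const_mul_left 2 :
      (fun p => 2 * ∑ j, (r j : ℝ) * ‖((S p).Λ j)ᵀ * (S p).cross j‖) =O[l] _)
    refine h6.trans ((hsqN.mul hsqT).congr_right fun p => by ring)
  have h5 : (fun p => 2 * (√(∑ t ∈ Finset.range (S p).T, nrm ((S p).signal t) ^ 2) *
      √((∑ j, ‖(S p).errGram j‖) * ∑ k, (r k : ℝ)))) =O[l]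
      fun p => ((S p).N : ℝ) * (S p).T * (S p).rate := by
    refine IsBigO.const_mul_left ?_ 2
    refine IsBigO.of_pow two_ne_zero ?_
    refine (h.sum_signal_sq.mul hsum_err).congr (fun p => ?_) fun p => ?_
    · simp only [Pi.pow_apply]
      rw [mul_pow, Real.sq_sqrt (Finset.sum_nonneg fun t _ => sq_nonneg _),
        Real.sq_sqrt (by positivity)]
    · simp only [Pi.pow_apply]
      ring
  exact ((((h1.add h2).add h3).add h4).add h5).add (hsum_err.trans hrr)

lemma card_regime (S : Sample J r) (j : Fin J) :
    ((((Finset.range S.T).filter fun t => S.z t = j).card : ℕ) : ℝ) =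
      ∑ t ∈ Finset.range S.T, S.ind j t := by
  rw [Finset.card_filter]
  push_cast
  rfl

/-- Each regime occupies at least half of its limiting share of the dates. -/
lemma card_regime_ge (h : Regular S l q0 SF SL ψ φ c) (j : Fin J) :
    ∀ᶠ p in l, (S p).T * q0 j / 2 ≤ ∑ t ∈ Finset.range (S p).T, (S p).ind j t := by
  have hq := h.q0_pos j
  filter_upwards [(h.freq j).eventually_const_le (show q0 j / 2 < q0 j by linarith), h.one_le_T]
    with p hp hT
  rw [inv_mul_eq_div, le_div_iff₀ (by linarith)] at hp
  linarith

/-- Every regime is fitted, at rate `ρ`, by the loadings of some component. -/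
lemma exists_component (h : Regular S l q0 SF SL ψ φ c) :
    ∃ K : ℝ, 0 < K ∧ ∀ᶠ p in l, ∀ j, ∃ k,
      misfit ((S p).L k) (S p).s ((S p).Λ j) ≤ K * ((S p).N * (S p).rate) ∧
      logDet ((S p).L k) (S p).s ≤ K * ((S p).N * (S p).rate) := by
  obtain ⟨d, hd, hsub⟩ := h.subsets
  obtain ⟨K, hK, hslack⟩ := h.slack_isBigO.exists_pos
  rw [isBigOWith_iff] at hslack
  rcases isEmpty_or_nonempty (Fin J) with hJ | ⟨⟨j0⟩⟩
  · exact ⟨1, one_pos, Eventually.of_forall fun p j => (hJ.false j).elim⟩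
  have hJ0 : (0 : ℝ) < J := by exact_mod_cast Fin.pos j0
  -- a uniform lower bound for the regime probabilities
  obtain ⟨qm, hqm, hqle⟩ : ∃ qm : ℝ, 0 < qm ∧ ∀ j, qm ≤ q0 j := by
    have : Nonempty (Fin J) := ⟨j0⟩
    obtain ⟨j1, hj1⟩ := Finite.exists_min q0
    exact ⟨q0 j1, h.q0_pos j1, hj1⟩
  have hall : ∀ᶠ p in l, ∀ j, (S p).T * q0 j / 2 ≤ ∑ t ∈ Finset.range (S p).T, (S p).ind j t :=
    eventually_all.2 fun j => h.card_regime_ge j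
  -- positivity of `c` is part of `fit`, which says nothing along the trivial filter
  have hc : 0 < c ∨ l = ⊥ := by
    by_cases hl : l = ⊥
    · exact Or.inr hl
    · have : l.NeBot := ⟨hl⟩
      obtain ⟨p, hp⟩ := h.fit.exists
      exact Or.inl hp.c_pos
  rcases hc with hc | hl
  swap
  · exact ⟨1, one_pos, by rw [hl]; trivial⟩
  refine ⟨K * (2 * J) / qm / d + K * (2 * J) / qm / c, by positivity, ?_⟩
  filter_upwards [hsub, hslack, hall, h.fit, h.c_le_s, h.one_le_N, h.one_le_T, h.rate_pos]
    with p hsub hslack hall hfit hs hN hT hr j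
  have hq := h.q0_pos j
  have hT0 : (0 : ℝ) < (S p).T := by linarith
  have hm : 0 < (2 * J : ℝ)⁻¹ * ((S p).T * q0 j) := by positivity
  obtain ⟨k, hk1, hk2⟩ := hfit.exists_misfit_le j hm hd.le (by
    rw [card_regime]
    refine le_trans (le_of_eq ?_) (hall j)
    field_simp) fun A hA hz hcard v => hsub j A hA hz hcard v
  have hsl : (S p).slack c ≤ K * ((S p).N * (S p).T * (S p).rate) := by
    refine (le_abs_self _).trans (hslack.trans (le_of_eq ?_))
    rw [Real.norm_of_nonneg (by positivity)]
  have hmm : (S p).T * (qm / (2 * J)) ≤ (2 * J : ℝ)⁻¹ * ((S p).T * q0 j) := by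
    calc (S p).T * (qm / (2 * J)) = (2 * J : ℝ)⁻¹ * ((S p).T * qm) := by field_simp
      _ ≤ _ := by gcongr; exact hqle j
  have hmis := misfit_nonneg ((S p).L k) hfit.s_pos ((S p).Λ j)
  have hld := logDet_nonneg ((S p).L k) hfit.s_pos
  have hNr : 0 < (S p).N * (S p).rate := by
    have : (0 : ℝ) < (S p).N := by linarith
    positivity
  -- division of the bounds of `exists_misfit_le` by the number of dates
  have key : ∀ x b : ℝ, 0 < b → 0 ≤ x →
      (2 * J : ℝ)⁻¹ * ((S p).T * q0 j) * (b * x) ≤ (S p).slack c →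
      x ≤ K * (2 * J) / qm / b * ((S p).N * (S p).rate) := by
    intro x b hb hx hle
    have h1 : (S p).T * (qm / (2 * J)) * (b * x) ≤ K * ((S p).N * (S p).T * (S p).rate) :=
      (mul_le_mul_of_nonneg_right hmm (by positivity)).trans (hle.trans hsl)
    have h2 : qm * b * x ≤ K * (2 * J) * ((S p).N * (S p).rate) := by
      have h3 : (S p).T * (qm * b * x) ≤ (S p).T * (K * (2 * J) * ((S p).N * (S p).rate)) := by
        calc (S p).T * (qm * b * x) = (S p).T * (qm / (2 * J)) * (b * x) * (2 * J) := by
              field_simp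
          _ ≤ K * ((S p).N * (S p).T * (S p).rate) * (2 * J) := by gcongr
          _ = _ := by ring
      exact le_of_mul_le_mul_left h3 hT0
    rw [div_div, div_mul_eq_mul_div, le_div_iff₀ (by positivity)]
    linarith
  have hA : 0 ≤ K * (2 * J) / qm / d * ((S p).N * (S p).rate) := by positivity
  have hB : 0 ≤ K * (2 * J) / qm / c * ((S p).N * (S p).rate) := by positivity
  refine ⟨k, ?_, ?_⟩
  · have := key _ d hd hmis hk1
    rw [add_mul]
    linarith
  · have h1 : (2 * J : ℝ)⁻¹ * ((S p).T * q0 j) * (c * logDet ((S p).L k) (S p).s) ≤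
        (S p).slack c := by
      refine le_trans ?_ hk2
      gcongr
    have := key _ c hc hld h1
    rw [add_mul]
    linarith

end Regular

/-! ### Matching components and regimes -/

/-- If `σ` never lowers `ρ`, and no index at which it preserves `ρ` shares its image with another
index, then it preserves `ρ` everywhere. -/
lemma eq_of_le_of_injOn {n : ℕ} {ρ : Fin n → ℕ} {σ : Fin n → Fin n} (hle : ∀ j, ρ j ≤ ρ (σ j))
    (hinj : ∀ j j', σ j = σ j' → ρ (σ j) = ρ j → j = j') (j : Fin n) : ρ (σ j) = ρ j := by
  by_contra hne
  -- among the indices whose value is raised, choose one with the largest value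
  obtain ⟨i, hi, himax⟩ := Finset.exists_max_image
    (Finset.univ.filter fun j => ρ (σ j) ≠ ρ j) ρ ⟨j, by simpa using hne⟩
  have hi' : ρ (σ i) ≠ ρ i := by simpa using hi
  have hlt : ρ i < ρ (σ i) := lt_of_le_of_ne (hle i) hi'.symm
  -- `σ` permutes the level set of `ρ` at `σ i`, so that another index is mapped to `σ i` as well
  set F := Finset.univ.filter fun k => ρ k = ρ (σ i) with hF
  have hpres : ∀ k ∈ F, ρ (σ k) = ρ k := fun k hk => by
    by_contra hk'
    have h1 := himax k (by simpa using hk')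
    have h2 : ρ k = ρ (σ i) := by simpa [hF] using hk
    omega
  have hmaps : Set.MapsTo σ F F := fun k hk => by
    have h2 : ρ k = ρ (σ i) := by simpa [hF] using hk
    simp only [hF, Finset.coe_filter, Finset.mem_univ, true_and, Set.mem_ofPred_eq]
    rw [hpres k hk, h2]
  have hinjF : Set.InjOn σ F := fun k hk k' _ hkk' => hinj k k' hkk' (hpres k hk)
  have hsurj := Finset.surjOn_of_injOn_of_card_le σ hmaps hinjF le_rfl
  obtain ⟨k, hk, hki⟩ := hsurj (show σ i ∈ (F : Set (Fin n)) by simp [hF])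
  have h3 := hinj k i hki (hpres k hk)
  have h4 : ρ k = ρ (σ i) := by simpa [hF] using hk
  rw [h3] at h4
  omega

lemma opNorm_proj_sub_sq_le {N k l : ℕ} (L : Matrix (Fin N) (Fin l) ℝ) {s : ℝ} (hs : 0 < s)
    {Λ : Matrix (Fin N) (Fin k) ℝ} (h : IsUnit (Λᵀ * Λ).det) (hkl : l = k) :
    ‖proj Λ - softProj L s‖ ^ 2 ≤ 2 * (‖(Λᵀ * Λ)⁻¹‖ * misfit L s Λ) := by
  refine (opNorm_sq_le_frobSq _).trans ((frobSq_proj_sub_softProj_le L hs h).trans ?_)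
  have := trace_softProj_le L hs
  have hkl' : (l : ℝ) = k := by rw [hkl]
  linarith

namespace Regular

variable {ι : Type*} {J : ℕ} {r : Fin J → ℕ} {S : ι → Sample J r} {l : Filter ι}
  {q0 : Fin J → ℝ} {SF SL : (j : Fin J) → Matrix (Fin (r j)) (Fin (r j)) ℝ}
  {ψ φ : ι → ℝ} {c : ℝ}

/-- Asymptotically, the loadings of component `k` span the loading space of regime `j`. -/
def Covers (S : ι → Sample J r) (l : Filter ι) (j k : Fin J) : Prop :=
  Tendsto (fun p => misfit ((S p).L k) (S p).s ((S p).Λ j) / (S p).N) l (𝓝 0)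

lemma Covers.tendsto_inv_mul {j k : Fin J} (hc : Covers S l j k)
    (h : Regular S l q0 SF SL ψ φ c) :
    Tendsto (fun p => 2 * (‖(((S p).Λ j)ᵀ * (S p).Λ j)⁻¹‖ *
      misfit ((S p).L k) (S p).s ((S p).Λ j))) l (𝓝 0) := by
  have h1 := (h.opNorm_inv_gram j).mul
    (isBigO_refl (fun p => misfit ((S p).L k) (S p).s ((S p).Λ j)) l)
  have h2 := h1.trans_tendsto (hc.congr fun p => by rw [div_eq_inv_mul])
  simpa using h2.const_mul 2

lemma Covers.rank_le [l.NeBot] {j k : Fin J} (hc : Covers S l j k)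
    (h : Regular S l q0 SF SL ψ φ c) : r j ≤ r k := by
  have h1 : Tendsto (fun p => (r j : ℝ) - 2 * (‖(((S p).Λ j)ᵀ * (S p).Λ j)⁻¹‖ *
      misfit ((S p).L k) (S p).s ((S p).Λ j))) l (𝓝 (r j - 0)) :=
    tendsto_const_nhds.sub (hc.tendsto_inv_mul h)
  rw [sub_zero] at h1
  have h2 : (r j : ℝ) ≤ r k := by
    refine le_of_tendsto h1 ?_
    filter_upwards [h.isUnit_det_gram j, h.fit] with p hu hf
    exact (le_trace_softProj _ hf.s_pos hu).trans (trace_softProj_le _ hf.s_pos)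
  exact_mod_cast h2

lemma Covers.tendsto_dist {j k : Fin J} (hc : Covers S l j k)
    (h : Regular S l q0 SF SL ψ φ c) (hr : r k = r j) :
    Tendsto (fun p => ‖proj ((S p).Λ j) - softProj ((S p).L k) (S p).s‖) l (𝓝 0) := by
  have h1 : Tendsto (fun p => ‖proj ((S p).Λ j) - softProj ((S p).L k) (S p).s‖ ^ 2) l (𝓝 0) := by
    refine squeeze_zero' (Eventually.of_forall fun p => sq_nonneg _) ?_ (hc.tendsto_inv_mul h)
    filter_upwards [h.isUnit_det_gram j, h.fit] with p hu hf
    exact opNorm_proj_sub_sq_le _ hf.s_pos hu hr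
  have h2 := h1.sqrt
  rw [Real.sqrt_zero] at h2
  exact h2.congr fun p => Real.sqrt_sq (norm_nonneg _)

/-- A component with as many factors as regime `j` cannot cover any other regime too. -/
lemma Covers.eq [l.NeBot] {j j' k : Fin J} (hc : Covers S l j k) (hc' : Covers S l j' k)
    (h : Regular S l q0 SF SL ψ φ c) (hr : r k = r j) : j = j' := by
  by_contra hne
  obtain ⟨C, hC, hident⟩ := h.ident
  set a : ι → ℝ := fun p => misfit ((S p).L k) (S p).s ((S p).Λ j') / (S p).N +
    ‖proj ((S p).Λ j) - softProj ((S p).L k) (S p).s‖ *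
      (‖(S p).Λ j'‖ ^ 2 / (S p).N) with ha
  set b : ι → ℝ := fun p =>
    ((S p).T : ℝ)⁻¹ * ∑ t ∈ Finset.range (S p).T, (S p).ind j' t * nrm ((S p).f j' t) ^ 2 with hb
  have hb1 : b =O[l] fun _ => (1 : ℝ) := by
    have h1 := (isBigO_refl (fun p => ((S p).T : ℝ)⁻¹) l).mul (h.sum_factor_sq_regime j')
    refine h1.trans_eventuallyEq ?_
    filter_upwards [h.one_le_T] with p hp
    exact inv_mul_cancel₀ (by linarith)
  have hΛ1 : (fun p => ‖(S p).Λ j'‖ ^ 2 / (S p).N) =O[l] fun _ => (1 : ℝ) := by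
    have h1 := (h.opNorm_Λ_sq j').mul (isBigO_refl (fun p => ((S p).N : ℝ)⁻¹) l)
    simp only [div_eq_mul_inv]
    refine h1.trans_eventuallyEq ?_
    filter_upwards [h.one_le_N] with p hp
    exact mul_inv_cancel₀ (by linarith)
  have ha0 : Tendsto a l (𝓝 0) := by
    have h1 : Tendsto (fun p => ‖proj ((S p).Λ j) - softProj ((S p).L k) (S p).s‖ *
        (‖(S p).Λ j'‖ ^ 2 / (S p).N)) l (𝓝 0) := by
      have h2 := (isBigO_refl (fun p =>
        ‖proj ((S p).Λ j) - softProj ((S p).L k) (S p).s‖) l).mul hΛ1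
      refine h2.trans_tendsto ?_
      simpa using hc.tendsto_dist h hr
    simpa using Tendsto.add hc' h1
  have hab : Tendsto (fun p => a p * b p) l (𝓝 0) := by
    refine ((isBigO_refl a l).mul hb1).trans_tendsto ?_
    simpa using ha0
  have hlow : ∀ᶠ p in l, C * (((S p).T : ℝ)⁻¹ * ∑ t ∈ Finset.range (S p).T, (S p).ind j' t) ≤
      a p * b p := by
    filter_upwards [hident, h.fit, h.isUnit_det_gram j, h.one_le_N, h.one_le_T]
      with p hid hf hu hN hT
    have hN0 : (0 : ℝ) < (S p).N := by linarith
    -- the identification bound, where the projection on `Λ j` is replaced by the soft projection on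
    -- `L k`, which fits regime `j'` too
    have hterm : ∀ t ∈ Finset.range (S p).T, C * (S p).ind j' t ≤
        a p * ((S p).ind j' t * nrm ((S p).f j' t) ^ 2) := by
      intro t ht
      by_cases hz : (S p).z t = j'
      · have h1 := hid j' j (Ne.symm hne) t (Finset.mem_range.1 ht) hz
        set w := (S p).Λ j' *ᵥ (S p).f j' t with hw
        have h2 : (S p).f j' t ⬝ᵥ
            ((((S p).Λ j')ᵀ * annihilator ((S p).Λ j) * (S p).Λ j') *ᵥ (S p).f j' t) =
            resid ((S p).L k) (S p).s w -
              w ⬝ᵥ ((proj ((S p).Λ j) - softProj ((S p).L k) (S p).s) *ᵥ w) := by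
          rw [← mulVec_mulVec, ← mulVec_mulVec, dotProduct_mulVec ((S p).f j' t), vecMul_transpose,
            annihilator_eq, resid]
          simp only [sub_mulVec, one_mulVec, dotProduct_sub]
          ring
        have h3 := resid_le_misfit ((S p).L k) hf.s_pos ((S p).Λ j') ((S p).f j' t)
        have h4 := (abs_le.1 (abs_dot_mulVec_le
          (proj ((S p).Λ j) - softProj ((S p).L k) (S p).s) w w)).1
        have h5 : nrm w * nrm w ≤ ‖(S p).Λ j'‖ ^ 2 * nrm ((S p).f j' t) ^ 2 := by
          rw [← mul_pow, ← sq]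
          have := nrm_mulVec_le ((S p).Λ j') ((S p).f j' t)
          have := nrm_nonneg w
          gcongr
        have h6 := mul_le_mul_of_nonneg_left h5
          (norm_nonneg (proj ((S p).Λ j) - softProj ((S p).L k) (S p).s))
        have h7 : a p * (S p).N = misfit ((S p).L k) (S p).s ((S p).Λ j') +
            ‖proj ((S p).Λ j) - softProj ((S p).L k) (S p).s‖ * ‖(S p).Λ j'‖ ^ 2 := by
          simp only [ha]
          field_simp
        have hi : (S p).ind j' t = 1 := if_pos hz
        rw [hi, mul_one, one_mul]
        refine le_of_mul_le_mul_right ?_ hN0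
        calc C * (S p).N ≤ a p * (S p).N * nrm ((S p).f j' t) ^ 2 := by
              rw [h7]
              rw [h2] at h1
              linarith
          _ = _ := by ring
      · have hi : (S p).ind j' t = 0 := if_neg hz
        rw [hi]
        simp
    have h8 := Finset.sum_le_sum hterm
    rw [← Finset.mul_sum, ← Finset.mul_sum] at h8
    have hTi : (0 : ℝ) ≤ ((S p).T : ℝ)⁻¹ := by positivity
    have h9 := mul_le_mul_of_nonneg_left h8 hTi
    simp only [hb]
    linarith
  -- averaging over the dates of regime `j'` gives `C q0 ≤ 0`
  have hlim := le_of_tendsto_of_tendsto ((h.freq j').const_mul C) hab hlow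
  have := mul_pos hC (h.q0_pos j')
  linarith

lemma covers_of_le {j k : Fin J} {K : ℝ} (h : Regular S l q0 SF SL ψ φ c)
    (hle : ∀ᶠ p in l, misfit ((S p).L k) (S p).s ((S p).Λ j) ≤ K * ((S p).N * (S p).rate)) :
    Covers S l j k := by
  have h1 : Tendsto (fun p => K * (S p).rate) l (𝓝 0) := by
    simpa using h.tendsto_rate.const_mul K
  refine squeeze_zero' ?_ ?_ h1
  · filter_upwards [h.fit] with p hf
    exact div_nonneg (misfit_nonneg _ hf.s_pos _) (Nat.cast_nonneg _)
  · filter_upwards [hle, h.one_le_N] with p hp hN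
    rw [div_le_iff₀ (by linarith)]
    linarith

/-- After the alignment of the labels, each component covers the regime of the same name. -/
lemma covers_self (h : Regular S l q0 SF SL ψ φ c) {σ : Equiv.Perm (Fin J)}
    (hr : ∀ j, r (σ j) = r j) (hσ : ∀ j, Covers S l j (σ j)) (j : Fin J) : Covers S l j j := by
  have htr : ∀ j, ∀ᶠ p in l, (r (σ j) : ℝ) - (softProj ((S p).L (σ j)) (S p).s).trace ≤
      2 * (‖(((S p).Λ j)ᵀ * (S p).Λ j)⁻¹‖ * misfit ((S p).L (σ j)) (S p).s ((S p).Λ j)) := by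
    intro j
    filter_upwards [h.isUnit_det_gram j, h.fit] with p hu hf
    have := le_trace_softProj ((S p).L (σ j)) hf.s_pos hu
    have hrj : (r (σ j) : ℝ) = r j := by exact_mod_cast hr j
    linarith
  have hunit : ∀ j, ∀ᶠ p in l, IsUnit (((S p).L (σ j))ᵀ * (S p).L (σ j)).det := by
    intro j
    filter_upwards [htr j, h.fit, ((hσ j).tendsto_inv_mul h).eventually_lt_const one_pos]
      with p hp hf h1
    exact isUnit_det_of_trace (hf.diag _) hf.s_pos (by linarith)
  have hsum : Tendsto (fun p => ∑ j, misfit ((S p).L (σ j)) (S p).s ((S p).Λ j) / (S p).N) l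
      (𝓝 0) := by
    simpa using tendsto_finsetSum Finset.univ fun j _ => hσ j
  -- the alignment compares the hard residuals under the labels of the model with those under `σ`
  have hfrob : Tendsto (fun p => frobSq (annihilator ((S p).L j) * (S p).Λ j) / (S p).N) l
      (𝓝 0) := by
    refine squeeze_zero' (Eventually.of_forall fun p => div_nonneg (frobSq_nonneg _)
      (Nat.cast_nonneg _)) ?_ hsum
    filter_upwards [h.labels, h.fit, eventually_all.2 hunit] with p hlab hf hu
    rw [← Finset.sum_div]
    refine div_le_div_of_nonneg_right ?_ (Nat.cast_nonneg _)
    calc frobSq (annihilator ((S p).L j) * (S p).Λ j)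
        ≤ ∑ j, frobSq (annihilator ((S p).L j) * (S p).Λ j) :=
          Finset.single_le_sum (f := fun j => frobSq (annihilator ((S p).L j) * (S p).Λ j))
            (fun j _ => frobSq_nonneg _) (Finset.mem_univ j)
      _ ≤ ∑ j, frobSq (annihilator ((S p).L (σ j)) * (S p).Λ j) := hlab σ hr
      _ ≤ _ := Finset.sum_le_sum fun j _ => frobSq_annihilator_mul_le hf.s_pos (hu j) _
  -- the gap between hard and soft residuals is controlled by the trace deficit of `L j`, and component
  -- `j = σ i` is known to cover regime `i`
  obtain ⟨i, rfl⟩ := σ.surjective j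
  have hΛ1 : (fun p => ‖(S p).Λ (σ i)‖ ^ 2 / (S p).N) =O[l] fun _ => (1 : ℝ) := by
    have h1 := (h.opNorm_Λ_sq (σ i)).mul (isBigO_refl (fun p => ((S p).N : ℝ)⁻¹) l)
    simp only [div_eq_mul_inv]
    refine h1.trans_eventuallyEq ?_
    filter_upwards [h.one_le_N] with p hp
    exact mul_inv_cancel₀ (by linarith)
  have h2 : Tendsto (fun p => ‖(S p).Λ (σ i)‖ ^ 2 / (S p).N *
      (2 * (‖(((S p).Λ i)ᵀ * (S p).Λ i)⁻¹‖ *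
        misfit ((S p).L (σ i)) (S p).s ((S p).Λ i)))) l (𝓝 0) := by
    refine (hΛ1.mul (isBigO_refl _ l)).trans_tendsto ?_
    simpa using (hσ i).tendsto_inv_mul h
  have h3 := hfrob.add h2
  rw [add_zero] at h3
  refine squeeze_zero' ?_ ?_ h3
  · filter_upwards [h.fit] with p hf
    exact div_nonneg (misfit_nonneg _ hf.s_pos _) (Nat.cast_nonneg _)
  · filter_upwards [h.fit, hunit i, htr i, h.one_le_N] with p hf hu ht hN
    have hN0 : (0 : ℝ) < (S p).N := by linarith
    rw [div_mul_eq_mul_div, ← add_div]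
    refine div_le_div_of_nonneg_right ?_ hN0.le
    refine (misfit_le_frobSq_annihilator hf.s_pos hu ((S p).Λ (σ i))).trans ?_
    have := mul_le_mul_of_nonneg_left ht (sq_nonneg ‖(S p).Λ (σ i)‖)
    linarith

/-- Each regime is fitted, at rate `ρ`, by the loadings of the component of the same name. -/
lemma misfit_le (h : Regular S l q0 SF SL ψ φ c) :
    ∃ K : ℝ, 0 < K ∧ ∀ᶠ p in l, ∀ j,
      misfit ((S p).L j) (S p).s ((S p).Λ j) ≤ K * ((S p).N * (S p).rate) ∧
      logDet ((S p).L j) (S p).s ≤ K * ((S p).N * (S p).rate) := by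
  obtain ⟨K, hK, hev⟩ := h.exists_component
  refine ⟨K, hK, ?_⟩
  -- along an ultrafilter, the component that fits a given regime is eventually constant
  refine mem_iff_ultrafilter.2 fun 𝒰 h𝒰 => ?_
  have h' := h.mono h𝒰
  have hex : ∀ j, ∃ k, ∀ᶠ p in (𝒰 : Filter ι),
      misfit ((S p).L k) (S p).s ((S p).Λ j) ≤ K * ((S p).N * (S p).rate) ∧
      logDet ((S p).L k) (S p).s ≤ K * ((S p).N * (S p).rate) := fun j =>
    Ultrafilter.eventually_exists_iff.1 ((hev.filter_mono h𝒰).mono fun p hp => hp j)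
  choose σ hσ using hex
  have hcov : ∀ j, Covers S 𝒰 j (σ j) := fun j =>
    covers_of_le h' ((hσ j).mono fun p hp => hp.1)
  have hinj : ∀ j j', σ j = σ j' → r (σ j) = r j → j = j' := fun j j' hjj' hr =>
    (hcov j).eq (by rw [hjj']; exact hcov j') h' hr
  have hr : ∀ j, r (σ j) = r j := eq_of_le_of_injOn (fun j => (hcov j).rank_le h') hinj
  have hbij : Function.Bijective σ :=
    Finite.injective_iff_bijective.1 fun j j' hjj' => hinj j j' hjj' (hr j)
  have hself : ∀ j, Covers S 𝒰 j j :=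
    covers_self h' (σ := Equiv.ofBijective σ hbij) hr hcov
  -- component `σ j` covers the regimes `j` and `σ j`, which therefore coincide
  have hid : ∀ j, σ j = j := fun j => ((hcov j).eq (hself (σ j)) h' (hr j)).symm
  have : ∀ᶠ p in (𝒰 : Filter ι), ∀ j,
      misfit ((S p).L j) (S p).s ((S p).Λ j) ≤ K * ((S p).N * (S p).rate) ∧
      logDet ((S p).L j) (S p).s ≤ K * ((S p).N * (S p).rate) :=
    eventually_all.2 fun j => by
      have h1 := hσ j
      have h2 := hid j
      generalize σ j = k at h1 h2
      subst h2
      exact h1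
  exact this

end Regular

/-! ### Classification of the dates -/

namespace Regular

variable {ι : Type*} {J : ℕ} {r : Fin J → ℕ} {S : ι → Sample J r} {l : Filter ι}
  {q0 : Fin J → ℝ} {SF SL : (j : Fin J) → Matrix (Fin (r j)) (Fin (r j)) ℝ}
  {ψ φ : ι → ℝ} {c : ℝ}

/-- The constants of the rates used in the classification of the dates, made common. -/
lemma exists_bounds (h : Regular S l q0 SF SL ψ φ c) :
    ∃ K : ℝ, 1 ≤ K ∧ ∀ᶠ p in l,
      (∀ j, ‖(S p).Λ j‖ ≤ K * √((S p).N : ℝ) ∧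
        ‖(((S p).Λ j)ᵀ * (S p).Λ j)⁻¹‖ ≤ K * ((S p).N : ℝ)⁻¹ ∧
        misfit ((S p).L j) (S p).s ((S p).Λ j) ≤ K * ((S p).N * (S p).rate) ∧
        logDet ((S p).L j) (S p).s ≤ K * ((S p).N * (S p).rate)) ∧
      (∀ t < (S p).T, nrm ((S p).f ((S p).z t) t) ≤ K * ψ p ∧
        nrm ((S p).e t) ≤ K * (√((S p).N : ℝ) * ψ p) ∧
        ∀ j, nrm (((S p).Λ j)ᵀ *ᵥ (S p).e t) ≤ K * (√((S p).N : ℝ) * φ p)) ∧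
      (S p).s ≤ K := by
  have h1 : (fun p => ∑ j, ‖(S p).Λ j‖) =O[l] fun p => √((S p).N : ℝ) := by
    have := IsBigO.sum (s := Finset.univ) fun j _ => h.opNorm_Λ j
    refine this.congr_left fun p => ?_
    simp
  have h2 : (fun p => ∑ j, ‖(((S p).Λ j)ᵀ * (S p).Λ j)⁻¹‖) =O[l] fun p => ((S p).N : ℝ)⁻¹ := by
    have := IsBigO.sum (s := Finset.univ) fun j _ => h.opNorm_inv_gram j
    refine this.congr_left fun p => ?_
    simp
  obtain ⟨K1, hK1, b1⟩ := h1.exists_pos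
  obtain ⟨K2, hK2, b2⟩ := h2.exists_pos
  obtain ⟨K3, hK3, b3⟩ := h.misfit_le
  obtain ⟨K4, hK4, b4⟩ := h.maxima
  obtain ⟨K5, hK5, b5⟩ := h.s_bdd.exists_pos
  rw [isBigOWith_iff] at b1 b2 b5
  refine ⟨K1 + K2 + K3 + K4 + K5 + 1, by linarith, ?_⟩
  filter_upwards [b1, b2, b3, b4, b5, h.fit, h.one_le_ψ, h.one_le_φ, h.rate_pos]
    with p b1 b2 b3 b4 b5 hf hψ hφ hr
  have e1 : ∀ j, ‖(S p).Λ j‖ ≤ ∑ j, ‖(S p).Λ j‖ := fun j =>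
    Finset.single_le_sum (f := fun j => ‖(S p).Λ j‖) (fun j _ => norm_nonneg _)
      (Finset.mem_univ j)
  have e2 : ∀ j, ‖(((S p).Λ j)ᵀ * (S p).Λ j)⁻¹‖ ≤ ∑ j, ‖(((S p).Λ j)ᵀ * (S p).Λ j)⁻¹‖ := fun j =>
    Finset.single_le_sum (f := fun j => ‖(((S p).Λ j)ᵀ * (S p).Λ j)⁻¹‖)
      (fun j _ => norm_nonneg _) (Finset.mem_univ j)
  rw [Real.norm_of_nonneg (Finset.sum_nonneg fun j _ => norm_nonneg _),
    Real.norm_of_nonneg (by positivity)] at b1 b2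
  rw [Real.norm_of_nonneg hf.s_pos.le, norm_one, mul_one] at b5
  have mono : ∀ {a y : ℝ}, 0 ≤ y → a ≤ K1 + K2 + K3 + K4 + K5 + 1 →
      a * y ≤ (K1 + K2 + K3 + K4 + K5 + 1) * y := fun hy ha => mul_le_mul_of_nonneg_right ha hy
  refine ⟨fun j => ⟨?_, ?_, ?_, ?_⟩, fun t ht => ⟨?_, ?_, fun j => ?_⟩, by linarith⟩
  · exact ((e1 j).trans b1).trans (mono (by positivity) (by linarith))
  · exact ((e2 j).trans b2).trans (mono (by positivity) (by linarith))
  · exact ((b3 j).1).trans (mono (by positivity) (by linarith))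
  · exact ((b3 j).2).trans (mono (by positivity) (by linarith))
  · exact ((b4 t ht).1).trans (mono (by positivity) (by linarith))
  · exact ((b4 t ht).2.1).trans (mono (by positivity) (by linarith))
  · exact ((b4 t ht).2.2 j).trans (mono (by positivity) (by linarith))

/-- At every date, the squared residual with respect to a wrong component exceeds the one with
respect to the right component by a multiple of `N`. -/
lemma exists_resid_gap (h : Regular S l q0 SF SL ψ φ c) :
    ∃ C : ℝ, 0 < C ∧ ∀ᶠ p in l, ∀ j k, j ≠ k → ∀ t < (S p).T, (S p).z t = j →
      C * (S p).N ≤ resid ((S p).L k) (S p).s ((S p).obs t) -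
        resid ((S p).L j) (S p).s ((S p).obs t) := by
  obtain ⟨K, hK, hb⟩ := h.exists_bounds
  obtain ⟨C, hC, hident⟩ := h.ident
  have hK0 : 0 < K := by linarith
  -- the relative error terms
  set u : ι → ℝ := fun p => √((S p).rate) with hu
  set ω : ι → ℝ := fun p => ψ p * φ p / √((S p).N : ℝ) with hω
  have hrate2 : Tendsto (fun p => (S p).rate * ψ p ^ 2) l (𝓝 0) := by
    have h1 := h.tendsto_rate.sqrt.mul h.rate_ψ
    rw [Real.sqrt_zero, zero_mul] at h1
    refine h1.congr' ?_
    filter_upwards [h.rate_pos] with p hp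
    rw [← mul_assoc, Real.mul_self_sqrt hp.le]
  have hη : Tendsto (fun p => (8 * K ^ 5 + 2 * K ^ 3) * (u p * ψ p ^ 2) +
      K ^ 3 * ((S p).rate * ψ p ^ 2) + (2 * K ^ 2 + 2 * K ^ 4) * ω p + K ^ 3 * ω p ^ 2) l
      (𝓝 0) := by
    have h1 := (((h.rate_ψ.const_mul (8 * K ^ 5 + 2 * K ^ 3)).add (hrate2.const_mul (K ^ 3))).add
      (h.ψ_φ.const_mul (2 * K ^ 2 + 2 * K ^ 4))).add ((h.ψ_φ.pow 2).const_mul (K ^ 3))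
    simpa using h1
  refine ⟨C / 2, by linarith, ?_⟩
  filter_upwards [hb, hident, hη.eventually_le_const (show 0 < C / 2 by linarith), h.fit,
    h.one_le_N, h.one_le_ψ, h.one_le_φ, h.rate_pos, eventually_all.2 h.isUnit_det_gram]
    with p hb hid hηp hf hN hψ hφ hr hunit j k hjk t ht hz
  obtain ⟨hb1, hb2, hb3⟩ := hb
  have hN0 : (0 : ℝ) < (S p).N := by linarith
  set x := √((S p).N : ℝ) with hx
  have hx0 : 0 < x := Real.sqrt_pos.2 hN0
  have hxx : x ^ 2 = (S p).N := Real.sq_sqrt hN0.le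
  have hs := hf.s_pos
  have hu0 : 0 ≤ u p := Real.sqrt_nonneg _
  have huu : u p ^ 2 = (S p).rate := Real.sq_sqrt hr.le
  have hψ0 : 0 < ψ p := by linarith
  have hφ0 : 0 < φ p := by linarith
  obtain ⟨hfK, heK, hΛeK⟩ := hb2 t ht
  subst hz
  set j := (S p).z t with hj
  set f := (S p).f j t with hfdef
  set e := (S p).e t with hedef
  -- size of the individual terms of `le_resid_sub_resid`
  have hδ : ‖proj ((S p).Λ k) - softProj ((S p).L k) (S p).s‖ ≤ 2 * K * u p := by
    have h1 := opNorm_proj_sub_sq_le ((S p).L k) hs (hunit k) rfl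
    have h2 : ‖(((S p).Λ k)ᵀ * (S p).Λ k)⁻¹‖ * misfit ((S p).L k) (S p).s ((S p).Λ k) ≤
        (K * ((S p).N : ℝ)⁻¹) * (K * ((S p).N * (S p).rate)) :=
      mul_le_mul (hb1 k).2.1 (hb1 k).2.2.1 (misfit_nonneg _ hs _) (by positivity)
    have h3 : (K * ((S p).N : ℝ)⁻¹) * (K * ((S p).N * (S p).rate)) = K ^ 2 * u p ^ 2 := by
      rw [huu]
      field_simp
    refine le_of_sq_le_sq ?_ (by positivity)
    nlinarith [sq_nonneg (K * u p)]
  have hw : nrm ((S p).Λ j *ᵥ f) ≤ K ^ 2 * (x * ψ p) := by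
    refine (nrm_mulVec_le _ _).trans ?_
    calc ‖(S p).Λ j‖ * nrm f ≤ (K * x) * (K * ψ p) :=
          mul_le_mul (hb1 j).1 hfK (nrm_nonneg _) (by positivity)
      _ = _ := by ring
  have he : nrm e ≤ K ^ 2 * (x * ψ p) := heK.trans (by
    have : K ≤ K ^ 2 := by nlinarith
    gcongr)
  have hPe : nrm (proj ((S p).Λ k) *ᵥ e) ^ 2 ≤ K ^ 3 * φ p ^ 2 := by
    refine (nrm_proj_mulVec_sq_le (hunit k) e).trans ?_
    calc ‖(((S p).Λ k)ᵀ * (S p).Λ k)⁻¹‖ * nrm (((S p).Λ k)ᵀ *ᵥ e) ^ 2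
        ≤ (K * ((S p).N : ℝ)⁻¹) * (K * (x * φ p)) ^ 2 := by
          refine mul_le_mul (hb1 k).2.1 ?_ (sq_nonneg _) (by positivity)
          have := hΛeK k
          have := nrm_nonneg (((S p).Λ k)ᵀ *ᵥ e)
          gcongr
      _ = K ^ 3 * φ p ^ 2 := by
          rw [← hxx]
          field_simp
  have hPe' : nrm (proj ((S p).Λ k) *ᵥ e) ≤ K ^ 2 * φ p := by
    refine le_of_sq_le_sq (hPe.trans ?_) (by positivity)
    have : K ^ 3 ≤ K ^ 4 := by
      have : 0 < K ^ 3 := by positivity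
      nlinarith
    calc K ^ 3 * φ p ^ 2 ≤ K ^ 4 * φ p ^ 2 := by gcongr
      _ = _ := by ring
  have hm := (hb1 j).2.2.1
  have hm0 := misfit_nonneg ((S p).L j) hs ((S p).Λ j)
  have hsm : √(misfit ((S p).L j) (S p).s ((S p).Λ j)) ≤ K * x * u p := by
    refine Real.sqrt_le_iff.2 ⟨by positivity, hm.trans ?_⟩
    rw [mul_pow, mul_pow, hxx, huu]
    have : K ≤ K ^ 2 := by nlinarith
    calc K * ((S p).N * (S p).rate) ≤ K ^ 2 * ((S p).N * (S p).rate) := by gcongr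
      _ = _ := by ring
  have hgap := Sample.le_resid_sub_resid hs (Lj := (S p).L j) (Λj := (S p).Λ j) (hunit k) hδ f e
  have hT0 := hid j k hjk t ht rfl
  -- each error term is negligible relative to `N = x²`
  have hT1 : 2 * K * u p * (nrm ((S p).Λ j *ᵥ f) + nrm e) ^ 2 ≤
      x ^ 2 * (8 * K ^ 5 * (u p * ψ p ^ 2)) := by
    have h1 : nrm ((S p).Λ j *ᵥ f) + nrm e ≤ 2 * (K ^ 2 * (x * ψ p)) := by linarith
    have h0 : 0 ≤ nrm ((S p).Λ j *ᵥ f) + nrm e := add_nonneg (nrm_nonneg _) (nrm_nonneg _)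
    calc 2 * K * u p * (nrm ((S p).Λ j *ᵥ f) + nrm e) ^ 2
        ≤ 2 * K * u p * (2 * (K ^ 2 * (x * ψ p))) ^ 2 := by gcongr
      _ = _ := by ring
  have hω1 : x ^ 2 * ω p = x * (ψ p * φ p) := by
    simp only [hω]
    rw [← hx]
    field_simp
  have hω2 : x ^ 2 * ω p ^ 2 = (ψ p * φ p) ^ 2 := by
    simp only [hω]
    rw [← hx]
    field_simp
  have hT2 : nrm f * nrm (((S p).Λ j)ᵀ *ᵥ e) ≤ x ^ 2 * (K ^ 2 * ω p) := by
    calc nrm f * nrm (((S p).Λ j)ᵀ *ᵥ e) ≤ (K * ψ p) * (K * (x * φ p)) :=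
          mul_le_mul hfK (hΛeK j) (nrm_nonneg _) (by positivity)
      _ = K ^ 2 * (x * (ψ p * φ p)) := by ring
      _ = _ := by rw [← hω1]; ring
  have hT3 : nrm ((S p).Λ j *ᵥ f) * nrm (proj ((S p).Λ k) *ᵥ e) ≤ x ^ 2 * (K ^ 4 * ω p) := by
    calc nrm ((S p).Λ j *ᵥ f) * nrm (proj ((S p).Λ k) *ᵥ e)
        ≤ (K ^ 2 * (x * ψ p)) * (K ^ 2 * φ p) := mul_le_mul hw hPe' (nrm_nonneg _) (by positivity)
      _ = K ^ 4 * (x * (ψ p * φ p)) := by ring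
      _ = _ := by rw [← hω1]; ring
  have hT4 : nrm (proj ((S p).Λ k) *ᵥ e) ^ 2 ≤ x ^ 2 * (K ^ 3 * ω p ^ 2) := by
    refine hPe.trans ?_
    have h1 : x ^ 2 * (K ^ 3 * ω p ^ 2) = K ^ 3 * (ψ p * φ p) ^ 2 := by rw [← hω2]; ring
    rw [h1]
    have : φ p ≤ ψ p * φ p := le_mul_of_one_le_left hφ0.le hψ
    gcongr
  have hT5 : misfit ((S p).L j) (S p).s ((S p).Λ j) * nrm f ^ 2 ≤
      x ^ 2 * (K ^ 3 * ((S p).rate * ψ p ^ 2)) := by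
    have := nrm_nonneg f
    calc misfit ((S p).L j) (S p).s ((S p).Λ j) * nrm f ^ 2
        ≤ K * ((S p).N * (S p).rate) * (K * ψ p) ^ 2 :=
          mul_le_mul hm (by gcongr) (sq_nonneg _) (by positivity)
      _ = _ := by rw [hxx]; ring
  have hT6 : √(misfit ((S p).L j) (S p).s ((S p).Λ j)) * nrm f * nrm e ≤
      x ^ 2 * (K ^ 3 * (u p * ψ p ^ 2)) := by
    calc √(misfit ((S p).L j) (S p).s ((S p).Λ j)) * nrm f * nrm e
        ≤ (K * x * u p) * (K * ψ p) * (K * (x * ψ p)) := by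
          refine mul_le_mul (mul_le_mul hsm hfK (nrm_nonneg _) (by positivity)) heK
            (nrm_nonneg _) (by positivity)
      _ = _ := by ring
  have hsum := mul_le_mul_of_nonneg_left hηp (sq_nonneg x)
  have hobs : (S p).obs t = (S p).Λ j *ᵥ f + e := rfl
  rw [hobs]
  rw [hxx] at hT1 hT2 hT3 hT4 hT5 hT6 hsum
  linarith

/-- The posterior probabilities identify the regime of every date, up to an error that is
exponentially small in `N`, uniformly over the dates. -/
lemma post_sub_ind_le (h : Regular S l q0 SF SL ψ φ c) :
    ∃ K a : ℝ, 0 < K ∧ 0 < a ∧ ∀ᶠ p in l, ∀ j, ∀ t < (S p).T,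
      |(S p).post j t - (S p).ind j t| ≤ K * Real.exp (-(a * (S p).N)) := by
  obtain ⟨K, hK, hb⟩ := h.exists_bounds
  obtain ⟨C, hC, hgap⟩ := h.exists_resid_gap
  have hK0 : 0 < K := by linarith
  rcases l.eq_or_neBot with rfl | hl
  · exact ⟨1, 1, one_pos, one_pos, by trivial⟩
  have hc : 0 < c := (h.fit.exists).elim fun p hp => hp.c_pos
  have hJ : (0 : ℝ) < J + 1 := by positivity
  -- `s ≤ K` turns the residual gap `C N` into a deviance gap `C N / K`, half of which is reserved for
  -- the log-determinant of the right component; densities carry another factor one half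
  refine ⟨(J + 1) * c⁻¹, C / (4 * K), by positivity, by positivity, ?_⟩
  have hKr : Tendsto (fun p => K * (S p).rate) l (𝓝 0) := by
    simpa using h.tendsto_rate.const_mul K
  filter_upwards [hb, hgap, h.fit, h.one_le_N,
    hKr.eventually_le_const (show 0 < C / (2 * K) by positivity)]
    with p hb hgap hf hN hr j t ht
  obtain ⟨hb1, hb2, hb3⟩ := hb
  have hs := hf.s_pos
  have hN0 : (0 : ℝ) < (S p).N := by linarith
  have hq0 : ∀ j, 0 < (S p).q j := fun j => hc.trans_le (hf.le_q j)
  set E := Real.exp (-(C / (4 * K) * (S p).N)) with hE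
  have hE0 : 0 < E := Real.exp_pos _
  have hwrong : ∀ k, k ≠ (S p).z t → (S p).post k t ≤ c⁻¹ * E := by
    intro k hk
    set j := (S p).z t with hj
    have h1 := postProb_le hq0 hs (S p).L ((S p).obs t) j k
    refine h1.trans (mul_le_mul ?_ ?_ (Real.exp_pos _).le (by positivity))
    · have h2 : (S p).q k ≤ 1 := by
        rw [← hf.sum_q]
        exact Finset.single_le_sum (f := (S p).q) (fun k _ => (hq0 k).le) (Finset.mem_univ k)
      rw [div_eq_mul_inv]
      calc (S p).q k * ((S p).q j)⁻¹ ≤ 1 * c⁻¹ :=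
            mul_le_mul h2 (inv_anti₀ hc (hf.le_q j)) (inv_pos.2 (hq0 j)).le zero_le_one
        _ = c⁻¹ := one_mul _
    · rw [hE]
      refine Real.exp_le_exp.2 (neg_le_neg ?_)
      have h2 := hgap j k hk.symm t ht rfl
      have h3 := logDet_nonneg ((S p).L k) hs
      have h4 := (hb1 j).2.2.2
      have h5 : K * ((S p).N * (S p).rate) ≤ C / (2 * K) * (S p).N := by
        calc K * ((S p).N * (S p).rate) = K * (S p).rate * (S p).N := by ring
          _ ≤ _ := by gcongr
      have h6 : C / K * (S p).N ≤ (resid ((S p).L k) (S p).s ((S p).obs t) -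
          resid ((S p).L j) (S p).s ((S p).obs t)) / (S p).s := by
        calc C / K * (S p).N = C * (S p).N / K := by ring
          _ ≤ (resid ((S p).L k) (S p).s ((S p).obs t) -
              resid ((S p).L j) (S p).s ((S p).obs t)) / K := by gcongr
          _ ≤ _ := by
            refine div_le_div_of_nonneg_left ?_ hs hb3
            exact (by positivity : 0 ≤ C * ((S p).N : ℝ)).trans h2
      have h7 : C / (4 * K) * ((S p).N : ℝ) = (C / K * (S p).N - C / (2 * K) * (S p).N) / 2 := by
        field_simp
        ring
      rw [h7]
      simp only [deviance]
      rw [sub_div] at h6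
      linarith
  have hp0 : ∀ k, 0 ≤ (S p).post k t := fun k => postProb_nonneg hq0 hs _ _ k
  -- the probability of the right regime is one minus the others
  by_cases hz : (S p).z t = j
  · have h1 : ∑ k, (S p).post k t = 1 := sum_postProb hq0 hs _ _ j
    rw [← Finset.add_sum_erase _ _ (Finset.mem_univ j)] at h1
    have h2 : ∑ k ∈ Finset.univ.erase j, (S p).post k t ≤
        ∑ _k ∈ Finset.univ.erase j, c⁻¹ * E := by
      refine Finset.sum_le_sum fun k hk => hwrong k ?_
      rw [hz]
      exact Finset.ne_of_mem_erase hk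
    have h3 : ∑ _k ∈ Finset.univ.erase j, c⁻¹ * E ≤ ∑ _k : Fin J, c⁻¹ * E :=
      Finset.sum_le_sum_of_subset_of_nonneg (Finset.erase_subset _ _) fun _ _ _ => by positivity
    have h3' : ∑ _k : Fin J, c⁻¹ * E = J * (c⁻¹ * E) := by
      rw [Finset.sum_const, Finset.card_univ, Fintype.card_fin, nsmul_eq_mul]
    rw [h3'] at h3
    have h4 : 0 ≤ ∑ k ∈ Finset.univ.erase j, (S p).post k t := Finset.sum_nonneg fun k _ => hp0 k
    have hi : (S p).ind j t = 1 := if_pos hz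
    have h5 : 0 < c⁻¹ * E := by positivity
    rw [hi, abs_le]
    constructor <;> nlinarith
  · have hi : (S p).ind j t = 0 := if_neg hz
    rw [hi, sub_zero, abs_of_nonneg (hp0 j)]
    refine (hwrong j (Ne.symm hz)).trans ?_
    have h5 : 0 < c⁻¹ * E := by positivity
    have : (0 : ℝ) ≤ J := by positivity
    nlinarith

end Regular

/-! ### Uniqueness of the eigenvectors -/

lemma sqrt_mul_sqrt {n : ℕ} {A : Matrix (Fin n) (Fin n) ℝ} (hA : A.PosSemidef) :
    CFC.sqrt A * CFC.sqrt A = A := CFC.sqrt_mul_sqrt_self A hA.nonneg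

lemma transpose_sqrt {n : ℕ} (A : Matrix (Fin n) (Fin n) ℝ) : (CFC.sqrt A)ᵀ = CFC.sqrt A :=
  transpose_eq_of_posSemidef (nonneg_iff_posSemidef.1 (CFC.sqrt_nonneg A))

lemma isUnit_det_sqrt {n : ℕ} {A : Matrix (Fin n) (Fin n) ℝ} (hA : A.PosDef) :
    IsUnit (CFC.sqrt A).det := by
  have h := hA.det_pos.ne'
  rw [← sqrt_mul_sqrt hA.posSemidef, det_mul] at h
  exact (left_ne_zero_of_mul h).isUnit

/-- An orthogonal matrix that intertwines two diagonal matrices with decreasing diagonals, one of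
them strictly decreasing, and has nonnegative diagonal, is the identity. -/
lemma eq_one_of_intertwines {n : ℕ} {O : Matrix (Fin n) (Fin n) ℝ} {v d : Fin n → ℝ}
    (hO : Oᵀ * O = 1) (hv : StrictAnti v) (hd : Antitone d)
    (h : diagonal v * O = O * diagonal d) (hpos : ∀ a, 0 ≤ O a a) : O = 1 ∧ d = v := by
  have hent : ∀ a b, O a b ≠ 0 → v a = d b := by
    intro a b hab
    have := congrFun (congrFun h a) b
    rw [diagonal_mul, mul_diagonal, mul_comm] at this
    exact mul_left_cancel₀ hab this
  have hcol : ∀ b b', ∑ a, O a b * O a b' = if b = b' then 1 else 0 := by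
    intro b b'
    have := congrFun (congrFun hO b) b'
    rwa [mul_apply, one_apply] at this
  have hex : ∀ b, ∃ a, O a b ≠ 0 := by
    intro b
    by_contra! hz
    have := hcol b b
    simp [hz] at this
  choose σ hσ using hex
  -- each column has its only nonzero entry in row `σ b`, and `σ` is increasing, hence the identity
  have huniq : ∀ a b, O a b ≠ 0 → a = σ b := fun a b hab =>
    hv.injective ((hent a b hab).trans (hent _ b (hσ b)).symm)
  have hzero : ∀ a b, a ≠ σ b → O a b = 0 := fun a b hab => by
    by_contra hne
    exact hab (huniq a b hne)
  have hmono : Monotone σ := by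
    intro b b' hb
    have := hd hb
    rw [← hent _ _ (hσ b), ← hent _ _ (hσ b')] at this
    exact hv.le_iff_ge.1 this
  have hinj : Function.Injective σ := by
    intro b b' hb
    by_contra hne
    have h1 := hcol b b'
    rw [if_neg hne, Finset.sum_eq_single (σ b)] at h1
    · rcases mul_eq_zero.1 h1 with h2 | h2
      · exact hσ b h2
      · rw [hb] at h2
        exact hσ b' h2
    · intro a _ ha
      rw [hzero a b ha, zero_mul]
    · intro h2
      exact absurd (Finset.mem_univ _) h2
  have hid : σ = id := by
    have hs : StrictMono σ := hmono.strictMono_of_injective hinj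
    have hsurj := Finite.injective_iff_surjective.1 hinj
    have := Subsingleton.elim (hs.orderIsoOfSurjective σ hsurj) (OrderIso.refl _)
    exact funext fun b => congrArg (fun e : Fin n ≃o Fin n => e b) this
  subst hid
  refine ⟨?_, funext fun b => (hent _ _ (hσ b)).symm⟩
  ext a b
  by_cases hab : a = b
  · subst hab
    have h1 := hcol a a
    rw [if_pos rfl, Finset.sum_eq_single a] at h1
    · rw [one_apply_eq]
      nlinarith [hpos a]
    · intro a' _ ha
      rw [hzero a' a ha, zero_mul]
    · intro h2
      exact absurd (Finset.mem_univ _) h2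
  · rw [hzero a b hab, one_apply_ne hab]

/-- A normalized solution of the limiting eigenvalue problem is the one given by the chosen
eigenvectors. -/
lemma IsEigen.eq_of_solution {n : ℕ} {SF SL : Matrix (Fin n) (Fin n) ℝ} {v : Fin n → ℝ}
    {U : Matrix (Fin n) (Fin n) ℝ} (hU : IsEigen SF SL v U) (hSL : SL.PosDef)
    {Y : Matrix (Fin n) (Fin n) ℝ} {d : Fin n → ℝ} (hY : Y * Yᵀ = SL) (hd : Antitone d)
    (h : SL * SF * Y = Y * diagonal d) (hpos : ∀ a, 0 ≤ (Uᵀ * (CFC.sqrt SL)⁻¹ * Y) a a) :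
    Y = CFC.sqrt SL * U ∧ d = v := by
  set R := CFC.sqrt SL with hR
  have hRu : IsUnit R.det := isUnit_det_sqrt hSL
  have hRR : R * R = SL := sqrt_mul_sqrt hSL.posSemidef
  have hRt : Rᵀ = R := transpose_sqrt SL
  have hRit : (R⁻¹)ᵀ = R⁻¹ := by rw [transpose_nonsing_inv, hRt]
  have hUU : U * Uᵀ = 1 := mul_eq_one_comm.1 hU.orthonormal
  set O := Uᵀ * R⁻¹ * Y with hO
  have hOO : O * Oᵀ = 1 := by
    have : O * Oᵀ = Uᵀ * R⁻¹ * (Y * Yᵀ) * R⁻¹ * U := by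
      rw [hO]
      simp only [transpose_mul, transpose_transpose, hRit, Matrix.mul_assoc]
    rw [this, hY, ← hRR]
    have h2 : Uᵀ * R⁻¹ * (R * R) * R⁻¹ * U = Uᵀ * (R⁻¹ * R) * (R * R⁻¹) * U := by
      simp only [Matrix.mul_assoc]
    rw [h2, nonsing_inv_mul _ hRu, mul_nonsing_inv _ hRu, Matrix.mul_one, Matrix.mul_one,
      hU.orthonormal]
  -- in the coordinates `O` the equation says that `O` intertwines the two spectra
  have hvO : diagonal v * O = O * diagonal d := by
    have h1 : diagonal v = Uᵀ * (R * SF * R) * U := by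
      rw [Matrix.mul_assoc, hU.eigen, ← Matrix.mul_assoc, hU.orthonormal, Matrix.one_mul]
    calc diagonal v * O = Uᵀ * (R * SF * R) * (U * Uᵀ) * R⁻¹ * Y := by
          rw [h1, hO]
          simp only [Matrix.mul_assoc]
      _ = Uᵀ * (R * SF) * (R * R⁻¹) * Y := by
          rw [hUU]
          simp only [Matrix.mul_assoc, Matrix.one_mul]
      _ = Uᵀ * ((R⁻¹ * R) * R) * SF * Y := by
          rw [mul_nonsing_inv _ hRu, nonsing_inv_mul _ hRu]
          simp only [Matrix.mul_assoc, Matrix.one_mul]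
      _ = Uᵀ * R⁻¹ * (R * R * SF * Y) := by simp only [Matrix.mul_assoc]
      _ = O * diagonal d := by
          rw [hRR, h, hO]
          simp only [Matrix.mul_assoc]
  obtain ⟨h1, h2⟩ := eq_one_of_intertwines (mul_eq_one_comm.1 hOO) hU.anti hd hvO hpos
  refine ⟨?_, h2⟩
  calc Y = R * (U * Uᵀ) * R⁻¹ * Y := by rw [hUU, Matrix.mul_one, mul_nonsing_inv _ hRu,
        Matrix.one_mul]
    _ = R * U * O := by rw [hO]; simp only [Matrix.mul_assoc]
    _ = R * U := by rw [h1, Matrix.mul_one]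

lemma opNorm_le_trace {n : ℕ} {A : Matrix (Fin n) (Fin n) ℝ} (hA : A.PosSemidef) :
    ‖A‖ ≤ A.trace := by
  obtain ⟨D, rfl⟩ := exists_gram hA
  rw [opNorm_transpose_mul_self, trace_transpose_mul_self]
  exact opNorm_sq_le_frobSq D

/-! ### The principal components equation of a sample -/

namespace Sample

variable {J : ℕ} {r : Fin J → ℕ} {S : Sample J r}

variable (S) in
/-- The effect on the second moments of the posterior misclassification of the dates. -/
noncomputable def misclass (j : Fin J) : Matrix (Fin S.N) (Fin S.N) ℝ :=
  weightedGram S.T (fun t => S.post j t - S.ind j t) S.obs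

variable (S) in
/-- The part of the posterior second moment matrix of the observations that is not due to the
factors alone. -/
noncomputable def rest (j : Fin J) : Matrix (Fin S.N) (Fin S.N) ℝ :=
  S.Λ j * (S.cross j)ᵀ + S.cross j * (S.Λ j)ᵀ + S.errGram j + S.misclass j

lemma weightedGram_post (j : Fin J) :
    weightedGram S.T (S.post j) S.obs = S.Λ j * S.facGram j * (S.Λ j)ᵀ + S.rest j := by
  have h1 : weightedGram S.T (S.ind j) S.obs = S.Λ j * S.facGram j * (S.Λ j)ᵀ +
      (S.Λ j * (S.cross j)ᵀ + S.cross j * (S.Λ j)ᵀ + S.errGram j) := by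
    simp only [weightedGram, facGram, cross, errGram, Matrix.mul_sum, Matrix.sum_mul,
      transpose_sum, ← Finset.sum_add_distrib]
    refine Finset.sum_congr rfl fun t _ => ?_
    by_cases hz : S.z t = j
    · subst hz
      simp only [obs, signal, transpose_smul, transpose_vecMulVec, Matrix.mul_smul,
        Matrix.smul_mul, mul_vecMulVec, vecMulVec_mul, vecMul_transpose, vecMulVec_add,
        add_vecMulVec, smul_add]
      abel
    · have : S.ind j t = 0 := if_neg hz
      simp [this]
  have h2 : weightedGram S.T (S.post j) S.obs =
      weightedGram S.T (S.ind j) S.obs + S.misclass j := by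
    simp only [misclass, weightedGram, ← Finset.sum_add_distrib]
    refine Finset.sum_congr rfl fun t _ => ?_
    rw [← add_smul, add_sub_cancel]
  rw [h2, h1, rest, add_assoc]

/-- The principal components equation for the maximizer of the likelihood. -/
lemma IsFit.weightedGram_mul {c : ℝ} (h : S.IsFit c) (j : Fin J) :
    (S.Λ j * S.facGram j * (S.Λ j)ᵀ + S.rest j) * S.L j =
      (∑ t ∈ Finset.range S.T, S.post j t) •
        (S.L j * ((S.L j)ᵀ * S.L j + S.s • (1 : Matrix (Fin (r j)) (Fin (r j)) ℝ))) := by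
  have hq : ∀ j, 0 < S.q j := fun j => h.c_pos.trans_le (h.le_q j)
  rw [← weightedGram_post]
  exact weightedGram_mul_of_min (fun t => postProb_nonneg hq h.s_pos _ _ j) h.s_pos (h.diag j)
    fun Λ => sum_post_deviance_le hq h.s_pos h.isMax j Λ

lemma opNorm_weightedGram_le {N T : ℕ} {p : ℕ → ℝ} {x : ℕ → Fin N → ℝ} {η b : ℝ}
    (hη : 0 ≤ η) (hp : ∀ t < T, |p t| ≤ η) (hx : ∀ t < T, nrm (x t) ≤ b) :
    ‖weightedGram T p x‖ ≤ T * (η * b ^ 2) := by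
  rw [weightedGram]
  refine (norm_sum_le _ _).trans ?_
  have : ∀ t ∈ Finset.range T, ‖p t • vecMulVec (x t) (x t)‖ ≤ η * b ^ 2 := by
    intro t ht
    have ht := Finset.mem_range.1 ht
    rw [norm_smul, Real.norm_eq_abs]
    have h1 := opNorm_vecMulVec_le (x t) (x t)
    have h2 := hx t ht
    have h3 := nrm_nonneg (x t)
    refine mul_le_mul (hp t ht) (h1.trans ?_) (norm_nonneg _) hη
    nlinarith
  refine (Finset.sum_le_sum this).trans (le_of_eq ?_)
  simp

end Sample

namespace Regular

variable {ι : Type*} {J : ℕ} {r : Fin J → ℕ} {S : ι → Sample J r} {l : Filter ι}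
  {q0 : Fin J → ℝ} {SF SL : (j : Fin J) → Matrix (Fin (r j)) (Fin (r j)) ℝ}
  {ψ φ : ι → ℝ} {c : ℝ}

/-- `ψ²` grows no faster than `N`. -/
lemma ψ_sq_le (h : Regular S l q0 SF SL ψ φ c) : ∀ᶠ p in l, ψ p ^ 2 ≤ (S p).N := by
  filter_upwards [h.rate_ψ.eventually_le_const one_pos, h.one_le_N,
    h.rate_pos] with p h1 hN hr
  have h2 : (√((S p).N : ℝ))⁻¹ ≤ (S p).rate := le_add_of_nonneg_left (by positivity)
  have hN0 : 0 < √((S p).N : ℝ) := Real.sqrt_pos.2 (by linarith)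
  have hN1 : 1 ≤ √((S p).N : ℝ) := Real.one_le_sqrt.2 hN
  have h3 : (√((S p).N : ℝ))⁻¹ ≤ √((S p).rate) := by
    refine Real.le_sqrt_of_sq_le (le_trans ?_ h2)
    have : (√((S p).N : ℝ))⁻¹ ≤ 1 := inv_le_one_of_one_le₀ hN1
    have : 0 ≤ (√((S p).N : ℝ))⁻¹ := by positivity
    nlinarith
  have h4 : (√((S p).N : ℝ))⁻¹ * ψ p ^ 2 ≤ 1 :=
    (mul_le_mul_of_nonneg_right h3 (sq_nonneg _)).trans h1
  rw [inv_mul_le_iff₀ hN0, mul_one] at h4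
  have h5 : √((S p).N : ℝ) * √((S p).N : ℝ) = (S p).N := Real.mul_self_sqrt (by linarith)
  nlinarith

/-- Misclassification of the dates is asymptotically negligible. -/
lemma misclass_isBigO (h : Regular S l q0 SF SL ψ φ c) (j : Fin J) :
    (fun p => ‖(S p).misclass j‖) =O[l] fun p => ((S p).T : ℝ) * ((S p).N : ℝ)⁻¹ := by
  obtain ⟨K, hK, hb⟩ := h.exists_bounds
  obtain ⟨K', a, hK', ha, hpost⟩ := h.post_sub_ind_le
  -- the exponential rate beats the squared observations, which are `O(N²)`, and a further factor `N`
  have hdecay : Tendsto (fun p => ((S p).N : ℝ) ^ 3 * Real.exp (-(a * (S p).N))) l (𝓝 0) := by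
    have h1 := (Real.tendsto_pow_mul_exp_neg_atTop_nhds_zero 3).comp
      (h.N_top.const_mul_atTop ha)
    have h2 := h1.const_mul ((a ^ 3)⁻¹)
    rw [mul_zero] at h2
    refine h2.congr fun p => ?_
    simp only [Function.comp]
    rw [mul_pow]
    field_simp
  refine IsBigO.of_bound (K' * (4 * K ^ 4)) ?_
  filter_upwards [hb, hpost, hdecay.eventually_le_const one_pos, h.ψ_sq_le, h.one_le_N,
    h.one_le_ψ] with p hb hpost hdec hψN hN hψ
  have hN0 : 0 < ((S p).N : ℝ) := by linarith
  set E := Real.exp (-(a * (S p).N)) with hE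
  have hE0 : 0 < E := Real.exp_pos _
  have hx2 : √((S p).N : ℝ) ^ 2 = (S p).N := Real.sq_sqrt hN0.le
  have hobs : ∀ t < (S p).T, nrm ((S p).obs t) ≤ 2 * K ^ 2 * (√((S p).N : ℝ) * ψ p) := by
    intro t ht
    obtain ⟨hf, he, -⟩ := hb.2.1 t ht
    have h1 : nrm ((S p).signal t) ≤ (K * √((S p).N : ℝ)) * (K * ψ p) :=
      (nrm_mulVec_le _ _).trans (mul_le_mul (hb.1 _).1 hf (nrm_nonneg _) (by positivity))
    have h2 : K * (√((S p).N : ℝ) * ψ p) ≤ K ^ 2 * (√((S p).N : ℝ) * ψ p) := by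
      have : K ≤ K ^ 2 := by nlinarith
      gcongr
    have h3 := nrm_add_le ((S p).signal t) ((S p).e t)
    have h4 : (S p).obs t = (S p).signal t + (S p).e t := rfl
    rw [h4]
    nlinarith
  have h1 := Sample.opNorm_weightedGram_le (by positivity) (hpost j) hobs
  rw [norm_norm, Real.norm_of_nonneg (by positivity)]
  refine h1.trans ?_
  have h2 : (2 * K ^ 2 * (√((S p).N : ℝ) * ψ p)) ^ 2 ≤ 4 * K ^ 4 * (S p).N ^ 2 := by
    rw [mul_pow, mul_pow, mul_pow, hx2]
    have : ((S p).N : ℝ) * ψ p ^ 2 ≤ (S p).N * (S p).N := by gcongr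
    calc 2 ^ 2 * (K ^ 2) ^ 2 * (((S p).N : ℝ) * ψ p ^ 2)
        ≤ 2 ^ 2 * (K ^ 2) ^ 2 * ((S p).N * (S p).N) := by gcongr
      _ = _ := by ring
  have h3 : ((S p).N : ℝ) ^ 2 * E ≤ ((S p).N : ℝ)⁻¹ := by
    rw [le_inv_comm₀ (by positivity) hN0, le_inv_comm₀ hN0 (by positivity),
      le_inv_comm₀ (by positivity) hN0, ← one_div, le_div_iff₀ (by positivity)]
    calc (S p).N * (((S p).N : ℝ) ^ 2 * E) = ((S p).N : ℝ) ^ 3 * E := by ring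
      _ ≤ 1 := hdec
  calc (S p).T * (K' * E * (2 * K ^ 2 * (√((S p).N : ℝ) * ψ p)) ^ 2)
      ≤ (S p).T * (K' * E * (4 * K ^ 4 * (S p).N ^ 2)) := by gcongr
    _ = K' * (4 * K ^ 4) * ((S p).T * ((S p).N ^ 2 * E)) := by ring
    _ ≤ _ := by gcongr

/-- The posterior probabilities have the right averages. -/
lemma tendsto_post (h : Regular S l q0 SF SL ψ φ c) (j : Fin J) :
    Tendsto (fun p => ((S p).T : ℝ)⁻¹ * ∑ t ∈ Finset.range (S p).T, (S p).post j t) l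
      (𝓝 (q0 j)) := by
  obtain ⟨K, a, hK, ha, hpost⟩ := h.post_sub_ind_le
  have h1 : Tendsto (fun p => K * Real.exp (-(a * (S p).N))) l (𝓝 0) := by
    have h1 := (Real.tendsto_exp_neg_atTop_nhds_zero.comp
      (h.N_top.const_mul_atTop ha)).const_mul K
    rwa [mul_zero] at h1
  have h2 : Tendsto (fun p => ((S p).T : ℝ)⁻¹ * ∑ t ∈ Finset.range (S p).T, (S p).post j t -
      ((S p).T : ℝ)⁻¹ * ∑ t ∈ Finset.range (S p).T, (S p).ind j t) l (𝓝 0) := by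
    refine squeeze_zero_norm' ?_ h1
    filter_upwards [hpost, h.one_le_T] with p hp hT
    rw [← mul_sub, ← Finset.sum_sub_distrib, norm_mul, norm_inv, Real.norm_natCast,
      inv_mul_le_iff₀ (by linarith)]
    refine (norm_sum_le _ _).trans ?_
    refine (Finset.sum_le_sum fun t ht => hp j t (Finset.mem_range.1 ht)).trans (le_of_eq ?_)
    simp
  simpa using h2.add (h.freq j)

/-- All moments of the observations other than those of the factors are of smaller order. -/
lemma rest_isBigO (h : Regular S l q0 SF SL ψ φ c) (j : Fin J) :
    (fun p => ‖(S p).rest j‖) =O[l] fun p => ((S p).N : ℝ) * (S p).T * (S p).rate ^ 2 := by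
  have h1 : (fun p => ‖(S p).Λ j‖ * ‖(S p).cross j‖) =O[l]
      fun p => ((S p).N : ℝ) * (S p).T * (S p).rate ^ 2 := by
    refine ((h.opNorm_Λ j).mul (h.cross j)).trans (IsBigO.of_bound 1 ?_)
    filter_upwards [h.one_le_N, h.one_le_T, h.inv_sqrt_T_le] with p hN hT hr
    have hT0 : 0 < √((S p).T : ℝ) := Real.sqrt_pos.2 (by linarith)
    rw [Real.norm_of_nonneg (by positivity), Real.norm_of_nonneg (by positivity), one_mul,
      ← mul_assoc, Real.mul_self_sqrt (by positivity), mul_assoc]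
    refine mul_le_mul_of_nonneg_left ?_ (by positivity)
    calc √((S p).T : ℝ) = (S p).T * (√((S p).T : ℝ))⁻¹ := by
          rw [← div_eq_mul_inv, Real.div_sqrt]
      _ ≤ _ := by gcongr
  have h2 : (fun p => ‖(S p).misclass j‖) =O[l]
      fun p => ((S p).N : ℝ) * (S p).T * (S p).rate ^ 2 := by
    refine (h.misclass_isBigO j).trans (IsBigO.of_bound 1 ?_)
    filter_upwards [h.one_le_N, h.one_le_T, h.inv_N_le] with p hN hT hr
    rw [Real.norm_of_nonneg (by positivity), Real.norm_of_nonneg (by positivity), one_mul,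
      mul_comm ((S p).N : ℝ), mul_assoc]
    refine mul_le_mul_of_nonneg_left ?_ (by positivity)
    have : (0 : ℝ) ≤ (S p).rate ^ 2 := sq_nonneg _
    nlinarith
  refine IsBigO.trans (IsBigO.of_bound 1 (Eventually.of_forall fun p => ?_))
    (((h1.add h1).add (h.errGram j)).add h2)
  rw [norm_norm, one_mul, Real.norm_of_nonneg (by positivity), Sample.rest]
  refine (norm_add_le _ _).trans (add_le_add_left ?_ _)
  refine (norm_add_le _ _).trans (add_le_add_left ?_ _)
  refine (norm_add_le _ _).trans (add_le_add ?_ ?_)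
  · refine (opNorm_mul_le _ _).trans ?_
    rw [opNorm_transpose]
  · refine (opNorm_mul_le _ _).trans ?_
    rw [opNorm_transpose, mul_comm]

end Regular

/-! ### Limits of the estimated loadings -/

namespace Sample

variable {J : ℕ} {r : Fin J → ℕ} {S : Sample J r}

variable (S) in
/-- The ordering and sign conventions of the estimate, relative to the matrices `U j` of
eigenvectors. -/
structure Oriented (SL U : (j : Fin J) → Matrix (Fin (r j)) (Fin (r j)) ℝ) : Prop where
  order : ∀ j, Antitone (gramDiag (S.L j))
  signs : ∀ j a, 0 ≤ ((U j)ᵀ * (CFC.sqrt (SL j))⁻¹ * (S.Λ j)ᵀ * S.L j) a a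

variable (S) in
/-- The coordinates `N^{-1/2} Λ' G` of the true loadings in terms of the columns of the rescaled
estimate `G`. -/
noncomputable def coord (j : Fin J) : Matrix (Fin (r j)) (Fin (r j)) ℝ :=
  (√(S.N : ℝ))⁻¹ • ((S.Λ j)ᵀ * scaled (S.L j) S.s)

variable (S) in
/-- The diagonal of `(L' L + s I) / N`. -/
noncomputable def spec (j : Fin J) (a : Fin (r j)) : ℝ :=
  (S.N : ℝ)⁻¹ * (gramDiag (S.L j) a + S.s)

variable (S) in
/-- The average posterior probability of a regime. -/
noncomputable def share (j : Fin J) : ℝ := (S.T : ℝ)⁻¹ * ∑ t ∈ Finset.range S.T, S.post j t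

lemma IsFit.coord_mul_transpose {c : ℝ} (h : S.IsFit c) (j : Fin J) :
    S.coord j * (S.coord j)ᵀ = (S.N : ℝ)⁻¹ • ((S.Λ j)ᵀ * softProj (S.L j) S.s * S.Λ j) := by
  rw [coord, transpose_smul, Matrix.smul_mul, Matrix.mul_smul, smul_smul, ← mul_inv,
    Real.mul_self_sqrt (by positivity), ← scaled_mul_transpose (h.diag j) h.s_pos]
  simp only [transpose_mul, transpose_transpose, Matrix.mul_assoc]

/-- The principal components equation in the coordinates `coord`. -/
lemma IsFit.coord_eq {c : ℝ} (h : S.IsFit c) (j : Fin J) :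
    ((S.N : ℝ)⁻¹ • ((S.Λ j)ᵀ * S.Λ j)) * ((S.T : ℝ)⁻¹ • S.facGram j) * S.coord j +
      ((S.N : ℝ)⁻¹ * (S.T : ℝ)⁻¹ * (√(S.N : ℝ))⁻¹) •
        ((S.Λ j)ᵀ * S.rest j * scaled (S.L j) S.s) =
    S.share j • (S.coord j * diagonal (S.spec j)) := by
  set D : Matrix (Fin (r j)) (Fin (r j)) ℝ :=
    diagonal fun a => (√(gramDiag (S.L j) a + S.s))⁻¹ with hD
  have hG : scaled (S.L j) S.s = S.L j * D := rfl
  have hfoc := congrArg (fun A => (S.Λ j)ᵀ * (A * D)) (h.weightedGram_mul j)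
  rw [gramShift_eq_diagonal (h.diag j), Matrix.mul_assoc _ (S.L j) D, ← hG, Matrix.smul_mul,
    Matrix.mul_assoc (S.L j), hD, diagonal_mul_diagonal] at hfoc
  have hcomm : (diagonal fun a => (gramDiag (S.L j) a + S.s) * (√(gramDiag (S.L j) a + S.s))⁻¹) =
      D * diagonal fun a => gramDiag (S.L j) a + S.s := by
    rw [hD, diagonal_mul_diagonal]
    congr 1
    ext a
    ring
  have hspec : diagonal (S.spec j) =
      (S.N : ℝ)⁻¹ • diagonal fun a => gramDiag (S.L j) a + S.s := by
    rw [← diagonal_smul]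
    rfl
  rw [hcomm, ← Matrix.mul_assoc (S.L j), ← hG, Matrix.mul_smul, ← Matrix.mul_assoc _ (scaled _ _),
    Matrix.add_mul, Matrix.mul_add] at hfoc
  have := congrArg (fun A => ((S.N : ℝ)⁻¹ * (S.T : ℝ)⁻¹ * (√(S.N : ℝ))⁻¹) • A) hfoc
  simp only [smul_add, smul_smul] at this
  rw [hspec, coord, share]
  simp only [Matrix.smul_mul, Matrix.mul_smul, smul_smul]
  refine Eq.trans ?_ (this.trans ?_)
  · congr 1
    · simp only [Matrix.mul_assoc]
      congr 1
      ring
    · simp only [Matrix.mul_assoc]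
  · congr 1
    ring

/-- `Λ' L / N` recovered from the rescaled loadings and the spectrum. -/
lemma transpose_mul_eq_coord (hs : 0 < S.s) (hN : 0 < (S.N : ℝ)) (j : Fin J) :
    (S.N : ℝ)⁻¹ • ((S.Λ j)ᵀ * S.L j) = S.coord j * diagonal fun a => √(S.spec j a) := by
  have h1 : (diagonal fun a => √(S.spec j a)) =
      (√(S.N : ℝ))⁻¹ • diagonal fun a => √(gramDiag (S.L j) a + S.s) := by
    rw [← diagonal_smul]
    congr 1
    ext a
    rw [spec, Real.sqrt_mul (by positivity), Real.sqrt_inv]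
    rfl
  conv_lhs => rw [← scaled_mul_sqrt (S.L j) hs]
  rw [h1, coord, Matrix.smul_mul, Matrix.mul_smul, smul_smul, ← mul_inv,
    Real.mul_self_sqrt (by positivity), Matrix.mul_assoc]

end Sample

namespace Regular

variable {ι : Type*} {J : ℕ} {r : Fin J → ℕ} {S : ι → Sample J r} {l : Filter ι}
  {q0 : Fin J → ℝ} {SF SL : (j : Fin J) → Matrix (Fin (r j)) (Fin (r j)) ℝ}
  {ψ φ : ι → ℝ} {c : ℝ}

/-- The rescaled loadings capture the whole of `Λ' Λ / N`, because the misfit is `o(N)`. -/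
lemma tendsto_coord_mul_transpose (h : Regular S l q0 SF SL ψ φ c) (j : Fin J) :
    Tendsto (fun p => (S p).coord j * ((S p).coord j)ᵀ) l (𝓝 (SL j)) := by
  obtain ⟨K, hK, hmis⟩ := h.misfit_le
  have h1 : Tendsto (fun p => ((S p).N : ℝ)⁻¹ •
      (((S p).Λ j)ᵀ * (1 - softProj ((S p).L j) (S p).s) * (S p).Λ j)) l (𝓝 0) := by
    have h2 : Tendsto (fun p => K * (S p).rate) l (𝓝 0) := by
      simpa using h.tendsto_rate.const_mul K
    refine squeeze_zero_norm' ?_ h2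
    filter_upwards [hmis, h.fit, h.one_le_N] with p hp hf hN
    rw [norm_smul, norm_inv, Real.norm_natCast, inv_mul_le_iff₀ (by linarith)]
    refine (opNorm_le_trace (misfit_posSemidef _ hf.s_pos _)).trans ((hp j).1.trans (le_of_eq ?_))
    ring
  have h2 := (h.loading j).sub h1
  rw [sub_zero] at h2
  refine h2.congr' ?_
  filter_upwards [h.fit] with p hf
  rw [hf.coord_mul_transpose, ← smul_sub, Matrix.mul_sub, Matrix.sub_mul, Matrix.mul_one,
    sub_sub_cancel]

lemma coord_isBigO (h : Regular S l q0 SF SL ψ φ c) (j : Fin J) :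
    (fun p => (S p).coord j) =O[l] fun _ => (1 : ℝ) := by
  have h1 := (h.tendsto_coord_mul_transpose j).norm.isBigO_one ℝ
  refine IsBigO.of_norm_left (IsBigO.of_pow two_ne_zero ?_)
  refine h1.congr (fun p => ?_) fun p => by simp
  simp only [Pi.pow_apply]
  have := opNorm_transpose_mul_self ((S p).coord j)ᵀ
  rw [transpose_transpose, opNorm_transpose] at this
  exact this

/-- The perturbation of the principal components equation vanishes in the limit. -/
lemma tendsto_rest (h : Regular S l q0 SF SL ψ φ c) (j : Fin J) :
    Tendsto (fun p => (((S p).N : ℝ)⁻¹ * ((S p).T : ℝ)⁻¹ * (√((S p).N : ℝ))⁻¹) •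
        (((S p).Λ j)ᵀ * (S p).rest j * scaled ((S p).L j) (S p).s)) l (𝓝 0) := by
  have h1 : (fun p => (((S p).N : ℝ)⁻¹ * ((S p).T : ℝ)⁻¹ * (√((S p).N : ℝ))⁻¹) *
      (‖(S p).Λ j‖ * ‖(S p).rest j‖)) =O[l] fun p => (S p).rate ^ 2 := by
    refine ((isBigO_refl _ _).mul ((h.opNorm_Λ j).mul (h.rest_isBigO j))).congr' .rfl ?_
    filter_upwards [h.one_le_N, h.one_le_T] with p hN hT
    have : 0 < √((S p).N : ℝ) := Real.sqrt_pos.2 (by linarith)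
    field_simp
  have h2 : Tendsto (fun p => (S p).rate ^ 2) l (𝓝 0) := by simpa using h.tendsto_rate.pow 2
  refine squeeze_zero_norm' ?_ (h1.trans_tendsto h2)
  filter_upwards [h.fit] with p hf
  rw [norm_smul, Real.norm_of_nonneg (by positivity)]
  refine mul_le_mul_of_nonneg_left ?_ (by positivity)
  have hG := opNorm_scaled_le (hf.diag j) hf.s_pos
  calc _ ≤ ‖((S p).Λ j)ᵀ * (S p).rest j‖ * ‖scaled ((S p).L j) (S p).s‖ := opNorm_mul_le _ _
    _ ≤ ‖((S p).Λ j)ᵀ * (S p).rest j‖ := mul_le_of_le_one_right (norm_nonneg _) hG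
    _ ≤ _ := (opNorm_mul_le _ _).trans (by rw [opNorm_transpose])

/-- The rescaled loadings and the spectrum converge: limits exist along every ultrafilter, solve the
limiting eigenvalue problem, and inherit the order and sign conventions that make its solution
unique. -/
lemma tendsto_coord_spec (h : Regular S l q0 SF SL ψ φ c)
    {v : (j : Fin J) → Fin (r j) → ℝ} {U : (j : Fin J) → Matrix (Fin (r j)) (Fin (r j)) ℝ}
    (hU : ∀ j, IsEigen (SF j) (SL j) (v j) (U j)) (ho : ∀ᶠ p in l, (S p).Oriented SL U)
    (j : Fin J) :
    Tendsto (fun p => (S p).coord j) l (𝓝 (CFC.sqrt (SL j) * U j)) ∧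
      Tendsto (fun p => diagonal ((S p).spec j)) l (𝓝 (diagonal (v j))) := by
  suffices H : ∀ 𝒰 : Ultrafilter ι, ↑𝒰 ≤ l →
      Tendsto (fun p => (S p).coord j) 𝒰 (𝓝 (CFC.sqrt (SL j) * U j)) ∧
      Tendsto (fun p => diagonal ((S p).spec j)) 𝒰 (𝓝 (diagonal (v j))) from
    ⟨tendsto_iff_ultrafilter _ _ _ |>.2 fun 𝒰 h𝒰 => (H 𝒰 h𝒰).1,
      tendsto_iff_ultrafilter _ _ _ |>.2 fun 𝒰 h𝒰 => (H 𝒰 h𝒰).2⟩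
  intro 𝒰 h𝒰
  replace h := h.mono h𝒰
  replace ho := ho.filter_mono h𝒰
  -- a limit of the coordinates exists by compactness
  obtain ⟨Y, hY⟩ : ∃ Y, Tendsto (fun p => (S p).coord j) 𝒰 (𝓝 Y) := by
    obtain ⟨K, hK⟩ := (h.coord_isBigO j).bound
    have : ProperSpace (Matrix (Fin (r j)) (Fin (r j)) ℝ) := FiniteDimensional.proper ℝ _
    have hc := isCompact_closedBall (0 : Matrix (Fin (r j)) (Fin (r j)) ℝ) K
    obtain ⟨Y, -, hY⟩ := hc.ultrafilter_le_nhds' (𝒰.map fun p => (S p).coord j) (by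
      refine hK.mono fun p hp => ?_
      simpa using hp)
    exact ⟨Y, hY⟩
  have htr : Continuous fun A : Matrix (Fin (r j)) (Fin (r j)) ℝ => Aᵀ :=
    continuous_id.matrix_transpose
  have hYt := (htr.tendsto Y).comp hY
  have hYY : Y * Yᵀ = SL j := tendsto_nhds_unique (hY.mul hYt) (h.tendsto_coord_mul_transpose j)
  have hSLu := h.isUnit_det_SL j
  have hq := (h.q0_pos j).ne'
  -- the right-hand side of the principal components equation
  have hX : Tendsto (fun p => (S p).share j • ((S p).coord j * diagonal ((S p).spec j))) 𝒰
      (𝓝 (SL j * (q0 j • SF j) * Y)) := by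
    have h1 := (((h.loading j).mul (h.factor j)).mul hY).add (h.tendsto_rest j)
    rw [add_zero] at h1
    refine h1.congr' ?_
    filter_upwards [h.fit] with p hf using hf.coord_eq j
  have hYinv : Yᵀ * (SL j)⁻¹ * Y = 1 := by
    have h1 : Y * (Yᵀ * (SL j)⁻¹) = 1 := by
      rw [← Matrix.mul_assoc, hYY, mul_nonsing_inv _ hSLu]
    exact mul_eq_one_comm.1 h1
  -- the spectrum is recovered from it
  have hspec : Tendsto (fun p => diagonal ((S p).spec j)) 𝒰 (𝓝 (Yᵀ * SF j * Y)) := by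
    have hinv := tendsto_matrix_inv (h.tendsto_coord_mul_transpose j) hSLu
    have h1 := ((h.tendsto_post j).inv₀ hq).smul ((hYt.mul hinv).mul hX)
    have h2 : (q0 j)⁻¹ • (Yᵀ * (SL j)⁻¹ * (SL j * (q0 j • SF j) * Y)) = Yᵀ * SF j * Y := by
      have : Yᵀ * (SL j)⁻¹ * (SL j * (q0 j • SF j) * Y) =
          q0 j • (Yᵀ * ((SL j)⁻¹ * SL j) * SF j * Y) := by
        simp only [Matrix.mul_smul, Matrix.smul_mul, Matrix.mul_assoc]
      rw [this, nonsing_inv_mul _ hSLu, Matrix.mul_one, smul_smul, inv_mul_cancel₀ hq, one_smul]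
    rw [h2] at h1
    refine h1.congr' ?_
    filter_upwards [eventually_isUnit_det (h.tendsto_coord_mul_transpose j) hSLu,
      (h.tendsto_post j).eventually_ne hq] with p hu hw
    have hw' : (S p).share j ≠ 0 := hw
    have h3 : ((S p).coord j)ᵀ * ((S p).coord j * ((S p).coord j)ᵀ)⁻¹ * (S p).coord j = 1 := by
      refine mul_eq_one_comm.1 ?_
      rw [← Matrix.mul_assoc, mul_nonsing_inv _ hu]
    simp only [Function.comp_apply]
    change ((S p).share j)⁻¹ • _ = _
    rw [Matrix.mul_smul, smul_smul, inv_mul_cancel₀ hw', one_smul, ← Matrix.mul_assoc, h3,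
      Matrix.one_mul]
  set D := Yᵀ * SF j * Y with hD
  have hent : ∀ a b, Tendsto (fun p => diagonal ((S p).spec j) a b) 𝒰 (𝓝 (D a b)) := fun a b =>
    ((continuous_id.matrix_elem a b).tendsto D).comp hspec
  -- the limit of the spectrum is diagonal and decreasing, and the sign convention passes to `Y`
  have hDd : D = diagonal fun a => D a a := by
    ext a b
    by_cases hab : a = b
    · subst hab
      rw [diagonal_apply_eq]
    · rw [diagonal_apply_ne _ hab]
      refine tendsto_nhds_unique (hent a b) ?_
      simp only [diagonal_apply_ne _ hab]
      exact tendsto_const_nhds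
  have hanti : Antitone fun a => D a a := by
    intro a b hab
    have h1 := hent a a
    have h2 := hent b b
    simp only [diagonal_apply_eq] at h1 h2
    refine le_of_tendsto_of_tendsto h2 h1 ?_
    filter_upwards [ho] with p hp
    have := hp.order j hab
    unfold Sample.spec
    gcongr
  have heq : SL j * SF j * Y = Y * diagonal fun a => D a a := by
    rw [← hDd, hD, ← Matrix.mul_assoc, ← Matrix.mul_assoc, hYY]
  have hpos : ∀ a, 0 ≤ ((U j)ᵀ * (CFC.sqrt (SL j))⁻¹ * Y) a a := by
    intro a
    have h1 : Tendsto (fun p => ((U j)ᵀ * (CFC.sqrt (SL j))⁻¹ * (S p).coord j) a a) 𝒰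
        (𝓝 (((U j)ᵀ * (CFC.sqrt (SL j))⁻¹ * Y) a a)) :=
      ((continuous_id.matrix_elem a a).tendsto _).comp (hY.const_mul _)
    refine ge_of_tendsto h1 ?_
    filter_upwards [ho, h.fit] with p hp hf
    have h2 := hp.signs j a
    rw [Sample.coord, scaled, Matrix.mul_smul, Matrix.smul_apply, ← Matrix.mul_assoc,
      ← Matrix.mul_assoc, mul_diagonal, smul_eq_mul]
    have h3 := gramDiag_nonneg ((S p).L j) a
    have := hf.s_pos
    positivity
  obtain ⟨hYU, hDv⟩ := (hU j).eq_of_solution (h.SL_posDef j) hYY hanti heq hpos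
  rw [← hYU, ← hDv, ← hDd]
  exact ⟨hY, hspec⟩

end Regular

/-! ### Expansion of the loadings of one unit -/

namespace Sample

variable {J : ℕ} {r : Fin J → ℕ} {S : Sample J r}

variable (S) in
/-- The matrix `W` of the sample. -/
noncomputable def W (j : Fin J) : Matrix (Fin (r j)) (Fin (r j)) ℝ :=
  S.share j • ((S.N : ℝ)⁻¹ • ((S.L j)ᵀ * S.L j + S.s • (1 : Matrix (Fin (r j)) (Fin (r j)) ℝ)))

variable (S) in
/-- The rotation matrix `H` of the sample. -/
noncomputable def H (j : Fin J) : Matrix (Fin (r j)) (Fin (r j)) ℝ :=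
  ((S.T : ℝ)⁻¹ • S.facGram j) * ((S.N : ℝ)⁻¹ • ((S.Λ j)ᵀ * S.L j)) * (S.W j)⁻¹

lemma IsFit.W_eq {c : ℝ} (h : S.IsFit c) (j : Fin J) :
    S.W j = S.share j • diagonal (S.spec j) := by
  rw [W, gramShift_eq_diagonal (h.diag j), ← diagonal_smul]
  rfl

/-- The estimation error is a linear function of the matrix `rest`. -/
lemma IsFit.sub_mul_H {c : ℝ} (h : S.IsFit c) (j : Fin J) (hW : IsUnit (S.W j).det) :
    S.L j - S.Λ j * S.H j = ((S.N : ℝ)⁻¹ * (S.T : ℝ)⁻¹) • (S.rest j * S.L j * (S.W j)⁻¹) := by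
  have h1 : S.L j * S.W j = ((S.N : ℝ)⁻¹ * (S.T : ℝ)⁻¹) •
      ((S.Λ j * S.facGram j * (S.Λ j)ᵀ + S.rest j) * S.L j) := by
    rw [h.weightedGram_mul, W, share, Matrix.mul_smul, Matrix.mul_smul, smul_smul, smul_smul]
    congr 1
    ring
  have h2 : S.Λ j * S.H j * S.W j = ((S.N : ℝ)⁻¹ * (S.T : ℝ)⁻¹) •
      (S.Λ j * S.facGram j * (S.Λ j)ᵀ * S.L j) := by
    rw [H, Matrix.mul_assoc (S.Λ j), Matrix.mul_assoc _ (S.W j)⁻¹, nonsing_inv_mul _ hW,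
      Matrix.mul_one]
    simp only [Matrix.smul_mul, Matrix.mul_smul, smul_smul, Matrix.mul_assoc]
  have h3 : (S.L j - S.Λ j * S.H j) * S.W j =
      ((S.N : ℝ)⁻¹ * (S.T : ℝ)⁻¹) • (S.rest j * S.L j) := by
    rw [Matrix.sub_mul, h1, h2, ← smul_sub, Matrix.add_mul, add_sub_cancel_left]
  calc S.L j - S.Λ j * S.H j = (S.L j - S.Λ j * S.H j) * S.W j * (S.W j)⁻¹ := by
        rw [Matrix.mul_assoc, mul_nonsing_inv _ hW, Matrix.mul_one]
    _ = _ := by rw [h3, Matrix.smul_mul]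

variable (S) in
/-- The part of the estimation error of a unit that is asymptotically negligible. -/
noncomputable def minor (j : Fin J) (i : Fin S.N) : Fin (r j) → ℝ :=
  S.Λ j i ᵥ* ((S.cross j)ᵀ * S.L j) + S.errGram j i ᵥ* S.L j + S.misclass j i ᵥ* S.L j

lemma mul_row {m n k : ℕ} (A : Matrix (Fin m) (Fin n) ℝ) (B : Matrix (Fin n) (Fin k) ℝ)
    (i : Fin m) : (A * B) i = A i ᵥ* B := by
  ext a
  rfl

lemma rest_row_vecMul (j : Fin J) (i : Fin S.N) :
    S.rest j i ᵥ* S.L j = S.cross j i ᵥ* ((S.Λ j)ᵀ * S.L j) + S.minor j i := by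
  have h1 : S.rest j i = S.Λ j i ᵥ* (S.cross j)ᵀ + S.cross j i ᵥ* (S.Λ j)ᵀ + S.errGram j i +
      S.misclass j i := by
    rw [← mul_row, ← mul_row]
    rfl
  rw [h1, minor, add_vecMul, add_vecMul, add_vecMul, vecMul_vecMul, vecMul_vecMul]
  abel

/-- The estimation error of unit `i`, split into the leading term and the negligible one. -/
lemma IsFit.sub_row {c : ℝ} (h : S.IsFit c) (j : Fin J) (hW : IsUnit (S.W j).det) (i : Fin S.N) :
    S.L j i - (S.H j)ᵀ *ᵥ S.Λ j i =
      (S.T : ℝ)⁻¹ • (S.cross j i ᵥ* ((S.N : ℝ)⁻¹ • ((S.Λ j)ᵀ * S.L j) * (S.W j)⁻¹)) +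
      ((S.N : ℝ)⁻¹ * (S.T : ℝ)⁻¹) • (S.minor j i ᵥ* (S.W j)⁻¹) := by
  have h1 := congrFun (h.sub_mul_H j hW) i
  rw [mulVec_transpose, ← mul_row]
  have h2 : (((S.N : ℝ)⁻¹ * (S.T : ℝ)⁻¹) • (S.rest j * S.L j * (S.W j)⁻¹)) i =
      ((S.N : ℝ)⁻¹ * (S.T : ℝ)⁻¹) • ((S.rest j i ᵥ* S.L j) ᵥ* (S.W j)⁻¹) := by
    rw [← mul_row, ← mul_row]
    rfl
  have h3 : S.L j i - (S.Λ j * S.H j) i = (S.L j - S.Λ j * S.H j) i := rfl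
  rw [h3, h1, h2, rest_row_vecMul, add_vecMul, smul_add, vecMul_vecMul, Matrix.smul_mul,
    vecMul_smul, smul_smul, mul_comm ((S.T : ℝ)⁻¹)]

end Sample

/-- Bounds for the sums that involve one given unit `i` of the sample. -/
structure RegularUnit {ι : Type*} {J : ℕ} {r : Fin J → ℕ} (S : ι → Sample J r) (l : Filter ι)
    (i : ∀ p, Fin (S p).N) (j : Fin J) : Prop where
  loading : (fun p => nrm ((S p).Λ j (i p))) =O[l] fun _ => (1 : ℝ)
  score : (fun p => nrm ((S p).cross j (i p))) =O[l] fun p => √((S p).T : ℝ)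
  errGram : (fun p => nrm ((S p).errGram j (i p))) =O[l]
    fun p => √((S p).N : ℝ) * √((S p).T : ℝ) + (S p).T
  errGram_Λ : (fun p => nrm ((S p).errGram j (i p) ᵥ* (S p).Λ j)) =O[l]
    fun p => √((S p).N : ℝ) * √((S p).T : ℝ) + (S p).T

namespace Regular

variable {ι : Type*} {J : ℕ} {r : Fin J → ℕ} {S : ι → Sample J r} {l : Filter ι}
  {q0 : Fin J → ℝ} {SF SL : (j : Fin J) → Matrix (Fin (r j)) (Fin (r j)) ℝ}
  {ψ φ : ι → ℝ} {c : ℝ}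

/-- The limiting eigenvalues are positive, since they diagonalize a congruent image of `SF`. -/
lemma eigen_pos {n : ℕ} {SF SL U : Matrix (Fin n) (Fin n) ℝ} {v : Fin n → ℝ}
    (hSF : SF.PosDef) (hSL : SL.PosDef) (hU : IsEigen SF SL v U) (a : Fin n) : 0 < v a := by
  set R := CFC.sqrt SL with hR
  have hRt : Rᵀ = R := transpose_sqrt SL
  have h1 : diagonal v = (R * U)ᵀ * SF * (R * U) := by
    calc diagonal v = Uᵀ * (R * SF * R * U) := by
          rw [hU.eigen, ← Matrix.mul_assoc, hU.orthonormal, Matrix.one_mul]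
      _ = _ := by simp only [transpose_mul, hRt, Matrix.mul_assoc]
  have hu : IsUnit (R * U) := by
    rw [isUnit_iff_isUnit_det, det_mul]
    refine (isUnit_det_sqrt hSL).mul ?_
    rw [← isUnit_iff_isUnit_det]
    exact IsUnit.of_mul_eq_one _ (mul_eq_one_comm.1 hU.orthonormal)
  have h2 : (diagonal v).PosDef := by
    rw [h1, ← conjTranspose_eq_transpose_of_trivial]
    exact hSF.conjTranspose_mul_mul_same (mulVec_injective_iff_isUnit.2 hu)
  have := h2.diag_pos (i := a)
  rwa [diagonal_apply_eq] at this

variable {v : (j : Fin J) → Fin (r j) → ℝ} {U : (j : Fin J) → Matrix (Fin (r j)) (Fin (r j)) ℝ}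

lemma tendsto_Λ_mul_L (h : Regular S l q0 SF SL ψ φ c)
    (hU : ∀ j, IsEigen (SF j) (SL j) (v j) (U j)) (ho : ∀ᶠ p in l, (S p).Oriented SL U)
    (j : Fin J) :
    Tendsto (fun p => ((S p).N : ℝ)⁻¹ • (((S p).Λ j)ᵀ * (S p).L j)) l
      (𝓝 (CFC.sqrt (SL j) * U j * diagonal fun a => √(v j a))) := by
  obtain ⟨h1, h2⟩ := h.tendsto_coord_spec hU ho j
  have hc : Continuous fun A : Matrix (Fin (r j)) (Fin (r j)) ℝ => diagonal fun a => √(A a a) :=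
    Continuous.matrix_diagonal (continuous_pi fun a =>
      Real.continuous_sqrt.comp (continuous_id.matrix_elem a a))
  have h3 := h1.mul ((hc.tendsto _).comp h2)
  simp only [diagonal_apply_eq] at h3
  refine h3.congr' ?_
  filter_upwards [h.fit, h.one_le_N] with p hf hN
  rw [Sample.transpose_mul_eq_coord hf.s_pos (by linarith)]
  simp [Function.comp]

lemma tendsto_W (h : Regular S l q0 SF SL ψ φ c)
    (hU : ∀ j, IsEigen (SF j) (SL j) (v j) (U j)) (ho : ∀ᶠ p in l, (S p).Oriented SL U)
    (j : Fin J) : Tendsto (fun p => (S p).W j) l (𝓝 (q0 j • diagonal (v j))) := by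
  obtain ⟨-, h2⟩ := h.tendsto_coord_spec hU ho j
  have h1 : Tendsto (fun p => (S p).share j) l (𝓝 (q0 j)) := h.tendsto_post j
  refine (h1.smul h2).congr' ?_
  filter_upwards [h.fit] with p hf using (hf.W_eq j).symm

lemma isUnit_det_limit_W (h : Regular S l q0 SF SL ψ φ c)
    (hU : ∀ j, IsEigen (SF j) (SL j) (v j) (U j)) (j : Fin J) :
    IsUnit (q0 j • diagonal (v j)).det := by
  rw [det_smul, det_diagonal]
  refine (mul_pos (pow_pos (h.q0_pos j) _) (Finset.prod_pos fun a _ => ?_)).ne'.isUnit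
  exact eigen_pos (h.SF_posDef j) (h.SL_posDef j) (hU j) a

lemma opNorm_L (h : Regular S l q0 SF SL ψ φ c)
    (hU : ∀ j, IsEigen (SF j) (SL j) (v j) (U j)) (ho : ∀ᶠ p in l, (S p).Oriented SL U)
    (j : Fin J) : (fun p => ‖(S p).L j‖) =O[l] fun p => √((S p).N : ℝ) := by
  obtain ⟨-, h2⟩ := h.tendsto_coord_spec hU ho j
  have h3 := (isBigO_refl (fun p => ((S p).N : ℝ)) l).mul (h2.norm.isBigO_one ℝ)
  have h4 : (fun p => (S p).s * ‖(1 : Matrix (Fin (r j)) (Fin (r j)) ℝ)‖) =O[l]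
      fun p => ((S p).N : ℝ) * 1 := by
    have h5 := h.s_bdd.mul (isBigO_const_const ‖(1 : Matrix (Fin (r j)) (Fin (r j)) ℝ)‖
      (one_ne_zero' ℝ) l)
    refine h5.trans (IsBigO.of_bound 1 ?_)
    filter_upwards [h.one_le_N] with p hN
    simpa using hN
  refine IsBigO.of_pow two_ne_zero ?_
  refine IsBigO.trans (IsBigO.of_bound 1 ?_) ((h3.add h4).congr_right
    (g₂ := (fun p => √((S p).N : ℝ)) ^ 2) fun p => ?_)
  · filter_upwards [h.fit, h.one_le_N] with p hf hN
    have h5 : ((S p).L j)ᵀ * (S p).L j = ((S p).N : ℝ) • diagonal ((S p).spec j) -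
        (S p).s • (1 : Matrix (Fin (r j)) (Fin (r j)) ℝ) := by
      have h6 : ((S p).N : ℝ) • diagonal ((S p).spec j) =
          ((S p).L j)ᵀ * (S p).L j + (S p).s • (1 : Matrix (Fin (r j)) (Fin (r j)) ℝ) := by
        rw [gramShift_eq_diagonal (hf.diag j), ← diagonal_smul]
        congr 1
        ext a
        have : ((S p).N : ℝ) ≠ 0 := by linarith
        simp [Sample.spec, mul_inv_cancel_left₀ this]
      rw [h6, add_sub_cancel_right]
    rw [Pi.pow_apply, ← opNorm_transpose_mul_self, h5, norm_norm, one_mul]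
    refine (norm_sub_le _ _).trans (le_trans (le_of_eq ?_) (le_abs_self _))
    rw [norm_smul, norm_smul, Real.norm_natCast, Real.norm_of_nonneg hf.s_pos.le]
  · simp [Real.sq_sqrt]

lemma opNorm_inv_W (h : Regular S l q0 SF SL ψ φ c)
    (hU : ∀ j, IsEigen (SF j) (SL j) (v j) (U j)) (ho : ∀ᶠ p in l, (S p).Oriented SL U)
    (j : Fin J) : (fun p => ‖((S p).W j)⁻¹‖) =O[l] fun _ => (1 : ℝ) :=
  (tendsto_matrix_inv (h.tendsto_W hU ho j) (h.isUnit_det_limit_W hU j)).norm.isBigO_one ℝ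

lemma opNorm_H (h : Regular S l q0 SF SL ψ φ c)
    (hU : ∀ j, IsEigen (SF j) (SL j) (v j) (U j)) (ho : ∀ᶠ p in l, (S p).Oriented SL U)
    (j : Fin J) : (fun p => ‖(S p).H j‖) =O[l] fun _ => (1 : ℝ) :=
  (((h.factor j).mul (h.tendsto_Λ_mul_L hU ho j)).mul
    (tendsto_matrix_inv (h.tendsto_W hU ho j) (h.isUnit_det_limit_W hU j))).norm.isBigO_one ℝ

/-- The rate of convergence of the whole matrix of estimated loadings. -/
lemma opNorm_sub (h : Regular S l q0 SF SL ψ φ c)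
    (hU : ∀ j, IsEigen (SF j) (SL j) (v j) (U j)) (ho : ∀ᶠ p in l, (S p).Oriented SL U)
    (j : Fin J) : (fun p => ‖(S p).L j - (S p).Λ j * (S p).H j‖) =O[l]
      fun p => √((S p).N : ℝ) * (S p).rate ^ 2 := by
  have h1 : (fun p => (((S p).N : ℝ)⁻¹ * ((S p).T : ℝ)⁻¹) *
      (‖(S p).rest j‖ * ‖(S p).L j‖ * ‖((S p).W j)⁻¹‖)) =O[l]
      fun p => √((S p).N : ℝ) * (S p).rate ^ 2 := by
    refine ((isBigO_refl _ _).mul (((h.rest_isBigO j).mul (h.opNorm_L hU ho j)).mul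
      (h.opNorm_inv_W hU ho j))).congr' .rfl ?_
    filter_upwards [h.one_le_N, h.one_le_T] with p hN hT
    field_simp
  refine IsBigO.trans (IsBigO.of_bound 1 ?_) h1
  filter_upwards [h.fit, eventually_isUnit_det (h.tendsto_W hU ho j)
    (h.isUnit_det_limit_W hU j)] with p hf hW
  rw [hf.sub_mul_H j hW, norm_norm, norm_smul, one_mul, Real.norm_of_nonneg (by positivity),
    Real.norm_of_nonneg (by positivity)]
  refine mul_le_mul_of_nonneg_left ?_ (by positivity)
  refine (opNorm_mul_le _ _).trans ?_
  exact mul_le_mul_of_nonneg_right (opNorm_mul_le _ _) (norm_nonneg _)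

/-- The rate of the negligible part tends to zero, relative to `N √T`. The binding term is `√T / N`,
which is assumed to vanish. -/
lemma tendsto_minor_rate (h : Regular S l q0 SF SL ψ φ c) :
    Tendsto (fun p => ((S p).N : ℝ)⁻¹ * (√((S p).T : ℝ))⁻¹ *
      ((√((S p).N : ℝ) * √((S p).T : ℝ) + (S p).T) * (√((S p).N : ℝ) * (S p).rate ^ 2 + 1) +
        (S p).T * ((S p).N : ℝ)⁻¹ * √((S p).N : ℝ))) l (𝓝 0) := by
  have hN : Tendsto (fun p => (√((S p).N : ℝ))⁻¹) l (𝓝 0) :=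
    tendsto_inv_atTop_zero.comp (Real.tendsto_sqrt_atTop.comp h.N_top)
  have hr : Tendsto (fun p => (S p).rate ^ 2) l (𝓝 0) := by simpa using h.tendsto_rate.pow 2
  have hT := h.sqrt_T
  -- `√T ρ² ≤ 2 + 2 √T / N`
  have hlim : Tendsto (fun p => (S p).rate ^ 2 + (√((S p).N : ℝ))⁻¹ +
      (2 + 2 * (√((S p).T : ℝ) / (S p).N)) * (√((S p).N : ℝ))⁻¹ + √((S p).T : ℝ) / (S p).N +
      √((S p).T : ℝ) / (S p).N * (√((S p).N : ℝ))⁻¹) l (𝓝 0) := by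
    have := (((hr.add hN).add (((hT.const_mul 2).const_add 2).mul hN)).add hT).add (hT.mul hN)
    simpa using this
  refine squeeze_zero' (Eventually.of_forall fun p => by positivity) ?_ hlim
  filter_upwards [h.one_le_N, h.one_le_T] with p hN hT
  set x := √((S p).N : ℝ) with hx
  set y := √((S p).T : ℝ) with hy
  have hx0 : 0 < x := Real.sqrt_pos.2 (by linarith)
  have hy0 : 0 < y := Real.sqrt_pos.2 (by linarith)
  have hxx : ((S p).N : ℝ) = x ^ 2 := (Real.sq_sqrt (by linarith)).symm
  have hyy : ((S p).T : ℝ) = y ^ 2 := (Real.sq_sqrt (by linarith)).symm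
  have hrate : y * (S p).rate ^ 2 ≤ 2 + 2 * (y / x ^ 2) := by
    have h1 : (S p).rate ^ 2 ≤ 2 * y⁻¹ + 2 * (x ^ 2)⁻¹ := by
      have h2 : ((√y)⁻¹) ^ 2 = y⁻¹ := by rw [inv_pow, Real.sq_sqrt hy0.le]
      have h3 : (S p).rate = (√y)⁻¹ + x⁻¹ := rfl
      rw [h3, ← h2, ← inv_pow]
      nlinarith [sq_nonneg ((√y)⁻¹ - x⁻¹)]
    calc y * (S p).rate ^ 2 ≤ y * (2 * y⁻¹ + 2 * (x ^ 2)⁻¹) := by gcongr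
      _ = _ := by field_simp
  rw [hxx, hyy]
  have h5 : (x ^ 2)⁻¹ * y⁻¹ * ((x * y + y ^ 2) * (x * (S p).rate ^ 2 + 1) + y ^ 2 * (x ^ 2)⁻¹ * x) =
      (S p).rate ^ 2 + x⁻¹ + y * (S p).rate ^ 2 * x⁻¹ + y / x ^ 2 + y / x ^ 2 * x⁻¹ := by
    field_simp
    ring
  rw [h5]
  have := mul_le_mul_of_nonneg_right hrate (inv_nonneg.2 hx0.le)
  linarith

/-- The products with `L` are split along `L = (L - Λ H) + Λ H`: the first part is small by the rate of
`L`, and `Λ` averages the errors in the second. -/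
lemma minor_isBigO (h : Regular S l q0 SF SL ψ φ c)
    (hU : ∀ j, IsEigen (SF j) (SL j) (v j) (U j)) (ho : ∀ᶠ p in l, (S p).Oriented SL U)
    {i : ∀ p, Fin (S p).N} {j : Fin J} (hi : RegularUnit S l i j) :
    (fun p => nrm ((S p).minor j (i p))) =O[l] fun p =>
      (√((S p).N : ℝ) * √((S p).T : ℝ) + (S p).T) * (√((S p).N : ℝ) * (S p).rate ^ 2 + 1) +
        (S p).T * ((S p).N : ℝ)⁻¹ * √((S p).N : ℝ) := by
  set B : ι → ℝ := fun p =>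
    (√((S p).N : ℝ) * √((S p).T : ℝ) + (S p).T) * (√((S p).N : ℝ) * (S p).rate ^ 2 + 1) +
      (S p).T * ((S p).N : ℝ)⁻¹ * √((S p).N : ℝ) with hB
  have hle : ∀ {g : ι → ℝ}, (∀ p, 0 ≤ g p) → (∀ p, g p ≤ B p) → g =O[l] B := fun h0 h1 =>
    IsBigO.of_bound 1 (Eventually.of_forall fun p => by
      rw [Real.norm_of_nonneg (h0 p), one_mul]
      exact (h1 p).trans (le_abs_self _))
  have hP : ∀ p, 0 ≤ √((S p).N : ℝ) * √((S p).T : ℝ) + (S p).T := fun p => by positivity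
  have hP' : ∀ p, √((S p).N : ℝ) * √((S p).T : ℝ) ≤ √((S p).N : ℝ) * √((S p).T : ℝ) + (S p).T :=
    fun p => le_add_of_nonneg_right (by positivity)
  have hQ : ∀ p, 0 ≤ √((S p).N : ℝ) * (S p).rate ^ 2 := fun p => by positivity
  have hR : ∀ p, 0 ≤ (S p).T * ((S p).N : ℝ)⁻¹ * √((S p).N : ℝ) := fun p => by positivity
  have split : ∀ u w : ι → ℝ, (u =O[l] fun p => √((S p).N : ℝ) * √((S p).T : ℝ) + (S p).T) →
      (w =O[l] fun p => √((S p).N : ℝ) * √((S p).T : ℝ) + (S p).T) →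
      (fun p => u p * ‖(S p).L j - (S p).Λ j * (S p).H j‖ + w p * ‖(S p).H j‖) =O[l] B := by
    intro u w hu hw
    refine ((hu.mul (h.opNorm_sub hU ho j)).trans (hle ?_ ?_)).add
      ((hw.mul (h.opNorm_H hU ho j)).trans (hle ?_ ?_))
    · exact fun p => mul_nonneg (hP p) (hQ p)
    · intro p
      have := hP p
      have := hR p
      simp only [hB]
      linarith
    · exact fun p => mul_nonneg (hP p) zero_le_one
    · intro p
      have := mul_nonneg (hP p) (hQ p)
      have := hR p
      simp only [hB]
      linarith
  have hcross' : ∀ {g : ι → ℝ}, (g =O[l] fun p => √((S p).N : ℝ) * √((S p).T : ℝ)) →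
      g =O[l] fun p => √((S p).N : ℝ) * √((S p).T : ℝ) + (S p).T := fun hg =>
    hg.trans (IsBigO.of_bound 1 (Eventually.of_forall fun p => by
      rw [Real.norm_of_nonneg (by positivity), one_mul]
      exact (hP' p).trans (le_abs_self _)))
  have h1 := (hi.loading.mul (split _ _ (hcross' (h.cross j)) (hcross' (h.Λ_cross j))))
  have h2 := split _ _ hi.errGram hi.errGram_Λ
  have h3 : (fun p => ‖(S p).misclass j‖ * ‖(S p).L j‖) =O[l] B := by
    refine ((h.misclass_isBigO j).mul (h.opNorm_L hU ho j)).trans (hle hR fun p => ?_)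
    have := mul_nonneg (hP p) (add_nonneg (hQ p) zero_le_one)
    simp only [hB]
    linarith
  refine IsBigO.trans (IsBigO.of_bound 1 (Eventually.of_forall fun p => ?_))
    (((h1.congr_right fun p => one_mul _).add h2).add h3)
  rw [Real.norm_of_nonneg (nrm_nonneg _), one_mul, Sample.minor]
  refine le_trans ?_ (le_abs_self _)
  refine (nrm_add_le _ _).trans (add_le_add ((nrm_add_le _ _).trans (add_le_add ?_ ?_)) ?_)
  · refine (nrm_vecMul_le _ _).trans (mul_le_mul_of_nonneg_left ?_ (nrm_nonneg _))
    have e : ((S p).cross j)ᵀ * (S p).L j =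
        ((S p).cross j)ᵀ * ((S p).L j - (S p).Λ j * (S p).H j) +
          (((S p).Λ j)ᵀ * (S p).cross j)ᵀ * (S p).H j := by
      rw [Matrix.mul_sub, transpose_mul, transpose_transpose, Matrix.mul_assoc, sub_add_cancel]
    rw [e]
    refine (norm_add_le _ _).trans (add_le_add ((opNorm_mul_le _ _).trans ?_)
      ((opNorm_mul_le _ _).trans ?_))
    · rw [opNorm_transpose]
    · rw [opNorm_transpose]
  · have e : (S p).errGram j (i p) ᵥ* (S p).L j =
        (S p).errGram j (i p) ᵥ* ((S p).L j - (S p).Λ j * (S p).H j) +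
          ((S p).errGram j (i p) ᵥ* (S p).Λ j) ᵥ* (S p).H j := by
      rw [vecMul_vecMul, ← vecMul_add, sub_add_cancel]
    rw [e]
    exact (nrm_add_le _ _).trans (add_le_add (nrm_vecMul_le _ _) (nrm_vecMul_le _ _))
  · exact (nrm_vecMul_le _ _).trans
      (mul_le_mul_of_nonneg_right (nrm_row_le _ _) (norm_nonneg _))

/-- The leading term of the estimation error of the loadings of one unit. -/
theorem tendsto_expansion (h : Regular S l q0 SF SL ψ φ c)
    (hU : ∀ j, IsEigen (SF j) (SL j) (v j) (U j)) (ho : ∀ᶠ p in l, (S p).Oriented SL U)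
    {i : ∀ p, Fin (S p).N} {j : Fin J} (hi : RegularUnit S l i j) :
    Tendsto (fun p => nrm (√((S p).T * q0 j) •
        ((S p).L j (i p) - ((S p).H j)ᵀ *ᵥ (S p).Λ j (i p)) -
      (diagonal (fun a => (√(v j a))⁻¹) * (U j)ᵀ * CFC.sqrt (SL j)) *ᵥ
        ((√((S p).T * q0 j))⁻¹ • (S p).cross j (i p)))) l (𝓝 0) := by
  have hq := h.q0_pos j
  set M : Matrix (Fin (r j)) (Fin (r j)) ℝ :=
    diagonal (fun a => (√(v j a))⁻¹) * (U j)ᵀ * CFC.sqrt (SL j) with hM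
  set A : ι → Matrix (Fin (r j)) (Fin (r j)) ℝ := fun p =>
    ((S p).N : ℝ)⁻¹ • (((S p).Λ j)ᵀ * (S p).L j) * ((S p).W j)⁻¹ with hA
  have hWinv := tendsto_matrix_inv (h.tendsto_W hU ho j) (h.isUnit_det_limit_W hU j)
  -- the coefficient of the score, `Λ' L / N · W⁻¹`, tends to `Mᵀ / q0`
  have hAlim : Tendsto (fun p => q0 j • A p - Mᵀ) l (𝓝 0) := by
    have h1 := (((h.tendsto_Λ_mul_L hU ho j).mul hWinv).const_smul (q0 j)).sub_const Mᵀ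
    have h2 : q0 j • (CFC.sqrt (SL j) * U j * (diagonal fun a => √(v j a)) *
        (q0 j • diagonal (v j))⁻¹) - Mᵀ = 0 := by
      have h3 : (q0 j • diagonal (v j))⁻¹ = (q0 j)⁻¹ • diagonal fun a => (v j a)⁻¹ := by
        apply inv_eq_right_inv
        rw [Matrix.smul_mul, Matrix.mul_smul, smul_smul, mul_inv_cancel₀ hq.ne', one_smul,
          diagonal_mul_diagonal, ← diagonal_one]
        congr 1
        ext a
        exact mul_inv_cancel₀ (eigen_pos (h.SF_posDef j) (h.SL_posDef j) (hU j) a).ne'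
      have h4 : (diagonal fun a => √(v j a)) * (diagonal fun a => (v j a)⁻¹) =
          diagonal fun a => (√(v j a))⁻¹ := by
        rw [diagonal_mul_diagonal]
        congr 1
        ext a
        have hv := eigen_pos (h.SF_posDef j) (h.SL_posDef j) (hU j) a
        have hs := Real.sqrt_pos.2 hv
        have hss := Real.mul_self_sqrt hv.le
        field_simp
        nlinarith
      rw [h3, Matrix.mul_smul, smul_smul, mul_inv_cancel₀ hq.ne', one_smul, Matrix.mul_assoc, h4,
        hM, transpose_mul, transpose_mul, transpose_transpose, diagonal_transpose, transpose_sqrt,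
        Matrix.mul_assoc, sub_self]
    rwa [h2] at h1
  have hb1 : Tendsto (fun p => (√((S p).T * q0 j))⁻¹ * nrm ((S p).cross j (i p)) *
      ‖q0 j • A p - Mᵀ‖) l (𝓝 0) := by
    have h1 : (fun p => (√((S p).T * q0 j))⁻¹ * nrm ((S p).cross j (i p))) =O[l]
        fun _ => (1 : ℝ) := by
      refine ((isBigO_refl _ _).mul hi.score).trans (IsBigO.of_bound (√(q0 j))⁻¹ ?_)
      filter_upwards [h.one_le_T] with p hT
      have hT0 : 0 < √((S p).T : ℝ) := Real.sqrt_pos.2 (by linarith)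
      rw [Real.norm_of_nonneg (by positivity), norm_one, mul_one, Real.sqrt_mul (by positivity)]
      refine le_of_eq ?_
      field_simp
    have h2 := (h1.mul (isBigO_refl (fun p => ‖q0 j • A p - Mᵀ‖) l)).trans_tendsto
      (g'' := fun p => 1 * ‖q0 j • A p - Mᵀ‖) (by simpa using hAlim.norm)
    exact h2
  have hb2 : Tendsto (fun p => √(q0 j) * (((S p).N : ℝ)⁻¹ * (√((S p).T : ℝ))⁻¹ *
      nrm ((S p).minor j (i p)) * ‖((S p).W j)⁻¹‖)) l (𝓝 0) := by
    have h1 := ((isBigO_refl (fun p => ((S p).N : ℝ)⁻¹ * (√((S p).T : ℝ))⁻¹) l).mul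
      (h.minor_isBigO hU ho hi)).mul (h.opNorm_inv_W hU ho j)
    have h2 := h1.trans_tendsto (by simpa using h.tendsto_minor_rate)
    simpa using h2.const_mul (√(q0 j))
  have hb := hb1.add hb2
  rw [add_zero] at hb
  refine squeeze_zero' (Eventually.of_forall fun p => nrm_nonneg _) ?_ hb
  filter_upwards [h.fit, h.one_le_T, h.one_le_N, eventually_isUnit_det (h.tendsto_W hU ho j)
    (h.isUnit_det_limit_W hU j)] with p hf hT hN hW
  have hT0 : 0 < ((S p).T : ℝ) := by linarith
  -- the normalizations `T⁻¹` of the expansion and `(T q0)^{-1/2}` of the score differ by the factor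
  -- `q0` that the limit of the coefficient lacks
  have hTq : √((S p).T * q0 j) * ((S p).T : ℝ)⁻¹ = (√((S p).T * q0 j))⁻¹ * q0 j := by
    have hs : 0 < √((S p).T * q0 j) := Real.sqrt_pos.2 (by positivity)
    have hss : √((S p).T * q0 j) * √((S p).T * q0 j) = (S p).T * q0 j :=
      Real.mul_self_sqrt (by positivity)
    field_simp
    nlinarith
  have e : √((S p).T * q0 j) • ((S p).L j (i p) - ((S p).H j)ᵀ *ᵥ (S p).Λ j (i p)) -
      M *ᵥ ((√((S p).T * q0 j))⁻¹ • (S p).cross j (i p)) =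
      (√((S p).T * q0 j))⁻¹ • ((S p).cross j (i p) ᵥ* (q0 j • A p - Mᵀ)) +
      (√((S p).T * q0 j) * (((S p).N : ℝ)⁻¹ * ((S p).T : ℝ)⁻¹)) •
        ((S p).minor j (i p) ᵥ* ((S p).W j)⁻¹) := by
    rw [hf.sub_row j hW, smul_add, smul_smul, smul_smul, hTq, vecMul_sub, vecMul_transpose,
      smul_sub, vecMul_smul, smul_smul, mulVec_smul]
    abel
  rw [e]
  refine (nrm_add_le _ _).trans (add_le_add ?_ ?_)
  · rw [nrm_smul, abs_of_nonneg (by positivity), mul_assoc]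
    exact mul_le_mul_of_nonneg_left (nrm_vecMul_le _ _) (by positivity)
  · rw [nrm_smul, abs_of_nonneg (by positivity)]
    have h1 : √((S p).T * q0 j) * (((S p).N : ℝ)⁻¹ * ((S p).T : ℝ)⁻¹) =
        √(q0 j) * (((S p).N : ℝ)⁻¹ * (√((S p).T : ℝ))⁻¹) := by
      have hs : 0 < √((S p).T : ℝ) := Real.sqrt_pos.2 hT0
      have hss : √((S p).T : ℝ) * √((S p).T : ℝ) = (S p).T := Real.mul_self_sqrt hT0.le
      rw [Real.sqrt_mul hT0.le]
      field_simp
      nlinarith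
    rw [h1, mul_assoc (√(q0 j)), mul_assoc (((S p).N : ℝ)⁻¹ * (√((S p).T : ℝ))⁻¹)]
    refine mul_le_mul_of_nonneg_left ?_ (by positivity)
    exact mul_le_mul_of_nonneg_left (nrm_vecMul_le _ _) (by positivity)

end Regular

/-! ### Events of probability tending to one -/

section Probability

variable {Ω : Type*} [MeasurableSpace Ω]

/-- The filter of the events, indexed by `n`, whose probability tends to one. -/
def whp (P : Measure Ω) : Filter (ℕ × Ω) where
  sets := {A | Tendsto (fun n => P {ω | (n, ω) ∉ A}) atTop (𝓝 0)}
  univ_sets := by simp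
  sets_of_superset := by
    intro A B hA hAB
    refine tendsto_of_tendsto_of_tendsto_of_le_of_le tendsto_const_nhds hA (fun _ => zero_le)
      fun n => measure_mono fun ω hω h => hω (hAB h)
  inter_sets := by
    intro A B hA hB
    have h := hA.add hB
    rw [add_zero] at h
    refine tendsto_of_tendsto_of_tendsto_of_le_of_le tendsto_const_nhds h (fun _ => zero_le)
      fun n => (measure_mono fun ω hω => ?_).trans (measure_union_le _ _)
    by_contra hn
    simp only [Set.mem_union, Set.mem_ofPred_eq, not_or, not_not] at hn
    exact hω hn

variable {P : Measure Ω}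

lemma eventually_whp {Q : ℕ × Ω → Prop} :
    (∀ᶠ p in whp P, Q p) ↔ Tendsto (fun n => P {ω | ¬ Q (n, ω)}) atTop (𝓝 0) := Iff.rfl

lemma tendsto_fst_whp : Tendsto Prod.fst (whp P) atTop := by
  intro A hA
  change Tendsto (fun n => P {ω : Ω | (n, ω) ∉ Prod.fst ⁻¹' A}) atTop (𝓝 0)
  refine tendsto_const_nhds.congr' ?_
  filter_upwards [hA] with n hn
  simp [hn]

lemma eventually_whp_of_ae {Q : ℕ × Ω → Prop} (h : ∀ n, ∀ᵐ ω ∂P, Q (n, ω)) :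
    ∀ᶠ p in whp P, Q p := by
  rw [eventually_whp]
  refine tendsto_const_nhds.congr fun n => ?_
  exact (ae_iff.1 (h n)).symm

lemma tendsto_whp_iff {E : Type*} [PseudoEMetricSpace E] {X : ℕ → Ω → E} {y : E} :
    Tendsto (fun p : ℕ × Ω => X p.1 p.2) (whp P) (𝓝 y) ↔
      TendstoInMeasure P X atTop fun _ => y := by
  rw [Metric.nhds_basis_eball.tendsto_right_iff]
  refine forall₂_congr fun ε _ => ?_
  rw [eventually_whp]
  simp only [Metric.mem_eball, not_lt]

/-- `R` holds along all filters that are finer than `whp P` and live on certain events whose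
probability is arbitrarily close to one. -/
def InProb (P : Measure Ω) (R : Filter (ℕ × Ω) → Prop) : Prop :=
  ∀ ε : ℝ, 0 < ε → ∃ A : Set (ℕ × Ω),
    (∀ᶠ n in atTop, P {ω | (n, ω) ∉ A} ≤ ENNReal.ofReal ε) ∧ ∀ l ≤ whp P ⊓ 𝓟 A, R l

/-- The property that `X` is bounded along a filter. -/
def BddAlong {κ : Type*} (X : κ → ℝ) (l : Filter κ) : Prop := ∃ K, ∀ᶠ p in l, X p ≤ K

lemma InProb.and {R R' : Filter (ℕ × Ω) → Prop} (h : InProb P R) (h' : InProb P R') :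
    InProb P fun l => R l ∧ R' l := by
  intro ε hε
  obtain ⟨A, hA, hRA⟩ := h (ε / 2) (half_pos hε)
  obtain ⟨B, hB, hRB⟩ := h' (ε / 2) (half_pos hε)
  refine ⟨A ∩ B, ?_, fun l hl => ⟨hRA l (hl.trans ?_), hRB l (hl.trans ?_)⟩⟩
  · filter_upwards [hA, hB] with n h1 h2
    have h3 : {ω | (n, ω) ∉ A ∩ B} ⊆ {ω | (n, ω) ∉ A} ∪ {ω | (n, ω) ∉ B} := by
      intro ω hω
      by_contra hn
      simp only [Set.mem_union, Set.mem_ofPred_eq, not_or, not_not] at hn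
      exact hω hn
    calc P {ω | (n, ω) ∉ A ∩ B} ≤ _ := (measure_mono h3).trans (measure_union_le _ _)
      _ ≤ ENNReal.ofReal (ε / 2) + ENNReal.ofReal (ε / 2) := add_le_add h1 h2
      _ = ENNReal.ofReal ε := by rw [← ENNReal.ofReal_add (by positivity) (by positivity),
        add_halves]
  · exact inf_le_inf_left _ (principal_mono.2 Set.inter_subset_left)
  · exact inf_le_inf_left _ (principal_mono.2 Set.inter_subset_right)

lemma InProb.forall_fin {J : ℕ} {R : Fin J → Filter (ℕ × Ω) → Prop}
    (h : ∀ j, InProb P (R j)) : InProb P fun l => ∀ j, R j l := by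
  have key : ∀ s : Finset (Fin J), InProb P fun l => ∀ j ∈ s, R j l := by
    intro s
    induction s using Finset.induction_on with
    | empty => exact fun ε _ => ⟨Set.univ, by simp, by simp⟩
    | insert a s _ ih =>
      intro ε hε
      obtain ⟨A, hA, h1⟩ := (h a).and ih ε hε
      exact ⟨A, hA, fun l hl => Finset.forall_mem_insert _ _ _ |>.2 (h1 l hl)⟩
  simpa using key Finset.univ

/-- Convergence in probability may be verified on events of probability close to one. -/
lemma InProb.tendsto {E : Type*} [TopologicalSpace E] {R : Filter (ℕ × Ω) → Prop} {X : ℕ × Ω → E}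
    {y : E} (h : InProb P R) (hX : ∀ l ≤ whp P, R l → Tendsto X l (𝓝 y)) :
    Tendsto X (whp P) (𝓝 y) := by
  intro B hB
  change Tendsto (fun n => P {ω | (n, ω) ∉ X ⁻¹' B}) atTop (𝓝 0)
  rw [ENNReal.tendsto_nhds_zero]
  intro ε hε
  obtain ⟨δ, hδ, hδε⟩ : ∃ δ : ℝ, 0 < δ ∧ ENNReal.ofReal δ + ENNReal.ofReal δ ≤ ε := by
    rcases eq_or_ne ε ⊤ with rfl | htop
    · exact ⟨1, one_pos, le_top⟩
    · have := ENNReal.toReal_pos hε.ne' htop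
      refine ⟨ε.toReal / 2, by linarith, ?_⟩
      rw [← ENNReal.ofReal_add (by linarith) (by linarith), add_halves, ENNReal.ofReal_toReal htop]
  obtain ⟨A, hA, hR⟩ := h δ hδ
  have h1 : ∀ᶠ p in whp P, p ∈ A → X p ∈ B :=
    eventually_inf_principal.1 ((hX _ inf_le_left (hR _ le_rfl)).eventually hB)
  have h2 := ENNReal.tendsto_nhds_zero.1 (eventually_whp.1 h1) (ENNReal.ofReal δ)
    (ENNReal.ofReal_pos.2 hδ)
  filter_upwards [hA, h2] with n h3 h4
  refine (measure_mono (t := {ω | (n, ω) ∉ A} ∪ {ω | ¬ ((n, ω) ∈ A → X (n, ω) ∈ B)}) ?_).trans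
    ((measure_union_le _ _).trans ((add_le_add h3 h4).trans hδε))
  intro ω hω
  by_contra hn
  simp only [Set.mem_union, Set.mem_ofPred_eq, not_or, not_not] at hn
  exact hω (hn.2 hn.1)

/-- Bounded expectations imply boundedness in probability. -/
lemma inProb_of_lintegral {X : ℕ → Ω → ℝ} (hm : ∀ n, Measurable (X n)) {M : ℝ}
    (hX : ∀ n, ∫⁻ ω, ENNReal.ofReal (X n ω) ∂P ≤ ENNReal.ofReal M) :
    InProb P (BddAlong fun p => X p.1 p.2) := by
  intro ε hε
  set K : ℝ := (|M| + 1) / ε with hK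
  have hK0 : 0 < K := by positivity
  refine ⟨{p | X p.1 p.2 ≤ K}, Eventually.of_forall fun n => ?_, fun l hl => ⟨K,
    (eventually_inf_principal.2 (Eventually.of_forall fun p hp => hp)).filter_mono hl⟩⟩
  have h1 := mul_meas_ge_le_lintegral (μ := P) ((hm n).ennreal_ofReal) (ENNReal.ofReal K)
  have h2 : {ω | (n, ω) ∉ {p : ℕ × Ω | X p.1 p.2 ≤ K}} ⊆
      {ω | ENNReal.ofReal K ≤ ENNReal.ofReal (X n ω)} := by
    intro ω hω
    simp only [Set.mem_ofPred_eq, not_le] at hω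
    exact ENNReal.ofReal_le_ofReal hω.le
  refine (measure_mono h2).trans ?_
  have h3 : ENNReal.ofReal K * P {ω | ENNReal.ofReal K ≤ ENNReal.ofReal (X n ω)} ≤
      ENNReal.ofReal K * ENNReal.ofReal ε := by
    refine (h1.trans (hX n)).trans ?_
    rw [← ENNReal.ofReal_mul hK0.le, hK, div_mul_cancel₀ _ hε.ne']
    exact ENNReal.ofReal_le_ofReal (by linarith [le_abs_self M])
  exact (ENNReal.mul_le_mul_iff_right (ENNReal.ofReal_pos.2 hK0).ne' ENNReal.ofReal_ne_top).1 h3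

lemma ofReal_norm_rpow {E : Type*} [SeminormedAddCommGroup E] (y : E) {a : ℝ} (ha : 0 ≤ a) :
    ENNReal.ofReal (‖y‖ ^ a) = ‖y‖ₑ ^ a := by
  rw [← ENNReal.ofReal_rpow_of_nonneg (norm_nonneg y) ha, ofReal_norm]

/-- An average of `a`-th powers of norms inherits a bound on the `a`-th moments. -/
lemma lintegral_average_le {E κ : Type*} [SeminormedAddCommGroup E] {a : ℝ} (ha : 0 ≤ a)
    (s : Finset κ) {Y : κ → Ω → E} (hm : ∀ k ∈ s, Measurable fun ω => ‖Y k ω‖) {M : ℝ}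
    (hY : ∀ k ∈ s, ∫⁻ ω, ‖Y k ω‖ₑ ^ a ∂P ≤ ENNReal.ofReal M) :
    ∫⁻ ω, ENNReal.ofReal ((s.card : ℝ)⁻¹ * ∑ k ∈ s, ‖Y k ω‖ ^ a) ∂P ≤ ENNReal.ofReal M := by
  have h1 : ∀ ω, ENNReal.ofReal ((s.card : ℝ)⁻¹ * ∑ k ∈ s, ‖Y k ω‖ ^ a) =
      ENNReal.ofReal (s.card : ℝ)⁻¹ * ∑ k ∈ s, ENNReal.ofReal (‖Y k ω‖ ^ a) := by
    intro ω
    rw [ENNReal.ofReal_mul (by positivity), ENNReal.ofReal_sum_of_nonneg fun k _ => by positivity]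
  simp_rw [h1]
  rw [lintegral_const_mul' _ _ ENNReal.ofReal_ne_top, lintegral_finsetSum _
    fun k hk => ((hm k hk).pow_const a).ennreal_ofReal]
  rcases s.eq_empty_or_nonempty with rfl | hs
  · simp
  have hc : (0 : ℝ) < s.card := by exact_mod_cast hs.card_pos
  calc ENNReal.ofReal (s.card : ℝ)⁻¹ * ∑ k ∈ s, ∫⁻ ω, ENNReal.ofReal (‖Y k ω‖ ^ a) ∂P
      ≤ ENNReal.ofReal (s.card : ℝ)⁻¹ * ∑ k ∈ s, ENNReal.ofReal M := by
        gcongr with k hk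
        simp_rw [ofReal_norm_rpow _ ha]
        exact hY k hk
    _ = ENNReal.ofReal M := by
        rw [Finset.sum_const, nsmul_eq_mul, ← mul_assoc, ← ENNReal.ofReal_natCast,
          ← ENNReal.ofReal_mul (by positivity), inv_mul_cancel₀ hc.ne', ENNReal.ofReal_one, one_mul]

lemma inProb_average {E : Type*} {κ : ℕ → Type*} [SeminormedAddCommGroup E] {a : ℝ} (ha : 0 ≤ a)
    (s : ∀ n, Finset (κ n)) {Y : ∀ n, κ n → Ω → E}
    (hm : ∀ n, ∀ k ∈ s n, Measurable fun ω => ‖Y n k ω‖) {M : ℝ}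
    (hY : ∀ n, ∀ k ∈ s n, ∫⁻ ω, ‖Y n k ω‖ₑ ^ a ∂P ≤ ENNReal.ofReal M) :
    InProb P (BddAlong fun p : ℕ × Ω =>
      ((s p.1).card : ℝ)⁻¹ * ∑ k ∈ s p.1, ‖Y p.1 k p.2‖ ^ a) := by
  refine inProb_of_lintegral (X := fun n ω => ((s n).card : ℝ)⁻¹ * ∑ k ∈ s n, ‖Y n k ω‖ ^ a)
    (fun n => ?_) fun n => lintegral_average_le ha (s n) (hm n) (hY n)
  exact (Finset.measurable_fun_sum _ fun k hk => (hm n k hk).pow_const a).const_mul _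

end Probability

/-! ### The samples of a factor model -/

namespace Model

variable {Ω : Type*} [MeasurableSpace Ω] {J : ℕ} {r : Fin J → ℕ} (D : Model Ω J r)

/-- The sample of size `(N, T)` at `ω`, with its estimates. -/
abbrev sample (N T : ℕ) (ω : Ω) (q : Fin J → ℝ) (s2 : ℝ) (L : (j : Fin J) → ℕ → Vec (r j)) :
    Sample J r where
  N := N
  T := T
  z t := D.z t ω
  f j t := (D.f j t ω).ofLp
  e t i := D.e i t ω
  Λ j := loadMat N (D.lam j)
  L j := loadMat N (L j)
  q := q
  s := s2

variable {D} {N T : ℕ} {ω : Ω} {q : Fin J → ℝ} {s2 : ℝ} {L : (j : Fin J) → ℕ → Vec (r j)}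

lemma obs_sample (t : ℕ) : (D.sample N T ω q s2 L).obs t = D.x N ω t := by
  ext i
  change (loadMat N (D.lam (D.z t ω)) *ᵥ (D.f (D.z t ω) t ω).ofLp) i + D.e i t ω = _
  rw [Model.x, EuclideanSpace.inner_eq_star_dotProduct]
  rfl

lemma facGram_sample (j : Fin J) :
    (D.sample N T ω q s2 L).facGram j = D.factorGram T ω j := by
  ext a b
  rw [Sample.facGram, weightedGram, Matrix.sum_apply]
  refine Finset.sum_congr rfl fun t _ => ?_
  rw [Matrix.smul_apply, vecMulVec_apply, smul_eq_mul, mul_comm]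
  rfl

lemma W_sample (j : Fin J) : (D.sample N T ω q s2 L).W j = D.W N T ω q s2 L j := by
  rw [Sample.W, W, Sample.share, smul_add, smul_smul, one_div, one_div, div_eq_inv_mul]
  simp only [Sample.post, obs_sample]

lemma H_sample (j : Fin J) : (D.sample N T ω q s2 L).H j = D.H N T ω q s2 L j := by
  rw [Sample.H, H, W_sample, facGram_sample, one_div, one_div]

lemma score_ofLp (T : ℕ) (ω : Ω) (j : Fin J) (i : ℕ) :
    (D.score T ω j i).ofLp =
      ∑ t ∈ Finset.range T, (D.e i t ω * D.ind j t ω) • (D.f j t ω).ofLp := by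
  rw [score, WithLp.ofLp_sum]
  rfl

lemma cross_row_sample (j : Fin J) (i : Fin N) :
    (D.sample N T ω q s2 L).cross j i = (D.score T ω j i).ofLp := by
  ext a
  rw [score_ofLp, Sample.cross, Matrix.sum_apply, Finset.sum_apply]
  refine Finset.sum_congr rfl fun t _ => ?_
  rw [Matrix.smul_apply, vecMulVec_apply, Pi.smul_apply, smul_eq_mul, smul_eq_mul]
  change D.ind j t ω * (D.e i t ω * (D.f j t ω).ofLp a) = _
  ring

lemma nrm_ofLp {n : ℕ} (v : Vec n) : nrm v.ofLp = ‖v‖ := rfl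

lemma Λ_mulVec_e_sample (j : Fin J) (t : ℕ) :
    ((D.sample N T ω q s2 L).Λ j)ᵀ *ᵥ (D.sample N T ω q s2 L).e t =
      (∑ i ∈ Finset.range N, D.e i t ω • D.lam j i).ofLp := by
  ext a
  rw [WithLp.ofLp_sum, Finset.sum_apply, Finset.sum_range, mulVec, dotProduct]
  refine Finset.sum_congr rfl fun i _ => ?_
  rw [WithLp.ofLp_smul, Pi.smul_apply, smul_eq_mul, mul_comm]
  rfl

lemma Λ_mul_cross_sample (j : Fin J) :
    ((D.sample N T ω q s2 L).Λ j)ᵀ * (D.sample N T ω q s2 L).cross j =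
      ∑ k ∈ Finset.range N, vecMulVec (D.lam j k).ofLp (D.score T ω j k).ofLp := by
  ext a b
  rw [Matrix.sum_apply, Finset.sum_range, mul_apply]
  refine Finset.sum_congr rfl fun k _ => ?_
  rw [vecMulVec_apply, ← cross_row_sample (D := D) (N := N) (q := q) (s2 := s2) (L := L)]
  rfl

lemma errGram_sample_apply (j : Fin J) (i k : Fin N) :
    (D.sample N T ω q s2 L).errGram j i k =
      ∑ t ∈ Finset.range T, D.e i t ω * D.e k t ω * D.ind j t ω := by
  rw [Sample.errGram, weightedGram, Matrix.sum_apply]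
  refine Finset.sum_congr rfl fun t _ => ?_
  rw [Matrix.smul_apply, vecMulVec_apply, smul_eq_mul, mul_comm]
  rfl

lemma ind_nonneg (j : Fin J) (t : ℕ) (ω : Ω) : 0 ≤ D.ind j t ω := by
  unfold ind
  split_ifs
  exacts [zero_le_one, le_rfl]

lemma ind_le_one (j : Fin J) (t : ℕ) (ω : Ω) : D.ind j t ω ≤ 1 := by
  unfold ind
  split_ifs
  exacts [le_rfl, zero_le_one]

variable (D) in
/-- The centred sums of the products of the errors of two units, over the dates of regime `j`. -/
noncomputable def centred (P : Measure Ω) (T : ℕ) (ω : Ω) (j : Fin J) (i k : ℕ) : ℝ :=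
  ∑ t ∈ Finset.range T, (D.e i t ω * D.e k t ω - D.errCov P i t k t) * D.ind j t ω

variable (D) in
/-- The sums of the error covariances of two units, over the dates of regime `j`. -/
noncomputable def covSum (P : Measure Ω) (T : ℕ) (ω : Ω) (j : Fin J) (i k : ℕ) : ℝ :=
  ∑ t ∈ Finset.range T, D.errCov P i t k t * D.ind j t ω

lemma errGram_sample (P : Measure Ω) (j : Fin J) :
    (D.sample N T ω q s2 L).errGram j =
      (Matrix.of fun i k : Fin N => D.centred P T ω j i k) +
        Matrix.of fun i k : Fin N => D.covSum P T ω j i k := by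
  ext i k
  rw [errGram_sample_apply, Matrix.add_apply, of_apply, of_apply, centred, covSum,
    ← Finset.sum_add_distrib]
  refine Finset.sum_congr rfl fun t _ => ?_
  ring

lemma covSum_comm (P : Measure Ω) (T : ℕ) (ω : Ω) (j : Fin J) (i k : ℕ) :
    D.covSum P T ω j i k = D.covSum P T ω j k i := by
  simp only [covSum, errCov, mul_comm]

lemma abs_covSum_le {P : Measure Ω} {τ : ℕ → ℕ → ℝ} (h : ∀ i k t, |D.errCov P i t k t| ≤ τ i k)
    (T : ℕ) (ω : Ω) (j : Fin J) (i k : ℕ) : |D.covSum P T ω j i k| ≤ T * τ i k := by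
  refine (Finset.abs_sum_le_sum_abs _ _).trans ?_
  refine (Finset.sum_le_sum fun t _ => (?_ : _ ≤ τ i k)).trans (le_of_eq (by simp))
  rw [abs_mul, abs_of_nonneg (ind_nonneg j t ω)]
  exact (mul_le_of_le_one_right (abs_nonneg _) (ind_le_one j t ω)).trans (h i k t)

lemma sum_abs_covSum_le {P : Measure Ω} {τ : ℕ → ℕ → ℝ} {M : ℝ}
    (h : ∀ i k t, |D.errCov P i t k t| ≤ τ i k) (hM : ∀ N i, ∑ k ∈ Finset.range N, τ i k ≤ M)
    (N T : ℕ) (ω : Ω) (j : Fin J) (i : ℕ) : ∑ k : Fin N, |D.covSum P T ω j i k| ≤ T * M := by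
  calc ∑ k : Fin N, |D.covSum P T ω j i k| ≤ ∑ k : Fin N, T * τ i k :=
        Finset.sum_le_sum fun k _ => abs_covSum_le h T ω j i k
    _ = T * ∑ k ∈ Finset.range N, τ i k := by rw [Finset.sum_range, Finset.mul_sum]
    _ ≤ _ := by gcongr; exact hM N i

lemma isFit_sample {c : ℝ} (hc : 0 < c) (hq : ∀ j, c ≤ q j) (hsum : ∑ j, q j = 1) (hs : 0 < s2)
    (h : D.IsQMLE N T ω q s2 L) : (D.sample N T ω q s2 L).IsFit c where
  c_pos := hc
  le_q := hq
  sum_q := hsum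
  s_pos := hs
  isMax Λ := by
    have := h.isMax Λ
    have hobs : (D.sample N T ω q s2 L).obs = D.x N ω := funext obs_sample
    rw [hobs]
    exact this
  diag := h.diag

end Model

/-! ### Finite-sample inequalities for the moment bounds -/

lemma le_of_rpow_le {x K A a : ℝ} (hx : 0 ≤ x) (hK : 1 ≤ K) (hA : 0 ≤ A) (ha : 1 ≤ a)
    (h : x ^ a ≤ A * K) : x ≤ K * A ^ (1 / a) := by
  have ha0 : 0 < a := by linarith
  have h1 : x = (x ^ a) ^ (1 / a) := by
    rw [← Real.rpow_mul hx, mul_one_div_cancel ha0.ne', Real.rpow_one]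
  rw [h1]
  calc (x ^ a) ^ (1 / a) ≤ (A * K) ^ (1 / a) :=
        Real.rpow_le_rpow (Real.rpow_nonneg hx _) h (by positivity)
    _ = A ^ (1 / a) * K ^ (1 / a) := Real.mul_rpow hA (by linarith)
    _ ≤ A ^ (1 / a) * K ^ (1 : ℝ) := by
        gcongr
        rw [div_le_one ha0]
        exact ha
    _ = _ := by rw [Real.rpow_one, mul_comm]

/-- A bounded average of `a`-th powers bounds the largest term by a multiple of the `a`-th root of the
number of terms. -/
lemma le_of_average_le {κ : Type*} {s : Finset κ} {y : κ → ℝ} (hy : ∀ k ∈ s, 0 ≤ y k) {a K : ℝ}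
    (hK : 1 ≤ K) (ha : 1 ≤ a) (h : (s.card : ℝ)⁻¹ * ∑ k ∈ s, y k ^ a ≤ K) {k : κ} (hk : k ∈ s) :
    y k ≤ K * (s.card : ℝ) ^ (1 / a) := by
  refine le_of_rpow_le (hy k hk) hK (by positivity) ha ?_
  have hc : (0 : ℝ) < s.card := by exact_mod_cast Finset.card_pos.2 ⟨k, hk⟩
  rw [inv_mul_le_iff₀ hc] at h
  exact (Finset.single_le_sum (f := fun k => y k ^ a)
    (fun k hk => Real.rpow_nonneg (hy k hk) _) hk).trans h

/-- The Euclidean norm is bounded by a higher power mean. -/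
lemma nrm_le_of_powerMean {N : ℕ} (x : Fin N → ℝ) {a A K : ℝ} (ha : 2 ≤ a) (hA : 0 ≤ A)
    (hK : 1 ≤ K) (h : ∑ i, |x i| ^ a ≤ N * (A * K)) : nrm x ≤ K * (√(N : ℝ) * A ^ (1 / a)) := by
  rcases Nat.eq_zero_or_pos N with rfl | hN
  · have : nrm x = 0 := by
      rw [Subsingleton.elim x 0, nrm_zero]
    rw [this]
    positivity
  have hN0 : (0 : ℝ) < N := by exact_mod_cast hN
  set w : ℝ := nrm x / √(N : ℝ) with hw
  have hw0 : 0 ≤ w := div_nonneg (nrm_nonneg _) (Real.sqrt_nonneg _)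
  have hsN : 0 < √(N : ℝ) := Real.sqrt_pos.2 hN0
  have h1 := Real.rpow_arith_mean_le_arith_mean_rpow Finset.univ (fun _ : Fin N => (N : ℝ)⁻¹)
    (fun i => |x i| ^ 2) (fun i _ => by positivity) (by simp [hN0.ne']) (fun i _ => by positivity)
    (show 1 ≤ a / 2 by linarith)
  have h2 : ∑ i, (N : ℝ)⁻¹ * |x i| ^ 2 = w ^ 2 := by
    rw [← Finset.mul_sum, hw, div_pow, Real.sq_sqrt hN0.le, nrm_sq, dotProduct, div_eq_inv_mul]
    congr 1
    exact Finset.sum_congr rfl fun i _ => by rw [sq_abs, sq]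
  have h3 : ∀ i, (|x i| ^ 2) ^ (a / 2) = |x i| ^ a := fun i => by
    rw [← Real.rpow_natCast, ← Real.rpow_mul (abs_nonneg _)]
    congr 1
    push_cast
    ring
  have h4 : (w ^ 2) ^ (a / 2) = w ^ a := by
    rw [← Real.rpow_natCast, ← Real.rpow_mul hw0]
    congr 1
    push_cast
    ring
  simp only [h3] at h1
  rw [h2, h4, ← Finset.mul_sum] at h1
  have h5 : w ≤ K * A ^ (1 / a) := by
    refine le_of_rpow_le hw0 hK hA (by linarith) (h1.trans ?_)
    rwa [inv_mul_le_iff₀ hN0]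
  rw [hw, div_le_iff₀ hsN] at h5
  linarith

/-- The operator norm of a symmetric matrix is bounded by its absolute row sums. -/
lemma opNorm_le_of_rowSum {n : ℕ} {B : Matrix (Fin n) (Fin n) ℝ} (hB : ∀ i k, B i k = B k i)
    {R : ℝ} (hR0 : 0 ≤ R) (hR : ∀ i, ∑ k, |B i k| ≤ R) : ‖B‖ ≤ R := by
  refine opNorm_le_of_nrm hR0 fun v => ?_
  refine nrm_le_of_sq_le (mul_nonneg hR0 (nrm_nonneg _)) ?_
  have h1 : ∀ i, (B *ᵥ v) i * (B *ᵥ v) i ≤ R * ∑ k, |B i k| * v k ^ 2 := by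
    intro i
    rw [← sq, mulVec, dotProduct]
    have h2 := Finset.sum_sq_le_sum_mul_sum_of_sq_le_mul Finset.univ
      (r := fun k => B i k * v k) (f := fun k => |B i k|) (g := fun k => |B i k| * v k ^ 2)
      (fun k _ => abs_nonneg _) (fun k _ => by positivity) (fun k _ => by
        rw [mul_pow, ← mul_assoc, ← sq, sq_abs])
    exact h2.trans (mul_le_mul_of_nonneg_right (hR i)
      (Finset.sum_nonneg fun k _ => by positivity))
  rw [mul_pow, nrm_sq]
  calc (B *ᵥ v) ⬝ᵥ (B *ᵥ v) ≤ ∑ i, R * ∑ k, |B i k| * v k ^ 2 := Finset.sum_le_sum fun i _ => h1 i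
    _ = R * ∑ k, (∑ i, |B k i|) * v k ^ 2 := by
        rw [← Finset.mul_sum, Finset.sum_comm]
        simp only [Finset.sum_mul]
        congr 1
        refine Finset.sum_congr rfl fun k _ => Finset.sum_congr rfl fun i _ => ?_
        rw [hB]
    _ ≤ R * ∑ k, R * v k ^ 2 := by
        gcongr with k
        exact hR k
    _ = R ^ 2 * (v ⬝ᵥ v) := by
        rw [← Finset.mul_sum, dotProduct, ← mul_assoc, ← sq]
        congr 1
        exact Finset.sum_congr rfl fun i _ => by rw [sq]

lemma nrm_le_sum_abs {n : ℕ} (x : Fin n → ℝ) : nrm x ≤ ∑ i, |x i| := by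
  have h : 0 ≤ ∑ i, |x i| := Finset.sum_nonneg fun i _ => abs_nonneg _
  refine nrm_le_of_sq_le h ?_
  rw [sq, Finset.sum_mul_sum, dotProduct]
  refine Finset.sum_le_sum fun i _ => ?_
  refine le_trans ?_ (Finset.single_le_sum (f := fun k => |x i| * |x k|)
    (fun k _ => by positivity) (Finset.mem_univ i))
  rw [← abs_mul]
  exact le_abs_self _

/-! ### Boundedness in probability from the moment conditions -/

namespace Model

variable {Ω : Type*} [MeasurableSpace Ω] {J : ℕ} {r : Fin J → ℕ}

/-- Along the filter `l`, the averages that appear in the moment conditions are bounded. -/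
structure Moderate (D : Model Ω J r) (P : Measure Ω) (α β : ℝ) (N T : ℕ → ℕ) (s2 : ℕ → Ω → ℝ)
    (l : Filter (ℕ × Ω)) : Prop where
  variance : BddAlong (fun p => s2 p.1 p.2 + (s2 p.1 p.2)⁻¹) l
  factor : BddAlong (fun p => ((Finset.range (T p.1)).card : ℝ)⁻¹ *
    ∑ t ∈ Finset.range (T p.1), ‖‖D.f (D.z t p.2) t p.2‖‖ ^ α) l
  error : BddAlong (fun p => ((Finset.range (N p.1) ×ˢ Finset.range (T p.1)).card : ℝ)⁻¹ *
    ∑ k ∈ Finset.range (N p.1) ×ˢ Finset.range (T p.1), ‖D.e k.1 k.2 p.2‖ ^ α) l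
  loading_error : ∀ j, BddAlong (fun p => ((Finset.range (T p.1)).card : ℝ)⁻¹ *
    ∑ t ∈ Finset.range (T p.1), ‖(1 / √(N p.1 : ℝ)) •
      ∑ i ∈ Finset.range (N p.1), D.e i t p.2 • D.lam j i‖ ^ β) l
  error_prod : ∀ j, BddAlong (fun p => ((Finset.range (N p.1) ×ˢ Finset.range (N p.1)).card : ℝ)⁻¹ *
    ∑ k ∈ Finset.range (N p.1) ×ˢ Finset.range (N p.1),
      ‖(1 / √(T p.1 : ℝ)) * D.centred P (T p.1) p.2 j k.1 k.2‖ ^ 2) l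
  score : ∀ j, BddAlong (fun p => ((Finset.range (N p.1)).card : ℝ)⁻¹ *
    ∑ i ∈ Finset.range (N p.1), ‖(1 / √(T p.1 : ℝ)) • D.score (T p.1) p.2 j i‖ ^ 2) l
  mixed : ∀ j, BddAlong (fun p => frobSq ((1 / √((N p.1 : ℝ) * T p.1)) •
    ∑ k ∈ Finset.range (N p.1), vecMulVec (D.lam j k).ofLp (D.score (T p.1) p.2 j k).ofLp)) l

/-- Along the filter `l`, the normalized sums that involve unit `i` in regime `j` are bounded. -/
structure ModerateUnit (D : Model Ω J r) (P : Measure Ω) (N T : ℕ → ℕ) (j : Fin J) (i : ℕ)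
    (l : Filter (ℕ × Ω)) : Prop where
  score : BddAlong (fun p => ‖(1 / √(T p.1 : ℝ)) • D.score (T p.1) p.2 j i‖ ^ 2) l
  row : BddAlong (fun p => ((Finset.range (N p.1)).card : ℝ)⁻¹ *
    ∑ k ∈ Finset.range (N p.1), ‖(1 / √(T p.1 : ℝ)) * D.centred P (T p.1) p.2 j i k‖ ^ 2) l
  row_loading : BddAlong (fun p => ‖(1 / √((N p.1 : ℝ) * T p.1)) •
    ∑ k ∈ Finset.range (N p.1), ∑ t ∈ Finset.range (T p.1),
      ((D.e i t p.2 * D.e k t p.2 - D.errCov P i t k t) * D.ind j t p.2) • D.lam j k‖ ^ 2) l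

variable {D : Model Ω J r} {P : Measure Ω}

lemma measurable_ind (j : Fin J) (t : ℕ) : Measurable (D.ind j t) :=
  Measurable.ite (D.measurable_z t (measurableSet_singleton j)) measurable_const measurable_const

lemma measurable_score (T : ℕ) (j : Fin J) (i : ℕ) : Measurable fun ω => D.score T ω j i :=
  Finset.measurable_fun_sum _ fun t _ =>
    ((D.measurable_e i t).mul (measurable_ind j t)).smul (D.measurable_f j t)

lemma measurable_centred (T : ℕ) (j : Fin J) (i k : ℕ) :
    Measurable fun ω => D.centred P T ω j i k :=
  Finset.measurable_fun_sum _ fun t _ =>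
    (((D.measurable_e i t).mul (D.measurable_e k t)).sub_const _).mul (measurable_ind j t)

lemma measurable_of_regime (D : Model Ω J r) (t : ℕ) {g : Fin J → Ω → ℝ}
    (hg : ∀ j, Measurable (g j)) : Measurable fun ω => g (D.z t ω) ω := by
  have : (fun ω => g (D.z t ω) ω) = fun ω => ∑ j, D.ind j t ω * g j ω := by
    ext ω
    rw [Finset.sum_eq_single (D.z t ω) (fun j _ hj => by rw [ind, if_neg hj.symm, zero_mul])
      (fun h => absurd (Finset.mem_univ _) h), ind, if_pos rfl, one_mul]
  rw [this]
  exact Finset.measurable_fun_sum _ fun j _ => (measurable_ind j t).mul (hg j)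

lemma inProb_average_sq {E : Type*} {κ : ℕ → Type*} [SeminormedAddCommGroup E]
    (s : ∀ n, Finset (κ n)) {Y : ∀ n, κ n → Ω → E}
    (hm : ∀ n, ∀ k ∈ s n, Measurable fun ω => ‖Y n k ω‖) {M : ℝ}
    (hY : ∀ n, ∀ k ∈ s n, ∫⁻ ω, ‖Y n k ω‖ₑ ^ 2 ∂P ≤ ENNReal.ofReal M) :
    InProb P (BddAlong fun p : ℕ × Ω =>
      ((s p.1).card : ℝ)⁻¹ * ∑ k ∈ s p.1, ‖Y p.1 k p.2‖ ^ 2) := by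
  have h := inProb_average (P := P) (a := 2) (by norm_num) s hm (M := M) (by
    intro n k hk
    simpa only [ENNReal.rpow_two] using hY n k hk)
  simpa only [Real.rpow_two] using h

lemma inProb_variance {s2 : ℕ → Ω → ℝ} (hs2_pos : ∀ n ω, 0 < s2 n ω)
    (hs2_tight : ∀ ε : ℝ, 0 < ε → ∃ c : ℝ, 0 < c ∧
      ∀ᶠ n in atTop, P {ω | s2 n ω < c ∨ c⁻¹ < s2 n ω} ≤ ENNReal.ofReal ε) :
    InProb P (BddAlong fun p => s2 p.1 p.2 + (s2 p.1 p.2)⁻¹) := by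
  intro ε hε
  obtain ⟨c, hc, hcε⟩ := hs2_tight ε hε
  refine ⟨{p | c ≤ s2 p.1 p.2 ∧ s2 p.1 p.2 ≤ c⁻¹}, ?_, fun l hl => ⟨c⁻¹ + c⁻¹,
    (eventually_inf_principal.2 (Eventually.of_forall fun p hp => ?_)).filter_mono hl⟩⟩
  · filter_upwards [hcε] with n hn
    refine (measure_mono fun ω hω => ?_).trans hn
    have hω' : ¬ (c ≤ s2 n ω ∧ s2 n ω ≤ c⁻¹) := hω
    rwa [not_and_or, not_le, not_le] at hω'
  · exact add_le_add hp.2 ((inv_le_inv₀ (hs2_pos _ _) hc).2 hp.1)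

variable [IsProbabilityMeasure P] {q0 : Fin J → ℝ}
  {SF SL : (j : Fin J) → Matrix (Fin (r j)) (Fin (r j)) ℝ}
  {Phi : (j : Fin J) → ℕ → Matrix (Fin (r j)) (Fin (r j)) ℝ} {α β M : ℝ}

lemma Conditions.inProb_loading_error (hD : D.Conditions P q0 SF SL Phi α β M) (N T : ℕ → ℕ)
    (j : Fin J) : InProb P (BddAlong fun p : ℕ × Ω => ((Finset.range (T p.1)).card : ℝ)⁻¹ *
      ∑ t ∈ Finset.range (T p.1), ‖(1 / √(N p.1 : ℝ)) •
        ∑ i ∈ Finset.range (N p.1), D.e i t p.2 • D.lam j i‖ ^ β) :=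
  inProb_average (P := P) (by linarith [hD.beta_ge]) (fun n => Finset.range (T n))
    (Y := fun n t ω => (1 / √(N n : ℝ)) • ∑ i ∈ Finset.range (N n), D.e i t ω • D.lam j i)
    (fun n t _ => Measurable.norm (Measurable.const_smul (c := 1 / √(N n : ℝ))
      (Finset.measurable_fun_sum _ fun i _ => (D.measurable_e i t).smul_const _))) (M := M)
    fun _ _ _ => hD.moment_loading_error _ _ _

lemma Conditions.inProb_error_prod (hD : D.Conditions P q0 SF SL Phi α β M) (N T : ℕ → ℕ)
    (j : Fin J) : InProb P (BddAlong fun p : ℕ × Ω =>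
      ((Finset.range (N p.1) ×ˢ Finset.range (N p.1)).card : ℝ)⁻¹ *
      ∑ k ∈ Finset.range (N p.1) ×ˢ Finset.range (N p.1),
        ‖(1 / √(T p.1 : ℝ)) * D.centred P (T p.1) p.2 j k.1 k.2‖ ^ 2) :=
  inProb_average_sq (fun n => Finset.range (N n) ×ˢ Finset.range (N n))
    (Y := fun n k ω => (1 / √(T n : ℝ)) * D.centred P (T n) ω j k.1 k.2)
    (fun _ _ _ => ((measurable_centred _ _ _ _).const_mul _).norm) (M := M)
    fun _ _ _ => hD.error_prod _ _ _ _

lemma Conditions.inProb_score (hD : D.Conditions P q0 SF SL Phi α β M) (N T : ℕ → ℕ)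
    (j : Fin J) : InProb P (BddAlong fun p : ℕ × Ω => ((Finset.range (N p.1)).card : ℝ)⁻¹ *
      ∑ i ∈ Finset.range (N p.1), ‖(1 / √(T p.1 : ℝ)) • D.score (T p.1) p.2 j i‖ ^ 2) :=
  inProb_average_sq (fun n => Finset.range (N n))
    (Y := fun n i ω => (1 / √(T n : ℝ)) • D.score (T n) ω j i)
    (fun n _ _ => ((measurable_score _ _ _).const_smul (1 / √(T n : ℝ))).norm) (M := M)
    fun _ _ _ => hD.moment_factor_error _ _ _

lemma Conditions.inProb_mixed (hD : D.Conditions P q0 SF SL Phi α β M) (N T : ℕ → ℕ)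
    (j : Fin J) : InProb P (BddAlong fun p : ℕ × Ω => frobSq ((1 / √((N p.1 : ℝ) * T p.1)) •
      ∑ k ∈ Finset.range (N p.1),
        vecMulVec (D.lam j k).ofLp (D.score (T p.1) p.2 j k).ofLp)) := by
  refine inProb_of_lintegral (X := fun n ω => frobSq ((1 / √((N n : ℝ) * T n)) •
    ∑ k ∈ Finset.range (N n), vecMulVec (D.lam j k).ofLp (D.score (T n) ω j k).ofLp))
    (fun n => ?_) (M := M) fun n => hD.double_mixed _ _ _
  unfold frobSq
  simp only [Matrix.smul_apply, Matrix.sum_apply, vecMulVec_apply, smul_eq_mul]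
  refine Finset.measurable_fun_sum _ fun a _ => Finset.measurable_fun_sum _ fun b _ =>
    Measurable.pow_const (Measurable.const_mul (Finset.measurable_fun_sum _ fun k _ =>
      Measurable.const_mul ?_ _) _) 2
  exact ((EuclideanSpace.proj (𝕜 := ℝ) b).continuous.measurable).comp (measurable_score _ _ _)

/-- All the averages of the moment conditions are bounded in probability, by Markov's inequality. -/
lemma Conditions.inProb_moderate (hD : D.Conditions P q0 SF SL Phi α β M) (N T : ℕ → ℕ)
    {s2 : ℕ → Ω → ℝ} (hs2_pos : ∀ n ω, 0 < s2 n ω)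
    (hs2_tight : ∀ ε : ℝ, 0 < ε → ∃ c : ℝ, 0 < c ∧
      ∀ᶠ n in atTop, P {ω | s2 n ω < c ∨ c⁻¹ < s2 n ω} ≤ ENNReal.ofReal ε) :
    InProb P (D.Moderate P α β N T s2) := by
  have hα : 0 ≤ α := by linarith [hD.alpha_gt]
  have h2 := inProb_average (P := P) hα (fun n => Finset.range (T n))
    (Y := fun n t ω => ‖D.f (D.z t ω) t ω‖) (fun n t _ => by
      simp only [norm_norm]
      exact measurable_of_regime D t (g := fun j ω => ‖D.f j t ω‖) fun j =>
        (D.measurable_f j t).norm)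
    (M := M) (fun n t _ => by
      simp only [enorm_norm]
      exact hD.factor_moment t)
  have h3 := inProb_average (P := P) hα (fun n => Finset.range (N n) ×ˢ Finset.range (T n))
    (Y := fun n k ω => D.e k.1 k.2 ω) (fun _ _ _ => (D.measurable_e _ _).norm) (M := M)
    fun _ _ _ => hD.error_moment _ _
  intro ε hε
  obtain ⟨A, hA, h⟩ := ((inProb_variance hs2_pos hs2_tight).and (h2.and (h3.and
    ((InProb.forall_fin (hD.inProb_loading_error N T)).and
    ((InProb.forall_fin (hD.inProb_error_prod N T)).and
    ((InProb.forall_fin (hD.inProb_score N T)).and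
    (InProb.forall_fin (hD.inProb_mixed N T)))))))) ε hε
  refine ⟨A, hA, fun l hl => ?_⟩
  obtain ⟨g1, g2, g3, g4, g5, g6, g7⟩ := h l hl
  exact ⟨g1, g2, g3, g4, g5, g6, g7⟩

lemma Conditions.inProb_moderateUnit (hD : D.Conditions P q0 SF SL Phi α β M) {N : ℕ → ℕ}
    (T : ℕ → ℕ) (j : Fin J) {i : ℕ} (hi : ∀ n, i < N n) :
    InProb P (D.ModerateUnit P N T j i) := by
  have h1 : InProb P (BddAlong fun p : ℕ × Ω =>
      ‖(1 / √(T p.1 : ℝ)) • D.score (T p.1) p.2 j i‖ ^ 2) := by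
    have := inProb_average_sq (P := P) (fun _ => ({0} : Finset ℕ))
      (Y := fun n _ ω => (1 / √(T n : ℝ)) • D.score (T n) ω j i)
      (fun n _ _ => ((measurable_score _ _ _).const_smul (1 / √(T n : ℝ))).norm) (M := M)
      fun _ _ _ => hD.moment_factor_error _ _ _
    simpa using this
  have h2 := inProb_average_sq (P := P) (fun n => Finset.range (N n))
    (Y := fun n k ω => (1 / √(T n : ℝ)) * D.centred P (T n) ω j i k)
    (fun _ _ _ => ((measurable_centred _ _ _ _).const_mul _).norm) (M := M)
    fun _ _ _ => hD.error_prod _ _ _ _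
  have h3 : InProb P (BddAlong fun p : ℕ × Ω => ‖(1 / √((N p.1 : ℝ) * T p.1)) •
      ∑ k ∈ Finset.range (N p.1), ∑ t ∈ Finset.range (T p.1),
        ((D.e i t p.2 * D.e k t p.2 - D.errCov P i t k t) * D.ind j t p.2) • D.lam j k‖ ^ 2) := by
    have := inProb_average_sq (P := P) (fun _ => ({0} : Finset ℕ))
      (Y := fun n _ ω => (1 / √((N n : ℝ) * T n)) •
        ∑ k ∈ Finset.range (N n), ∑ t ∈ Finset.range (T n),
          ((D.e i t ω * D.e k t ω - D.errCov P i t k t) * D.ind j t ω) • D.lam j k)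
      (fun n k _ => by
        refine Measurable.norm (Measurable.const_smul (c := 1 / √((N n : ℝ) * T n)) ?_)
        exact Finset.measurable_fun_sum _ fun k _ => Finset.measurable_fun_sum _ fun t _ =>
          ((((D.measurable_e i t).mul (D.measurable_e k t)).sub_const _).mul
            (measurable_ind j t)).smul_const _) (M := M)
      fun n k _ => hD.double_unit _ _ _ _ (hi n)
    simpa only [Finset.card_singleton, Finset.sum_singleton, Nat.cast_one, inv_one, one_mul]
      using this
  intro ε hε
  obtain ⟨A, hA, h⟩ := (h1.and (h2.and h3)) ε hε
  refine ⟨A, hA, fun l hl => ?_⟩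
  obtain ⟨g1, g2, g3⟩ := h l hl
  exact ⟨g1, g2, g3⟩

end Model

/-! ### Regularity of the samples with probability close to one -/

/-- A bound of `Z²` by `g²` times a factor that stays bounded. -/
lemma isBigO_of_sq_le {κ : Type*} {l : Filter κ} {Z g X : κ → ℝ} (hX : BddAlong X l)
    (h : ∀ᶠ p in l, Z p ^ 2 ≤ X p * g p ^ 2) : Z =O[l] g := by
  obtain ⟨K, hK⟩ := hX
  refine IsBigO.of_bound √|K| ?_
  filter_upwards [hK, h] with p h1 h2
  rw [Real.norm_eq_abs, Real.norm_eq_abs]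
  refine abs_le_of_sq_le_sq ?_ (by positivity)
  rw [mul_pow, Real.sq_sqrt (abs_nonneg _), sq_abs]
  exact h2.trans (mul_le_mul_of_nonneg_right (h1.trans (le_abs_self K)) (sq_nonneg _))

section Rates

variable {N T : ℕ → ℕ} {α β : ℝ}

/-- Uniform bounds of order `T^{1/α}` on the factors and errors are compatible with the consistency rate.
Here `T^{-1/8+2/α} → 0` because `α > 16`, and the fourth root of `T^{16/α} / N` dominates
`N^{-1/4} T^{2/α}`. -/
lemma tendsto_rate_factor (hα : 16 < α) (hT : Tendsto T atTop atTop)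
    (hrate : Tendsto (fun n => (T n : ℝ) ^ (16 / α) / (N n : ℝ)) atTop (𝓝 0)) :
    Tendsto (fun n => √((√√(T n : ℝ))⁻¹ + (√(N n : ℝ))⁻¹) * ((T n : ℝ) ^ (1 / α)) ^ 2) atTop
      (𝓝 0) := by
  have hα0 : 0 < α := by linarith
  have hTr : Tendsto (fun n => (T n : ℝ)) atTop atTop := tendsto_natCast_atTop_atTop.comp hT
  have h1 : Tendsto (fun n => (T n : ℝ) ^ (-(1 / 8 - 2 / α))) atTop (𝓝 0) := by
    refine (tendsto_rpow_neg_atTop ?_).comp hTr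
    rw [sub_pos, div_lt_iff₀ hα0]
    linarith
  have h2 := hrate.rpow_const (p := 1 / 4) (Or.inr (by norm_num))
  rw [Real.zero_rpow (by norm_num)] at h2
  have h3 := h1.add h2
  rw [add_zero] at h3
  refine squeeze_zero' (Eventually.of_forall fun n => by positivity) ?_ h3
  filter_upwards [hTr.eventually_ge_atTop 1] with n hn
  have hT0 : (0 : ℝ) < T n := by linarith
  have hN0 : (0 : ℝ) ≤ N n := by positivity
  have e0 : ((T n : ℝ) ^ (1 / α)) ^ 2 = (T n : ℝ) ^ (2 / α) := by
    rw [← Real.rpow_natCast, ← Real.rpow_mul hT0.le]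
    congr 1
    push_cast
    ring
  have e1 : √((√√(T n : ℝ))⁻¹) = (T n : ℝ) ^ (-(1 / 8 : ℝ)) := by
    rw [Real.sqrt_eq_rpow, Real.sqrt_eq_rpow, Real.sqrt_eq_rpow, ← Real.rpow_mul hT0.le,
      ← Real.rpow_neg hT0.le, ← Real.rpow_mul hT0.le]
    norm_num
  have e2 : √((√(N n : ℝ))⁻¹) = ((N n : ℝ) ^ (1 / 4 : ℝ))⁻¹ := by
    rw [Real.sqrt_inv, Real.sqrt_eq_rpow, Real.sqrt_eq_rpow, ← Real.rpow_mul hN0]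
    norm_num
  have h4 : √((√√(T n : ℝ))⁻¹ + (√(N n : ℝ))⁻¹) ≤
      √((√√(T n : ℝ))⁻¹) + √((√(N n : ℝ))⁻¹) := by
    refine Real.sqrt_le_iff.2 ⟨by positivity, ?_⟩
    rw [add_sq, Real.sq_sqrt (by positivity), Real.sq_sqrt (by positivity)]
    have : 0 ≤ 2 * √((√√(T n : ℝ))⁻¹) * √((√(N n : ℝ))⁻¹) := by positivity
    linarith
  rw [e0]
  refine (mul_le_mul_of_nonneg_right h4 (by positivity)).trans ?_
  rw [e1, e2, add_mul]
  refine add_le_add (le_of_eq ?_) ?_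
  · rw [← Real.rpow_add hT0]
    congr 1
    ring
  · rw [Real.div_rpow (by positivity) hN0, ← Real.rpow_mul hT0.le, div_eq_mul_inv, mul_comm]
    refine mul_le_mul_of_nonneg_right (Real.rpow_le_rpow_of_exponent_le hn ?_) (by positivity)
    rw [div_mul_eq_mul_div]
    gcongr
    norm_num

lemma tendsto_rate_cross
    (hrate : Tendsto (fun n => (T n : ℝ) ^ (2 / α + 2 / β) / (N n : ℝ)) atTop (𝓝 0))
    (hT : Tendsto T atTop atTop) :
    Tendsto (fun n => (T n : ℝ) ^ (1 / α) * (T n : ℝ) ^ (1 / β) / √(N n : ℝ)) atTop (𝓝 0) := by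
  have hTr : Tendsto (fun n => (T n : ℝ)) atTop atTop := tendsto_natCast_atTop_atTop.comp hT
  have h := hrate.sqrt
  rw [Real.sqrt_zero] at h
  refine h.congr' ?_
  filter_upwards [hTr.eventually_ge_atTop 1] with n hn
  have hT0 : (0 : ℝ) < T n := by linarith
  rw [Real.sqrt_div (by positivity), Real.sqrt_eq_rpow (_ ^ _), ← Real.rpow_mul hT0.le,
    ← Real.rpow_add hT0]
  congr 2
  ring

end Rates

namespace Model

variable {Ω : Type*} [MeasurableSpace Ω] {J : ℕ} {r : Fin J → ℕ} {D : Model Ω J r}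

section Fixed

variable {N T : ℕ} {ω : Ω} {q : Fin J → ℝ} {s2 : ℝ} {L : (j : Fin J) → ℕ → Vec (r j)}

lemma opNorm_cross_sq_le (hN : 0 < N) (hT : 0 < T) (j : Fin J) :
    ‖(D.sample N T ω q s2 L).cross j‖ ^ 2 ≤ (((Finset.range N).card : ℝ)⁻¹ *
      ∑ i ∈ Finset.range N, ‖(1 / √(T : ℝ)) • D.score T ω j i‖ ^ 2) *
        (√(N : ℝ) * √(T : ℝ)) ^ 2 := by
  have hN0 : (0 : ℝ) < N := by exact_mod_cast hN
  have hT0 : (0 : ℝ) < T := by exact_mod_cast hT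
  refine (opNorm_sq_le_frobSq _).trans (le_of_eq ?_)
  rw [frobSq_eq_sum_nrm_sq, mul_pow, Real.sq_sqrt hN0.le, Real.sq_sqrt hT0.le, Finset.card_range,
    Finset.mul_sum, Finset.sum_mul, Finset.sum_range]
  refine Finset.sum_congr rfl fun i _ => ?_
  rw [cross_row_sample, nrm_ofLp, norm_smul, mul_pow, norm_div, norm_one,
    Real.norm_of_nonneg (Real.sqrt_nonneg _), div_pow, Real.sq_sqrt hT0.le]
  field_simp

lemma frobSq_smul {m n : ℕ} (a : ℝ) (A : Matrix (Fin m) (Fin n) ℝ) :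
    frobSq (a • A) = a ^ 2 * frobSq A := by
  simp only [frobSq, Matrix.smul_apply, smul_eq_mul, mul_pow, Finset.mul_sum]

lemma opNorm_Λ_cross_sq_le (hN : 0 < N) (hT : 0 < T) (j : Fin J) :
    ‖((D.sample N T ω q s2 L).Λ j)ᵀ * (D.sample N T ω q s2 L).cross j‖ ^ 2 ≤
      frobSq ((1 / √((N : ℝ) * T)) • ∑ k ∈ Finset.range N,
        vecMulVec (D.lam j k).ofLp (D.score T ω j k).ofLp) * (√(N : ℝ) * √(T : ℝ)) ^ 2 := by
  have hN0 : (0 : ℝ) < N := by exact_mod_cast hN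
  have hT0 : (0 : ℝ) < T := by exact_mod_cast hT
  refine (opNorm_sq_le_frobSq _).trans (le_of_eq ?_)
  rw [Λ_mul_cross_sample, frobSq_smul, mul_pow, Real.sq_sqrt hN0.le, Real.sq_sqrt hT0.le, div_pow,
    Real.sq_sqrt (by positivity)]
  field_simp

lemma opNorm_centred_sq_le (P : Measure Ω) (hN : 0 < N) (hT : 0 < T) (j : Fin J) :
    ‖(Matrix.of fun i k : Fin N => D.centred P T ω j i k)‖ ^ 2 ≤
      (((Finset.range N ×ˢ Finset.range N).card : ℝ)⁻¹ *
        ∑ k ∈ Finset.range N ×ˢ Finset.range N,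
          ‖(1 / √(T : ℝ)) * D.centred P T ω j k.1 k.2‖ ^ 2) * (N * √(T : ℝ)) ^ 2 := by
  have hN0 : (0 : ℝ) < N := by exact_mod_cast hN
  have hT0 : (0 : ℝ) < T := by exact_mod_cast hT
  refine (opNorm_sq_le_frobSq _).trans (le_of_eq ?_)
  rw [Finset.sum_product, Finset.sum_range, frobSq, Finset.card_product, Finset.card_range,
    Finset.mul_sum, Finset.sum_mul]
  refine Finset.sum_congr rfl fun i _ => ?_
  rw [Finset.sum_range, Finset.mul_sum, Finset.sum_mul]
  refine Finset.sum_congr rfl fun k _ => ?_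
  rw [norm_mul, mul_pow, norm_div, norm_one, Real.norm_of_nonneg (Real.sqrt_nonneg _), div_pow,
    Real.sq_sqrt hT0.le, mul_pow, Real.sq_sqrt hT0.le, of_apply, Real.norm_eq_abs, sq_abs]
  push_cast
  field_simp

lemma nrm_centred_row_sq_le (P : Measure Ω) (hN : 0 < N) (hT : 0 < T) (j : Fin J) (i : ℕ) :
    nrm (fun k : Fin N => D.centred P T ω j i k) ^ 2 ≤
      (((Finset.range N).card : ℝ)⁻¹ * ∑ k ∈ Finset.range N,
          ‖(1 / √(T : ℝ)) * D.centred P T ω j i k‖ ^ 2) * (√(N : ℝ) * √(T : ℝ)) ^ 2 := by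
  have hN0 : (0 : ℝ) < N := by exact_mod_cast hN
  have hT0 : (0 : ℝ) < T := by exact_mod_cast hT
  refine le_of_eq ?_
  rw [nrm_sq, dotProduct, Finset.sum_range, Finset.card_range, Finset.mul_sum, Finset.sum_mul]
  refine Finset.sum_congr rfl fun k _ => ?_
  rw [norm_mul, mul_pow, norm_div, norm_one, Real.norm_of_nonneg (Real.sqrt_nonneg _), div_pow,
    Real.sq_sqrt hT0.le, mul_pow, Real.sq_sqrt hT0.le, Real.sq_sqrt hN0.le, Real.norm_eq_abs,
    sq_abs]
  field_simp

lemma nrm_centred_row_loading_sq_le (P : Measure Ω) (hN : 0 < N) (hT : 0 < T) (j : Fin J)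
    (i : ℕ) :
    nrm ((fun k : Fin N => D.centred P T ω j i k) ᵥ* loadMat N (D.lam j)) ^ 2 ≤
      ‖(1 / √((N : ℝ) * T)) • ∑ k ∈ Finset.range N, ∑ t ∈ Finset.range T,
        ((D.e i t ω * D.e k t ω - D.errCov P i t k t) * D.ind j t ω) • D.lam j k‖ ^ 2 *
        (√(N : ℝ) * √(T : ℝ)) ^ 2 := by
  have hN0 : (0 : ℝ) < N := by exact_mod_cast hN
  have hT0 : (0 : ℝ) < T := by exact_mod_cast hT
  have h1 : (fun k : Fin N => D.centred P T ω j i k) ᵥ* loadMat N (D.lam j) =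
      (∑ k ∈ Finset.range N, ∑ t ∈ Finset.range T,
        ((D.e i t ω * D.e k t ω - D.errCov P i t k t) * D.ind j t ω) • D.lam j k).ofLp := by
    ext a
    simp only [← Finset.sum_smul]
    rw [WithLp.ofLp_sum, Finset.sum_apply, Finset.sum_range, vecMul, dotProduct]
    refine Finset.sum_congr rfl fun k _ => ?_
    rw [WithLp.ofLp_smul, Pi.smul_apply, smul_eq_mul]
    rfl
  rw [h1, nrm_ofLp, norm_smul, mul_pow, norm_div, norm_one,
    Real.norm_of_nonneg (Real.sqrt_nonneg _), div_pow, Real.sq_sqrt (by positivity), mul_pow,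
    Real.sq_sqrt hN0.le, Real.sq_sqrt hT0.le]
  refine le_of_eq ?_
  field_simp

end Fixed

end Model

namespace Model

variable {Ω : Type*} [MeasurableSpace Ω] {J : ℕ} {r : Fin J → ℕ} {D : Model Ω J r}
  {P : Measure Ω} {q0 : Fin J → ℝ}
  {SF SL : (j : Fin J) → Matrix (Fin (r j)) (Fin (r j)) ℝ}
  {Phi : (j : Fin J) → ℕ → Matrix (Fin (r j)) (Fin (r j)) ℝ} {α β M : ℝ}
  {N T : ℕ → ℕ} {q : ℕ → Ω → Fin J → ℝ} {s2 : ℕ → Ω → ℝ}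
  {L : ℕ → Ω → (j : Fin J) → ℕ → Vec (r j)} {l : Filter (ℕ × Ω)}

variable (D N T q s2 L) in
/-- The samples along a sequence of sizes and estimates. -/
abbrev samples (p : ℕ × Ω) : Sample J r :=
  D.sample (N p.1) (T p.1) p.2 (q p.1 p.2) (s2 p.1 p.2) (L p.1 p.2)

lemma tendsto_of_fst {E : Type*} {g : ℕ → E} {F : Filter E} (hl : l ≤ whp P)
    (h : Tendsto g atTop F) : Tendsto (fun p : ℕ × Ω => g p.1) l F :=
  h.comp (tendsto_fst_whp.mono_left hl)

lemma tendsto_of_inMeasure {E : Type*} [PseudoEMetricSpace E] {g : ℕ → Ω → E} {y : E}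
    (hl : l ≤ whp P) (hT : Tendsto T atTop atTop) (h : TendstoInMeasure P g atTop fun _ => y) :
    Tendsto (fun p : ℕ × Ω => g (T p.1) p.2) l (𝓝 y) :=
  (tendsto_whp_iff.2 (h.comp hT)).mono_left hl

lemma tendsto_matrix_of_entry {κ : Type*} {l : Filter κ} {m n : ℕ}
    {A : κ → Matrix (Fin m) (Fin n) ℝ} {B : Matrix (Fin m) (Fin n) ℝ}
    (h : ∀ a b, Tendsto (fun p => A p a b) l (𝓝 (B a b))) : Tendsto A l (𝓝 B) :=
  tendsto_pi_nhds.2 fun a => tendsto_pi_nhds.2 fun b => h a b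

/-- The largest factor, error and weighted error sum over the dates of the sample. -/
lemma Moderate.exists_maxima (hα : 2 ≤ α) (hβ : 1 ≤ β) (h : D.Moderate P α β N T s2 l)
    (hN : ∀ᶠ p in l, 0 < N p.1) :
    ∃ K : ℝ, 0 < K ∧ ∀ᶠ p in l, ∀ t < T p.1,
      nrm ((samples D N T q s2 L p).f ((samples D N T q s2 L p).z t) t) ≤
        K * (T p.1 : ℝ) ^ (1 / α) ∧
      nrm ((samples D N T q s2 L p).e t) ≤ K * (√(N p.1 : ℝ) * (T p.1 : ℝ) ^ (1 / α)) ∧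
      ∀ j, nrm (((samples D N T q s2 L p).Λ j)ᵀ *ᵥ (samples D N T q s2 L p).e t) ≤
        K * (√(N p.1 : ℝ) * (T p.1 : ℝ) ^ (1 / β)) := by
  obtain ⟨K1, hK1⟩ := h.factor
  obtain ⟨K2, hK2⟩ := h.error
  choose K3 hK3 using h.loading_error
  set K := 1 + |K1| + |K2| + ∑ j, |K3 j| with hK
  have hK3' : ∀ j, |K3 j| ≤ ∑ j, |K3 j| := fun j =>
    Finset.single_le_sum (f := fun j => |K3 j|) (fun j _ => abs_nonneg _) (Finset.mem_univ j)
  have hs : 0 ≤ ∑ j, |K3 j| := Finset.sum_nonneg fun j _ => abs_nonneg _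
  have hK1' : K1 ≤ K := by linarith [le_abs_self K1, abs_nonneg K2]
  have hK2' : K2 ≤ K := by linarith [le_abs_self K2, abs_nonneg K1]
  have hone : 1 ≤ K := by linarith [abs_nonneg K1, abs_nonneg K2]
  refine ⟨K, by linarith, ?_⟩
  filter_upwards [hK1, hK2, eventually_all.2 hK3, hN] with p h1 h2 h3 hN0 t ht
  have hT0 : (0 : ℝ) < T p.1 := by exact_mod_cast (Nat.zero_le t).trans_lt ht
  have hN0' : (0 : ℝ) < N p.1 := by exact_mod_cast hN0
  have ht' : t ∈ Finset.range (T p.1) := Finset.mem_range.2 ht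
  refine ⟨?_, ?_, fun j => ?_⟩
  · have := le_of_average_le (y := fun t => ‖‖D.f (D.z t p.2) t p.2‖‖)
      (fun k _ => norm_nonneg _) hone (by linarith : 1 ≤ α) (h1.trans hK1') ht'
    rwa [Finset.card_range, norm_norm] at this
  · refine nrm_le_of_powerMean _ hα hT0.le hone ?_
    have h4 := h2.trans hK2'
    have hNT : (0 : ℝ) < ((N p.1 * T p.1 : ℕ) : ℝ) := by
      push_cast
      positivity
    rw [Finset.card_product, Finset.card_range, Finset.card_range, inv_mul_le_iff₀ hNT,
      Finset.sum_product_right] at h4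
    have h5 := Finset.single_le_sum (f := fun t => ∑ i ∈ Finset.range (N p.1), ‖D.e i t p.2‖ ^ α)
      (fun t _ => Finset.sum_nonneg fun i _ => by positivity) ht'
    have h6 := h5.trans h4
    rw [Finset.sum_range] at h6
    push_cast at h6
    rw [← mul_assoc]
    exact h6
  · have h4 := le_of_average_le (y := fun t => ‖(1 / √(N p.1 : ℝ)) •
        ∑ i ∈ Finset.range (N p.1), D.e i t p.2 • D.lam j i‖)
      (fun k _ => norm_nonneg _) hone hβ ((h3 j).trans (by
        linarith [le_abs_self (K3 j), hK3' j, abs_nonneg K1, abs_nonneg K2])) ht'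
    rw [Λ_mulVec_e_sample, nrm_ofLp]
    rw [Finset.card_range, norm_smul, norm_div, norm_one,
      Real.norm_of_nonneg (Real.sqrt_nonneg _), one_div,
      inv_mul_le_iff₀ (Real.sqrt_pos.2 hN0')] at h4
    linarith

variable [IsProbabilityMeasure P]

lemma Conditions.M_nonneg (hD : D.Conditions P q0 SF SL Phi α β M) : 0 ≤ M := by
  obtain ⟨τ, -, hτ⟩ := hD.error_cross
  simpa using hτ 0 0

lemma Conditions.tendsto_facGram (hD : D.Conditions P q0 SF SL Phi α β M) (hl : l ≤ whp P)
    (hT : Tendsto T atTop atTop) (j : Fin J) :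
    Tendsto (fun p => ((T p.1 : ℕ) : ℝ)⁻¹ • (samples D N T q s2 L p).facGram j) l
      (𝓝 (q0 j • SF j)) := by
  refine tendsto_matrix_of_entry fun a b => ?_
  have h := (tendsto_of_inMeasure hl hT (hD.factor_plim j a b)).const_mul (q0 j)
  refine h.congr fun p => ?_
  rw [facGram_sample, Matrix.smul_apply, smul_eq_mul]
  have := (hD.q0_mem j).1.ne'
  field_simp

lemma Conditions.eventually_subsets (hD : D.Conditions P q0 SF SL Phi α β M) (hl : l ≤ whp P)
    (hT : Tendsto T atTop atTop) :
    ∃ d : ℝ, 0 < d ∧ ∀ᶠ p in l, ∀ j, ∀ A ⊆ Finset.range (T p.1),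
      (∀ t ∈ A, (samples D N T q s2 L p).z t = j) →
      (2 * J : ℝ)⁻¹ * (T p.1 * q0 j) ≤ A.card → ∀ v : Fin (r j) → ℝ,
        A.card * (d * nrm v ^ 2) ≤ ∑ t ∈ A, (v ⬝ᵥ (samples D N T q s2 L p).f j t) ^ 2 := by
  rcases isEmpty_or_nonempty (Fin J) with hJ | hJ
  · exact ⟨1, one_pos, Eventually.of_forall fun p j => (hJ.false j).elim⟩
  have hJ0 : (0 : ℝ) < J := by
    obtain ⟨j⟩ := hJ
    exact_mod_cast Fin.pos j
  choose d hd hlim using fun j => hD.factor_subsets j (2 * J : ℝ)⁻¹ (by positivity)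
  obtain ⟨j1, hj1⟩ := Finite.exists_min d
  refine ⟨d j1, hd j1, eventually_all.2 fun j => ?_⟩
  have h1 := (hlim j).comp hT
  have h2 : ∀ᶠ p in whp P, ¬ ∃ A ⊆ Finset.range (T p.1), (∀ t ∈ A, D.z t p.2 = j) ∧
      (2 * J : ℝ)⁻¹ * (T p.1 * q0 j) ≤ A.card ∧ ∃ v : Vec (r j),
        (1 / (A.card : ℝ)) * ∑ t ∈ A, ⟪v, D.f j t p.2⟫ ^ 2 < d j * ‖v‖ ^ 2 := by
    rw [eventually_whp]
    simp only [not_not]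
    exact h1
  filter_upwards [hl h2] with p hp A hA hz hcard v
  rcases A.eq_empty_or_nonempty with rfl | hne
  · simp
  have hc : (0 : ℝ) < A.card := by exact_mod_cast hne.card_pos
  push Not at hp
  have h3 := hp A hA hz hcard (WithLp.toLp 2 v)
  rw [one_div, inv_mul_eq_div, le_div_iff₀ hc] at h3
  have h4 : ∀ t, ⟪WithLp.toLp 2 v, D.f j t p.2⟫ = v ⬝ᵥ (D.f j t p.2).ofLp := fun t => by
    rw [EuclideanSpace.inner_eq_star_dotProduct, dotProduct_comm]
    rfl
  simp only [h4] at h3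
  refine le_trans ?_ h3
  rw [mul_comm]
  exact mul_le_mul_of_nonneg_right (mul_le_mul_of_nonneg_right (hj1 j) (sq_nonneg _)) hc.le

lemma Conditions.eventually_ident (hD : D.Conditions P q0 SF SL Phi α β M) (hl : l ≤ whp P)
    (hN : Tendsto N atTop atTop) (hT : Tendsto T atTop atTop) :
    ∃ C : ℝ, 0 < C ∧ ∀ᶠ p in l, ∀ j k, j ≠ k → ∀ t < T p.1,
      (samples D N T q s2 L p).z t = j →
      C * N p.1 ≤ (D.f j t p.2).ofLp ⬝ᵥ
        (((loadMat (N p.1) (D.lam j))ᵀ * annihilator (loadMat (N p.1) (D.lam k)) *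
          loadMat (N p.1) (D.lam j)) *ᵥ (D.f j t p.2).ofLp) := by
  obtain ⟨C, hC, hlim⟩ := hD.identification
  refine ⟨C, hC, eventually_all.2 fun j => eventually_all.2 fun k => ?_⟩
  by_cases hjk : j = k
  · exact Eventually.of_forall fun p h => absurd hjk h
  have hNT : Tendsto (fun n => (N n, T n)) atTop atTop := by
    rw [← prod_atTop_atTop_eq]
    exact hN.prodMk hT
  have h1 := (hlim j k hjk).comp hNT
  have h2 : ∀ᶠ p in whp P, ¬ ∃ t < T p.1, D.z t p.2 = j ∧
        (1 / (N p.1 : ℝ)) * ((D.f j t p.2).ofLp ⬝ᵥ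
          ((loadMat (N p.1) (D.lam j))ᵀ * annihilator (loadMat (N p.1) (D.lam k)) *
            loadMat (N p.1) (D.lam j)).mulVec (D.f j t p.2).ofLp) < C := by
    rw [eventually_whp]
    simp only [not_not]
    exact h1
  have hN1 : ∀ᶠ p in l, 0 < N p.1 := (tendsto_of_fst hl hN).eventually_gt_atTop 0
  filter_upwards [hl h2, hN1] with p hp hN0 _ t ht hz
  push Not at hp
  have h3 := hp t ht hz
  have : (0 : ℝ) < N p.1 := by exact_mod_cast hN0
  rwa [one_div, inv_mul_eq_div, le_div_iff₀ this] at h3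

/-- The second moments of the errors split into centred sums, of order `N √T` in
Frobenius norm, and sums of covariances, of order `T` in operator norm by their row sums. -/
lemma Conditions.errGram_isBigO (hD : D.Conditions P q0 SF SL Phi α β M)
    (h : D.Moderate P α β N T s2 l) (hN : ∀ᶠ p in l, 0 < N p.1) (hT : ∀ᶠ p in l, 0 < T p.1)
    (j : Fin J) :
    (fun p => ‖(samples D N T q s2 L p).errGram j‖) =O[l]
      fun p => (N p.1 : ℝ) * T p.1 * (samples D N T q s2 L p).rate ^ 2 := by
  obtain ⟨τ, hτ, hτM⟩ := hD.error_cross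
  have hrate : ∀ p, (√(T p.1 : ℝ))⁻¹ ≤ (samples D N T q s2 L p).rate ^ 2 ∧
      ((N p.1 : ℕ) : ℝ)⁻¹ ≤ (samples D N T q s2 L p).rate ^ 2 := by
    intro p
    have h1 : ((√√(T p.1 : ℝ))⁻¹) ^ 2 = (√(T p.1 : ℝ))⁻¹ := by
      rw [inv_pow, Real.sq_sqrt (Real.sqrt_nonneg _)]
    have h2 : ((√(N p.1 : ℝ))⁻¹) ^ 2 = (N p.1 : ℝ)⁻¹ := by
      rw [inv_pow, Real.sq_sqrt (by positivity)]
    have h3 : (samples D N T q s2 L p).rate = (√√(T p.1 : ℝ))⁻¹ + (√(N p.1 : ℝ))⁻¹ := rfl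
    rw [h3, ← h1, ← h2]
    constructor <;> gcongr
    · exact le_add_of_nonneg_right (by positivity)
    · exact le_add_of_nonneg_left (by positivity)
  have h1 : (fun p : ℕ × Ω => ‖(Matrix.of fun i k : Fin (N p.1) =>
      D.centred P (T p.1) p.2 j i k)‖) =O[l]
      fun p => (N p.1 : ℝ) * T p.1 * (samples D N T q s2 L p).rate ^ 2 := by
    refine (isBigO_of_sq_le (g := fun p => (N p.1 : ℝ) * √(T p.1 : ℝ)) (h.error_prod j) ?_).trans
      (IsBigO.of_bound 1 ?_)
    · filter_upwards [hN, hT] with p hN hT using opNorm_centred_sq_le P hN hT j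
    · filter_upwards with p
      rw [Real.norm_of_nonneg (by positivity), Real.norm_of_nonneg (by positivity), one_mul,
        mul_assoc]
      refine mul_le_mul_of_nonneg_left ?_ (by positivity)
      calc √(T p.1 : ℝ) = T p.1 * (√(T p.1 : ℝ))⁻¹ := by rw [← div_eq_mul_inv, Real.div_sqrt]
        _ ≤ _ := by gcongr; exact (hrate p).1
  have h2 : (fun p : ℕ × Ω => ‖(Matrix.of fun i k : Fin (N p.1) =>
      D.covSum P (T p.1) p.2 j i k)‖) =O[l]
      fun p => (N p.1 : ℝ) * T p.1 * (samples D N T q s2 L p).rate ^ 2 := by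
    refine IsBigO.of_bound M ?_
    filter_upwards [hN] with p hN
    rw [norm_norm, Real.norm_of_nonneg (by positivity)]
    refine (opNorm_le_of_rowSum (fun i k => covSum_comm P _ _ j i k)
      (mul_nonneg (by positivity) hD.M_nonneg) fun i =>
        sum_abs_covSum_le hτ hτM (N p.1) (T p.1) p.2 j i).trans ?_
    rw [mul_comm]
    refine mul_le_mul_of_nonneg_left ?_ hD.M_nonneg
    have hN0 : (0 : ℝ) < N p.1 := by exact_mod_cast hN
    have := (hrate p).2
    rw [inv_le_iff_one_le_mul₀ hN0] at this
    have hT0 : (0 : ℝ) ≤ T p.1 := by positivity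
    nlinarith
  refine IsBigO.trans (IsBigO.of_bound 1 (Eventually.of_forall fun p => ?_)) (h1.add h2)
  rw [errGram_sample P, norm_norm, one_mul, Real.norm_of_nonneg (by positivity)]
  exact norm_add_le _ _

/-- With probability close to one, the samples of the model satisfy the standing conditions. -/
lemma Conditions.regular (hD : D.Conditions P q0 SF SL Phi α β M)
    (hN : Tendsto N atTop atTop) (hT : Tendsto T atTop atTop)
    (hrate₁ : Tendsto (fun n => √(T n : ℝ) / (N n : ℝ)) atTop (𝓝 0))
    (hrate₂ : Tendsto (fun n => (T n : ℝ) ^ (16 / α) / (N n : ℝ)) atTop (𝓝 0))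
    (hrate₃ : Tendsto (fun n => (T n : ℝ) ^ (2 / α + 2 / β) / (N n : ℝ)) atTop (𝓝 0))
    (hq_sum : ∀ n ω, ∑ j, q n ω j = 1) (hq_pos : ∃ c : ℝ, 0 < c ∧ ∀ n ω j, c ≤ q n ω j)
    (hs2_pos : ∀ n ω, 0 < s2 n ω)
    (hL_max : ∀ n, ∀ᵐ ω ∂P, D.IsQMLE (N n) (T n) ω (q n ω) (s2 n ω) (L n ω))
    (hL_labels : ∀ n, ∀ᵐ ω ∂P, ∀ π : Equiv.Perm (Fin J), (∀ j, r (π j) = r j) →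
      ∑ j, frobSq (annihilator (loadMat (N n) (L n ω j)) * loadMat (N n) (D.lam j)) ≤
        ∑ j, frobSq (annihilator (loadMat (N n) (L n ω (π j))) * loadMat (N n) (D.lam j)))
    (hl : l ≤ whp P) (h : D.Moderate P α β N T s2 l) :
    ∃ c, Regular (samples D N T q s2 L) l q0 SF SL (fun p => (T p.1 : ℝ) ^ (1 / α))
      (fun p => (T p.1 : ℝ) ^ (1 / β)) c := by
  have hα := hD.alpha_gt
  have hβ := hD.beta_ge
  obtain ⟨cq, hcq, hqc⟩ := hq_pos
  obtain ⟨K, hK⟩ := h.variance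
  have hTr : Tendsto (fun n => (T n : ℝ)) atTop atTop := tendsto_natCast_atTop_atTop.comp hT
  have hT1 : ∀ᶠ p in l, 1 ≤ (T p.1 : ℝ) := (tendsto_of_fst hl hTr).eventually_ge_atTop 1
  have hN0 : ∀ᶠ p in l, 0 < N p.1 := (tendsto_of_fst hl hN).eventually_gt_atTop 0
  have hT0 : ∀ᶠ p in l, 0 < T p.1 := (tendsto_of_fst hl hT).eventually_gt_atTop 0
  have hNT0 := hN0.and hT0
  -- one constant bounds both the weights and the error variance from below
  refine ⟨min cq (|K| + 1)⁻¹, ?_⟩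
  have hc : 0 < min cq (|K| + 1)⁻¹ := lt_min hcq (by positivity)
  exact
  { N_top := tendsto_of_fst hl (tendsto_natCast_atTop_atTop.comp hN)
    T_top := tendsto_of_fst hl hTr
    fit := by
      have h1 : ∀ᶠ p in whp P, D.IsQMLE (N p.1) (T p.1) p.2 (q p.1 p.2) (s2 p.1 p.2) (L p.1 p.2) :=
        eventually_whp_of_ae hL_max
      filter_upwards [hl h1] with p hp
      exact isFit_sample hc (fun j => (min_le_left _ _).trans (hqc _ _ j)) (hq_sum _ _)
        (hs2_pos _ _) hp
    c_le_s := by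
      filter_upwards [hK] with p hp
      have hs := hs2_pos p.1 p.2
      refine (min_le_right _ _).trans ?_
      change _ ≤ s2 p.1 p.2
      rw [inv_le_comm₀ (by positivity) hs]
      linarith [le_abs_self K]
    s_bdd := by
      refine IsBigO.of_bound |K| ?_
      filter_upwards [hK] with p hp
      have hs := hs2_pos p.1 p.2
      have hsi := inv_pos.2 hs
      change ‖s2 p.1 p.2‖ ≤ _
      rw [Real.norm_of_nonneg hs.le, norm_one, mul_one]
      linarith [le_abs_self K]
    one_le_ψ := by
      filter_upwards [hT1] with p hp
      exact Real.one_le_rpow hp (by positivity)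
    one_le_φ := by
      filter_upwards [hT1] with p hp
      exact Real.one_le_rpow hp (by positivity)
    rate_ψ := tendsto_of_fst hl (tendsto_rate_factor hα hT hrate₂)
    ψ_φ := tendsto_of_fst hl (tendsto_rate_cross hrate₃ hT)
    sqrt_T := tendsto_of_fst hl hrate₁
    SF_posDef := hD.SF_posDef
    SL_posDef := hD.SL_posDef
    q0_pos := fun j => (hD.q0_mem j).1
    loading := fun j => by
      have h1 := hD.loading_lim j
      simp only [one_div] at h1
      exact tendsto_of_fst hl (h1.comp hN)
    factor := hD.tendsto_facGram hl hT
    freq := fun j => by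
      have h1 := tendsto_of_inMeasure hl hT (hD.regime_freq j)
      simp only [one_div] at h1
      exact h1
    subsets := hD.eventually_subsets hl hT
    ident := hD.eventually_ident hl hN hT
    maxima := h.exists_maxima (by linarith) (by linarith) hN0
    errGram := hD.errGram_isBigO h hN0 hT0
    cross := fun j => by
      refine isBigO_of_sq_le (h.score j) ?_
      filter_upwards [hNT0] with p hp using opNorm_cross_sq_le hp.1 hp.2 j
    Λ_cross := fun j => by
      refine isBigO_of_sq_le (h.mixed j) ?_
      filter_upwards [hNT0] with p hp using opNorm_Λ_cross_sq_le hp.1 hp.2 j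
    labels := by
      refine hl (eventually_whp_of_ae hL_labels) }

/-- The sums that involve unit `i` are of the order that the moment conditions suggest. -/
lemma Conditions.regularUnit (hD : D.Conditions P q0 SF SL Phi α β M) {i : ℕ} {j : Fin J}
    (hi : ∀ n, i < N n) (hT : Tendsto T atTop atTop) (hl : l ≤ whp P)
    (h : D.ModerateUnit P N T j i l) :
    RegularUnit (samples D N T q s2 L) l (fun p => ⟨i, hi p.1⟩) j := by
  obtain ⟨τ, hτ, hτM⟩ := hD.error_cross
  have hT0 : ∀ᶠ p in l, 0 < T p.1 := (tendsto_of_fst hl hT).eventually_gt_atTop 0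
  have hN0 : ∀ p : ℕ × Ω, 0 < N p.1 := fun p => (Nat.zero_le i).trans_lt (hi p.1)
  have hle : ∀ {g : ℕ × Ω → ℝ}, (g =O[l] fun p => √(N p.1 : ℝ) * √(T p.1 : ℝ)) →
      g =O[l] fun p => √(N p.1 : ℝ) * √(T p.1 : ℝ) + T p.1 := fun hg =>
    hg.trans (IsBigO.of_bound 1 (Eventually.of_forall fun p => by
      rw [Real.norm_of_nonneg (by positivity), one_mul, Real.norm_of_nonneg (by positivity)]
      exact le_add_of_nonneg_right (by positivity)))
  have hrow : ∀ p : ℕ × Ω, (samples D N T q s2 L p).errGram j ⟨i, hi p.1⟩ =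
      (fun k : Fin (N p.1) => D.centred P (T p.1) p.2 j i k) +
        fun k : Fin (N p.1) => D.covSum P (T p.1) p.2 j i k := fun p => by
    rw [errGram_sample P]
    rfl
  have hcov : ∀ p : ℕ × Ω, nrm (fun k : Fin (N p.1) => D.covSum P (T p.1) p.2 j i k) ≤
      T p.1 * M := fun p =>
    (nrm_le_sum_abs _).trans (sum_abs_covSum_le hτ hτM (N p.1) (T p.1) p.2 j i)
  have hcovΛ : ∀ p : ℕ × Ω, nrm ((fun k : Fin (N p.1) => D.covSum P (T p.1) p.2 j i k) ᵥ*
      loadMat (N p.1) (D.lam j)) ≤ T p.1 * M * M := by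
    intro p
    have h1 : (fun k : Fin (N p.1) => D.covSum P (T p.1) p.2 j i k) ᵥ*
        loadMat (N p.1) (D.lam j) = ∑ k : Fin (N p.1), D.covSum P (T p.1) p.2 j i k •
          (D.lam j k).ofLp := by
      ext a
      rw [Finset.sum_apply]
      rfl
    rw [h1]
    refine (nrm_sum_le _ _).trans ?_
    refine (Finset.sum_le_sum (g := fun k : Fin (N p.1) => |D.covSum P (T p.1) p.2 j i k| * M)
      fun k _ => ?_).trans ?_
    · rw [nrm_smul, nrm_ofLp]
      exact mul_le_mul_of_nonneg_left (hD.loading_bdd j k) (abs_nonneg _)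
    · rw [← Finset.sum_mul]
      exact mul_le_mul_of_nonneg_right (sum_abs_covSum_le hτ hτM (N p.1) (T p.1) p.2 j i)
        hD.M_nonneg
  have hTO : ∀ K : ℝ, 0 ≤ K → (fun p : ℕ × Ω => (T p.1 : ℝ) * K) =O[l]
      fun p => √(N p.1 : ℝ) * √(T p.1 : ℝ) + T p.1 := fun K hK =>
    IsBigO.of_bound K (Eventually.of_forall fun p => by
      rw [Real.norm_of_nonneg (by positivity), Real.norm_of_nonneg (by positivity), mul_comm]
      exact mul_le_mul_of_nonneg_left (le_add_of_nonneg_left (by positivity)) hK)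
  refine ⟨?_, ?_, ?_, ?_⟩
  · refine IsBigO.of_bound M (Eventually.of_forall fun p => ?_)
    rw [Real.norm_of_nonneg (nrm_nonneg _), norm_one, mul_one]
    exact hD.loading_bdd j i
  · refine isBigO_of_sq_le h.score ?_
    filter_upwards [hT0] with p hp
    have hT0 : (0 : ℝ) < T p.1 := by exact_mod_cast hp
    rw [cross_row_sample, nrm_ofLp, norm_smul, mul_pow, norm_div, norm_one,
      Real.norm_of_nonneg (Real.sqrt_nonneg _), div_pow, Real.sq_sqrt hT0.le]
    refine le_of_eq ?_
    field_simp
  · have h1 : (fun p : ℕ × Ω => nrm fun k : Fin (N p.1) => D.centred P (T p.1) p.2 j i k) =O[l]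
        fun p => √(N p.1 : ℝ) * √(T p.1 : ℝ) := by
      refine isBigO_of_sq_le h.row ?_
      filter_upwards [hT0] with p hp using nrm_centred_row_sq_le P (hN0 p) hp j i
    refine IsBigO.trans (IsBigO.of_bound 1 (Eventually.of_forall fun p => ?_))
      ((hle h1).add (hTO M hD.M_nonneg))
    rw [hrow, Real.norm_of_nonneg (nrm_nonneg _), one_mul]
    exact ((nrm_add_le _ _).trans (add_le_add le_rfl (hcov p))).trans (le_abs_self _)
  · have h1 : (fun p : ℕ × Ω => nrm ((fun k : Fin (N p.1) => D.centred P (T p.1) p.2 j i k) ᵥ*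
        loadMat (N p.1) (D.lam j))) =O[l] fun p => √(N p.1 : ℝ) * √(T p.1 : ℝ) := by
      refine isBigO_of_sq_le h.row_loading ?_
      filter_upwards [hT0] with p hp using nrm_centred_row_loading_sq_le P (hN0 p) hp j i
    refine IsBigO.trans (IsBigO.of_bound 1 (Eventually.of_forall fun p => ?_))
      ((hle h1).add (hTO (M * M) (mul_nonneg hD.M_nonneg hD.M_nonneg)))
    rw [hrow, Real.norm_of_nonneg (nrm_nonneg _), one_mul, add_vecMul]
    refine ((nrm_add_le _ _).trans (add_le_add le_rfl ((hcovΛ p).trans (le_of_eq ?_)))).trans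
      (le_abs_self _)
    ring

end Model

/-! ### Measurability of the estimation error -/

section Measurability

variable {Ω : Type*} [MeasurableSpace Ω] {m n k : ℕ}

/-- A random matrix with measurable entries. -/
def MeasurableEntries (A : Ω → Matrix (Fin m) (Fin n) ℝ) : Prop :=
  ∀ a b, Measurable fun ω => A ω a b

namespace MeasurableEntries

lemma const (A : Matrix (Fin m) (Fin n) ℝ) : MeasurableEntries fun _ : Ω => A :=
  fun _ _ => measurable_const

lemma add {A B : Ω → Matrix (Fin m) (Fin n) ℝ} (hA : MeasurableEntries A)
    (hB : MeasurableEntries B) : MeasurableEntries fun ω => A ω + B ω :=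
  fun a b => (hA a b).add (hB a b)

lemma smul {c : Ω → ℝ} (hc : Measurable c) {A : Ω → Matrix (Fin m) (Fin n) ℝ}
    (hA : MeasurableEntries A) : MeasurableEntries fun ω => c ω • A ω :=
  fun a b => hc.mul (hA a b)

lemma transpose {A : Ω → Matrix (Fin m) (Fin n) ℝ} (hA : MeasurableEntries A) :
    MeasurableEntries fun ω => (A ω)ᵀ :=
  fun a b => hA b a

lemma mul {A : Ω → Matrix (Fin m) (Fin n) ℝ} {B : Ω → Matrix (Fin n) (Fin k) ℝ}
    (hA : MeasurableEntries A) (hB : MeasurableEntries B) :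
    MeasurableEntries fun ω => A ω * B ω := by
  intro a b
  simp only [mul_apply]
  exact Finset.measurable_fun_sum _ fun c _ => (hA a c).mul (hB c b)

lemma mulVec {A : Ω → Matrix (Fin m) (Fin n) ℝ} {x : Ω → Fin n → ℝ}
    (hA : MeasurableEntries A) (hx : ∀ b, Measurable fun ω => x ω b) (a : Fin m) :
    Measurable fun ω => (A ω *ᵥ x ω) a := by
  simp only [Matrix.mulVec, dotProduct]
  exact Finset.measurable_fun_sum _ fun c _ => (hA a c).mul (hx c)

lemma det {A : Ω → Matrix (Fin n) (Fin n) ℝ} (hA : MeasurableEntries A) :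
    Measurable fun ω => (A ω).det := by
  simp only [det_apply]
  exact Finset.measurable_fun_sum _ fun σ _ =>
    (Finset.measurable_fun_prod _ fun a _ => hA _ _).const_smul _

lemma inv {A : Ω → Matrix (Fin n) (Fin n) ℝ} (hA : MeasurableEntries A) :
    MeasurableEntries fun ω => (A ω)⁻¹ := by
  intro a b
  simp only [inv_def, Ring.inverse_eq_inv', Matrix.smul_apply, adjugate_apply, smul_eq_mul]
  refine hA.det.inv.mul (MeasurableEntries.det fun c d => ?_)
  by_cases h : c = b
  · simp only [h, updateRow_self]
    exact measurable_const
  · simp only [updateRow_ne h]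
    exact hA c d

end MeasurableEntries

lemma measurable_gaussDensity {A : Ω → Matrix (Fin m) (Fin n) ℝ} {s : Ω → ℝ} {x : Ω → Fin m → ℝ}
    (hA : MeasurableEntries A) (hs : Measurable s) (hx : ∀ a, Measurable fun ω => x ω a) :
    Measurable fun ω => gaussDensity (A ω) (s ω) (x ω) := by
  have hS : MeasurableEntries fun ω => A ω * (A ω)ᵀ + s ω • (1 : Matrix (Fin m) (Fin m) ℝ) :=
    (hA.mul hA.transpose).add (.smul hs (.const 1))
  exact ((hS.det.pow_const _).const_mul _).mul ((Finset.measurable_fun_sum _ fun a _ =>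
    (hx a).mul (hS.inv.mulVec hx a)).const_mul _).exp

namespace Model

variable {J : ℕ} {r : Fin J → ℕ} (D : Model Ω J r)

lemma measurable_x (N t : ℕ) (i : Fin N) : Measurable fun ω => D.x N ω t i :=
  (D.measurable_of_regime t (g := fun j ω => ⟪D.f j t ω, D.lam j i⟫) fun j =>
    (D.measurable_f j t).inner_const).add (D.measurable_e i t)

variable {N T : ℕ} {q : Ω → Fin J → ℝ} {s2 : Ω → ℝ} {L : Ω → (j : Fin J) → ℕ → Vec (r j)}

lemma measurableEntries_loadMat (hL : ∀ j i, Measurable fun ω => L ω j i) (j : Fin J) :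
    MeasurableEntries fun ω => loadMat N (L ω j) := fun i a =>
  (EuclideanSpace.proj (𝕜 := ℝ) a).continuous.measurable.comp (hL j i)

lemma measurableEntries_factorGram (j : Fin J) :
    MeasurableEntries fun ω => D.factorGram T ω j := by
  intro a b
  simp only [factorGram, of_apply]
  exact Finset.measurable_fun_sum _ fun t _ =>
    (((EuclideanSpace.proj (𝕜 := ℝ) a).continuous.measurable.comp (D.measurable_f j t)).mul
      ((EuclideanSpace.proj (𝕜 := ℝ) b).continuous.measurable.comp (D.measurable_f j t))).mul
      (measurable_ind j t)

lemma measurableEntries_H (hq : ∀ j, Measurable fun ω => q ω j) (hs : Measurable s2)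
    (hL : ∀ j i, Measurable fun ω => L ω j i) (j : Fin J) :
    MeasurableEntries fun ω => D.H N T ω (q ω) (s2 ω) (L ω) j := by
  have hΛ := fun j => measurableEntries_loadMat (N := N) hL j
  have hd : ∀ t k, Measurable fun ω =>
      q ω k * gaussDensity (loadMat N (L ω k)) (s2 ω) (D.x N ω t) := fun t k =>
    (hq k).mul (measurable_gaussDensity (hΛ k) hs (D.measurable_x N t))
  have hp : ∀ t, Measurable fun ω =>
      postProb (q ω) (s2 ω) (fun k => loadMat N (L ω k)) (D.x N ω t) j := fun t =>
    (hd t j).div (Finset.measurable_fun_sum _ fun k _ => hd t k)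
  have hW : MeasurableEntries fun ω => D.W N T ω (q ω) (s2 ω) (L ω) j :=
    .smul ((Finset.measurable_fun_sum _ fun t _ => hp t).const_mul _)
      ((MeasurableEntries.smul measurable_const ((hΛ j).transpose.mul (hΛ j))).add
        (.smul (hs.div_const _) (.const 1)))
  exact ((MeasurableEntries.smul measurable_const (D.measurableEntries_factorGram j)).mul
    (.smul measurable_const ((MeasurableEntries.const _).mul (hΛ j)))).mul hW.inv

lemma measurable_estimation_error (hq : ∀ j, Measurable fun ω => q ω j) (hs : Measurable s2)
    (hL : ∀ j i, Measurable fun ω => L ω j i) (c : ℝ) (j : Fin J) (i : ℕ) :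
    Measurable fun ω => c • (L ω j i - WithLp.toLp 2
      ((D.H N T ω (q ω) (s2 ω) (L ω) j)ᵀ *ᵥ (D.lam j i).ofLp)) := by
  refine ((hL j i).sub ((WithLp.measurable_toLp 2 _).comp
    (measurable_pi_lambda _ fun a => ?_))).const_smul c
  exact (D.measurableEntries_H hq hs hL j).transpose.mulVec
    (x := fun _ => (D.lam j i).ofLp) (fun _ => measurable_const) a

end Model

end Measurability

/-! ### The limit distribution -/

/-- A linear image of a centred Gaussian vector is Gaussian. -/
lemma map_multivariateGaussian {m n : ℕ} (A : Matrix (Fin m) (Fin n) ℝ)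
    {S : Matrix (Fin n) (Fin n) ℝ} (hS : S.PosSemidef) :
    (multivariateGaussian 0 S).map (fun x => WithLp.toLp 2 (A *ᵥ x.ofLp)) =
      multivariateGaussian 0 (A * S * Aᵀ) := by
  have hg : Measurable fun x : EuclideanSpace ℝ (Fin n) => WithLp.toLp 2 (A *ᵥ x.ofLp) := by
    refine Continuous.measurable ?_
    fun_prop
  have : IsProbabilityMeasure ((multivariateGaussian 0 S).map
    fun x => WithLp.toLp 2 (A *ᵥ x.ofLp)) := Measure.isProbabilityMeasure_map hg.aemeasurable
  have hS' : (A * S * Aᵀ).PosSemidef := by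
    have := hS.mul_mul_conjTranspose_same A
    rwa [conjTranspose_eq_transpose_of_trivial] at this
  refine Measure.ext_of_charFun (funext fun t => ?_)
  have h1 : charFun ((multivariateGaussian 0 S).map fun x => WithLp.toLp 2 (A *ᵥ x.ofLp)) t =
      charFun (multivariateGaussian 0 S) (WithLp.toLp 2 (Aᵀ *ᵥ t.ofLp)) := by
    rw [charFun_apply, charFun_apply, integral_map hg.aemeasurable (by fun_prop)]
    refine integral_congr_ae (Eventually.of_forall fun x => ?_)
    have : ⟪WithLp.toLp 2 (A *ᵥ x.ofLp), t⟫ = ⟪x, WithLp.toLp 2 (Aᵀ *ᵥ t.ofLp)⟫ := by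
      simp only [EuclideanSpace.inner_eq_star_dotProduct, star_trivial]
      rw [dotProduct_mulVec, ← vecMul_transpose, transpose_transpose]
    simp only [this]
  rw [h1, charFun_multivariateGaussian hS, charFun_multivariateGaussian hS']
  simp only [inner_zero_right]
  congr 4
  rw [← vecMul_transpose, transpose_transpose, ← dotProduct_mulVec, mulVec_vecMul]
  simp only [mulVec_mulVec, Matrix.mul_assoc]

namespace Model

variable {Ω : Type*} [MeasurableSpace Ω] {J : ℕ} {r : Fin J → ℕ} {D : Model Ω J r}
  {P : Measure Ω} [IsProbabilityMeasure P] {q0 : Fin J → ℝ}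
  {SF SL U : (j : Fin J) → Matrix (Fin (r j)) (Fin (r j)) ℝ} {v : (j : Fin J) → Fin (r j) → ℝ}
  {Phi : (j : Fin J) → ℕ → Matrix (Fin (r j)) (Fin (r j)) ℝ} {α β M : ℝ}

/-- The limit of the distribution of the leading term. -/
lemma Conditions.tendsto_leading (hD : D.Conditions P q0 SF SL Phi α β M) {T : ℕ → ℕ}
    (hT : Tendsto T atTop atTop) (j : Fin J) (i : ℕ) :
    TendstoInDistribution (fun n ω => WithLp.toLp 2
      ((diagonal (fun a => (√(v j a))⁻¹) * (U j)ᵀ * CFC.sqrt (SL j)) *ᵥ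
        ((1 / √(T n * q0 j)) • D.score (T n) ω j i).ofLp))
      atTop id (fun _ => P)
      (multivariateGaussian 0 (limitCov (SL j) (v j) (U j) (Phi j i))) := by
  set A := diagonal (fun a => (√(v j a))⁻¹) * (U j)ᵀ * CFC.sqrt (SL j) with hA
  have hg : Continuous fun x : Vec (r j) => WithLp.toLp 2 (A *ᵥ x.ofLp) := by fun_prop
  have h1 := (hD.clt_score j i).continuous_comp hg
  have hcov : limitCov (SL j) (v j) (U j) (Phi j i) = A * Phi j i * Aᵀ := by
    rw [hA, limitCov]
    simp only [transpose_mul, transpose_transpose, diagonal_transpose, transpose_sqrt,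
      Matrix.mul_assoc]
  refine ⟨fun n => h1.forall_aemeasurable (T n), by fun_prop, ?_⟩
  refine (h1.tendsto.comp hT).mono_right (le_of_eq (congrArg 𝓝 (Subtype.ext ?_)))
  change Measure.map _ _ = Measure.map _ _
  rw [Measure.map_id, hcov]
  exact map_multivariateGaussian A (hD.Phi_posSemidef j i)

variable {N T : ℕ → ℕ} {q : ℕ → Ω → Fin J → ℝ} {s2 : ℕ → Ω → ℝ}
  {L : ℕ → Ω → (j : Fin J) → ℕ → Vec (r j)}

/-- The difference between the estimation error and its leading term tends to zero in
probability. -/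
lemma Conditions.tendsto_remainder (hD : D.Conditions P q0 SF SL Phi α β M)
    (hU : ∀ j, IsEigen (SF j) (SL j) (v j) (U j))
    (hN : Tendsto N atTop atTop) (hT : Tendsto T atTop atTop)
    (hrate₁ : Tendsto (fun n => √(T n : ℝ) / (N n : ℝ)) atTop (𝓝 0))
    (hrate₂ : Tendsto (fun n => (T n : ℝ) ^ (16 / α) / (N n : ℝ)) atTop (𝓝 0))
    (hrate₃ : Tendsto (fun n => (T n : ℝ) ^ (2 / α + 2 / β) / (N n : ℝ)) atTop (𝓝 0))
    (hq_sum : ∀ n ω, ∑ j, q n ω j = 1) (hq_pos : ∃ c : ℝ, 0 < c ∧ ∀ n ω j, c ≤ q n ω j)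
    (hs2_pos : ∀ n ω, 0 < s2 n ω)
    (hs2_tight : ∀ ε : ℝ, 0 < ε → ∃ c : ℝ, 0 < c ∧
      ∀ᶠ n in atTop, P {ω | s2 n ω < c ∨ c⁻¹ < s2 n ω} ≤ ENNReal.ofReal ε)
    (hL_max : ∀ n, ∀ᵐ ω ∂P, D.IsQMLE (N n) (T n) ω (q n ω) (s2 n ω) (L n ω))
    (hL_aligned : ∀ n, ∀ᵐ ω ∂P, D.Aligned SL U (N n) (L n ω)) (j : Fin J) {i : ℕ}
    (hi : ∀ n, i < N n) :
    TendstoInMeasure P (fun n ω => √((T n : ℝ) * q0 j) • (L n ω j i -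
        WithLp.toLp 2 ((D.H (N n) (T n) ω (q n ω) (s2 n ω) (L n ω) j)ᵀ *ᵥ (D.lam j i).ofLp)) -
      WithLp.toLp 2 ((diagonal (fun a => (√(v j a))⁻¹) * (U j)ᵀ * CFC.sqrt (SL j)) *ᵥ
        ((1 / √(T n * q0 j)) • D.score (T n) ω j i).ofLp)) atTop fun _ => 0 := by
  rw [← tendsto_whp_iff, tendsto_zero_iff_norm_tendsto_zero]
  refine ((hD.inProb_moderate N T hs2_pos hs2_tight).and
    (hD.inProb_moderateUnit T j hi)).tendsto fun l hl h => ?_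
  obtain ⟨c, hreg⟩ := hD.regular hN hT hrate₁ hrate₂ hrate₃ hq_sum hq_pos hs2_pos hL_max
    (fun n => (hL_aligned n).mono fun ω h => h.labels) hl h.1
  have ho : ∀ᶠ p in whp P, (samples D N T q s2 L p).Oriented SL U :=
    eventually_whp_of_ae fun n => by
      filter_upwards [hL_max n, hL_aligned n] with ω h1 h2 using ⟨h1.order, h2.signs⟩
  refine (hreg.tendsto_expansion hU (hl ho) (hD.regularUnit hi hT hl h.2)).congr fun p => ?_
  rw [H_sample, cross_row_sample, ← one_div]
  rfl

end Model

end Analysis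
end RegimeFactor

theorem theorem4 {Ω : Type*} [MeasurableSpace Ω] (P : Measure Ω) [IsProbabilityMeasure P]
    {J : ℕ} {r : Fin J → ℕ} (D : RegimeFactor.Model Ω J r)
    (q0 : Fin J → ℝ) (SF SL : (j : Fin J) → Matrix (Fin (r j)) (Fin (r j)) ℝ)
    (Phi : (j : Fin J) → ℕ → Matrix (Fin (r j)) (Fin (r j)) ℝ) (α β M : ℝ)
    (hD : D.Conditions P q0 SF SL Phi α β M)
    -- the eigenvalues of `Σ_{Λ_j}^{1/2} Σ_{F_j} Σ_{Λ_j}^{1/2}` are distinct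
    (v : (j : Fin J) → Fin (r j) → ℝ) (U : (j : Fin J) → Matrix (Fin (r j)) (Fin (r j)) ℝ)
    (hU : ∀ j, RegimeFactor.IsEigen (SF j) (SL j) (v j) (U j))
    -- `(N, T) → ∞` jointly, at the required relative rates
    (N T : ℕ → ℕ) (hN : Tendsto N atTop atTop) (hT : Tendsto T atTop atTop)
    (hrate₁ : Tendsto (fun n => √(T n : ℝ) / (N n : ℝ)) atTop (𝓝 0))
    (hrate₂ : Tendsto (fun n => (T n : ℝ) ^ (16 / α) / (N n : ℝ)) atTop (𝓝 0))
    (hrate₃ : Tendsto (fun n => (T n : ℝ) ^ (2 / α + 2 / β) / (N n : ℝ)) atTop (𝓝 0))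
    -- mixture weights bounded away from zero
    (q : ℕ → Ω → Fin J → ℝ) (hq_meas : ∀ n j, Measurable fun ω => q n ω j)
    (hq_sum : ∀ n ω, ∑ j, q n ω j = 1)
    (hq_pos : ∃ c : ℝ, 0 < c ∧ ∀ n ω j, c ≤ q n ω j)
    -- the estimate of `σ²`: bounded and bounded away from zero in probability
    (s2 : ℕ → Ω → ℝ) (hs2_meas : ∀ n, Measurable (s2 n)) (hs2_pos : ∀ n ω, 0 < s2 n ω)
    (hs2_tight : ∀ ε : ℝ, 0 < ε → ∃ c : ℝ, 0 < c ∧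
      ∀ᶠ n in atTop, P {ω | s2 n ω < c ∨ c⁻¹ < s2 n ω} ≤ ENNReal.ofReal ε)
    -- the estimated loadings
    (L : ℕ → Ω → (j : Fin J) → ℕ → RegimeFactor.Vec (r j))
    (hL_meas : ∀ n j i, Measurable fun ω => L n ω j i)
    (hL_max : ∀ n, ∀ᵐ ω ∂P, D.IsQMLE (N n) (T n) ω (q n ω) (s2 n ω) (L n ω))
    (hL_aligned : ∀ n, ∀ᵐ ω ∂P, D.Aligned SL U (N n) (L n ω)) (j : Fin J) (i : ℕ) :
    TendstoInDistribution
      (fun n ω => √((T n : ℝ) * q0 j) • (L n ω j i -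
        WithLp.toLp 2 ((D.H (N n) (T n) ω (q n ω) (s2 n ω) (L n ω) j).transpose.mulVec
          (D.lam j i).ofLp)))
      atTop id (fun _ => P)
      (multivariateGaussian 0 (RegimeFactor.limitCov (SL j) (v j) (U j) (Phi j i))) := by
  have hX := hD.tendsto_leading (v := v) (U := U) hT j i
  refine tendstoInDistribution_of_tendstoInMeasure_sub _ _ hX ?_ fun n =>
    (D.measurable_estimation_error (hq_meas n) (hs2_meas n) (hL_meas n) _ j i).aemeasurable
  -- The unit `i` belongs to the sample from some point on.
  obtain ⟨n₀, hn₀⟩ := eventually_atTop.1 (hN.eventually_gt_atTop i)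
  have hshift := tendsto_add_atTop_nat n₀
  have hR := hD.tendsto_remainder hU (hN.comp hshift) (hT.comp hshift) (hrate₁.comp hshift)
    (hrate₂.comp hshift) (hrate₃.comp hshift) (q := fun n => q (n + n₀))
    (s2 := fun n => s2 (n + n₀)) (L := fun n => L (n + n₀)) (fun n => hq_sum _)
    (hq_pos.imp fun c h => ⟨h.1, fun n => h.2 _⟩) (fun n => hs2_pos _)
    (fun ε hε => (hs2_tight ε hε).imp fun c h => ⟨h.1, hshift.eventually h.2⟩)
    (fun n => hL_max _) (fun n => hL_aligned _) j (fun n => hn₀ _ (Nat.le_add_left _ _))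
  exact fun ε hε => (tendsto_add_atTop_iff_nat n₀).1 (hR ε hε)
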